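/- **Index sets.** A finite family $S$ of finite sequences of positive integers is given (at first $S=\{\emptyset\}$). Let $n$ be the largest length of an element of $S$ and $c$ the largest integer occurring in it ($c=0$ if none occurs); write $I\in S$ as $I=(I_m,\dots,I_n)$, so that $m=n+1-\#I$ (and $m=n+1$ for $I=\emptyset$). Put $G^+(I)=(I_m,\dots,I_n,c+1)$ and $G(S)=G^+(S)\cup\{\emptyset\}$. For $\varepsilon\in\{1,2\}$ put $$F_j^{\varepsilon}(I)=(I_m+\varepsilon c,\dots,I_j+\varepsilon c,\,I_j,\dots,I_n,\,3c+1)\quad (m\le j\le n),\qquad F_j^\varepsilon(I)=(I_m,\dots,I_n,3c+1)\quad (1\le j<m,\ j\le n),$$ $$F_{n+1}^{\varepsilon}(I)=(I_m+\varepsilon c,\dots,I_n+\varepsilon c,\,3c+1+\varepsilon,\,3c+1).$$ Let $\widetilde F_j^{\varepsilon}(I)$ be $F_j^\varepsilon(I)$ with $3c+3$ added to every integer, $F_j(S)=F_j^1(S)\cup F_j^2(S)\cup\widetilde F_j^1(S)\cup\widetilde F_j^2(S)$ for $1\le j\le n+1$, and $F(S)=\bigcup_{1\le j\le n+1}F_j(S)$.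 For a finite sequence $H=(H_1,\dots,H_k)$ of symbols among $F$, $G$, $F_j$ (each $F_j$ being used with $1\le j\le n+1$, for the $n$ of the family to which it is applied) let $J_H=H_k\circ\dots\circ H_1(\{\emptyset\})$, let $n$ be the largest length of an element of $J_H$, and $J_H^h=\{I\in J_H:\#I=n-h\}$. Let $\mathcal A_d=\mathbb C\langle X_1,\dots,X_d\rangle$ and $\mathcal A_d^H=\mathbb C\langle X_{i,I}: 1\le i\le d,\ I\in J_H\rangle$. For a map $f$ from $J_H$ to $J_{H'}$, $P(f(X))$ is $P$ with each $X_{i,I}$ replaced by $X_{i,f(I)}$. **Derivatives.** $\partial_{i,I}:\mathcal A_d^H\to\mathcal A_d^H\otimes\mathcal A_d^H$ is the linear map with $\partial_{i,I}(PQ)=\partial_{i,I}P\,(1\otimes Q)+(P\otimes 1)\,\partial_{i,I}Q$ and $\partial_{i,I}X_{k,K}=\mathbf 1_{i=k}\mathbf 1_{I=K}\,1\otimes1$; $\partial_{i,h}=\sum_{I\in J_H^h}\partial_{i,I}$ and $\mathcal D_{i,h}=m\circ\partial_{i,h}$ with $m(A\otimes B)=BA$. On $\mathcal A_d$, $\partial_i$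 and $\mathcal D_i=m\circ\partial_i$ are defined in the same way. **Setting.** Let $N\ge1$. Let $(\mathcal A,\tau)$ be a tracial $C^*$-probability space, $\mathcal A_N=M_N(\mathcal A)\supset M_N(\mathbb C)$ and $\tau_N=\tau\circ\frac1N\mathrm{tr}_N$. Let $x=x^0,x^1,x^2,\dots$ be an infinite sequence of free semicircular systems of $d$ variables in $(\mathcal A_N,\tau_N)$, freely independent of each other and of $M_N(\mathbb C)$. Let $X^N=(X_1^N,\dots,X_d^N)$ be independent GUE random matrices (Hermitian; $\sqrt N X_{r,r}$, $\sqrt{2N}\,\Re X_{r,s}$, $\sqrt{2N}\,\Im X_{r,s}$, $r<s$, are independent standard real Gaussians). Let $V\in\mathcal A_d$ be such that $\mathbb E\big[\big|\frac1N\mathrm{tr}_N(Q(X^N))\,e^{-N\mathrm{tr}_N(V(X^N))}\big|\big]<\infty$ for every $Q\in\mathcal A_d$. For a sequence $T_n=(t_1,\dots,t_n)$ of non-negative numbers let $\widetilde t_1\le\dots\le\widetilde t_n$ be its increasing rearrangement and $\widetilde t_0=0$, and for $I=(I_m,\dots,I_n)\in J_H$ put $$X^{N,T_n}_{i,I}=e^{\widetilde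 t_{m-1}/2}\Big(\sum_{l=m}^n(e^{-\widetilde t_{l-1}}-e^{-\widetilde t_l})^{1/2}x_i^{I_l}+e^{-\widetilde t_n/2}X_i^N\Big),\quad x^{T_n}_{i,I}=e^{\widetilde t_{m-1}/2}\Big(\sum_{l=m}^n(e^{-\widetilde t_{l-1}}-e^{-\widetilde t_l})^{1/2}x_i^{I_l}+e^{-\widetilde t_n/2}x_i\Big).$$ The same definitions are used for $J_{\{H,G\}}$ with $T_{n+1}=(T_n,t_{n+1})$ and for $J_{\{H,F\}}$ with $T_{n+2}=(T_{n+1},t_{n+2})$. **Operators.** $\nabla_V^{H,T_{n+1}}:\mathcal A_d^H\to\mathcal A_d^{\{H,G\}}$ is $$\nabla_V^{H,T_{n+1}}(Q)=\frac12\sum_{i=1}^d\sum_{h=0}^n e^{(\widetilde t_h-t_{n+1})/2}\ \mathcal D_{i,h}Q(G^+(X))\ \mathcal D_iV(X^\emptyset),\qquad X^\emptyset=(X_{i,\emptyset})_i .$$ For $1\le s\le n+1$, $L_s^{H,T_{n+2}}:\mathcal A_d^H\to\mathcal A_d^{\{H,F_s\}}$ is $$L_s^{H,T_{n+2}}(Q)=\frac12\sum_{i,j=1}^d\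 \sum_{\substack{0\le h,k\le n\\0\le p,q\le s-1}}e^{(\widetilde t_h+\widetilde t_k+\widetilde t_p+\widetilde t_q)/2-t_{n+1}-t_{n+2}}\sum_{\substack{I\in J_H^p,\ J\in J_H^q\\ I_s=J_s}}\Theta_s\big([\partial_{j,I}\otimes\partial_{j,J}]\circ\partial_{i,k}\circ\mathcal D_{i,h}Q\big),$$ where $\widetilde t_0,\dots,\widetilde t_n$ are those of $T_n$, the condition $I_s=J_s$ is void for $s=n+1$, and $\Theta_s(A\otimes B\otimes C\otimes D)=B(F_s^1(X))\,A(\widetilde F_s^1(X))\,D(\widetilde F_s^2(X))\,C(F_s^2(X))$. Finally $L^{H,T_{n+2}}(Q)=\sum_{s=1}^{n+1}\mathbf 1_{[\widetilde t_{s-1},\widetilde t_s]}(t_{n+2})\,L_s^{H,T_{n+2}}(Q)\in\mathcal A_d^{\{H,F\}}$, where here $\widetilde t_s$ is the $s$-th smallest element of $T_{n+1}$. **Theorem (master equation).** For every such $H$, every $P\in\mathcal A_d^H$ and every sequence $T_n$ of $n$ non-negative numbers, all the expectations and time integrals below converge absolutely, and $$\begin{aligned}\mathbb E\big[\tau_N(P(X^{N,T_n}))\,e^{-N\mathrm{tr}_N(V(X^N))}\big]={}&\tau_N(P(x^{T_n}))\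 \mathbb E\big[e^{-N\mathrm{tr}_N(V(X^N))}\big]\\&-\int_{\widetilde t_n}^\infty\mathbb E\big[\tau_N\big(\nabla_V^{H,T_{n+1}}(P)(X^{N,T_{n+1}})\big)e^{-N\mathrm{tr}_N(V(X^N))}\big]dt_{n+1}\\&+\frac1{N^2}\int_{\widetilde t_n}^\infty\int_0^{t_{n+1}}\mathbb E\big[\tau_N\big(L^{H,T_{n+2}}(P)(X^{N,T_{n+2}})\big)e^{-N\mathrm{tr}_N(V(X^N))}\big]dt_{n+2}\,dt_{n+1}.\end{aligned}$$ -/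

import Mathlib

open MeasureTheory ProbabilityTheory
open scoped TensorProduct

namespace MasterEquation

noncomputable section

/-! ## Free probability -/

/-- `τ` is a trace turning the C*-algebra `A` into a C*-probability space. -/
structure IsTrace {A : Type*} [CStarAlgebra A] (τ : A →L[ℂ] ℂ) : Prop where
  map_one : τ 1 = 1
  nonneg : ∀ a : A, 0 ≤ (τ (star a * a)).re ∧ (τ (star a * a)).im = 0
  mul_comm : ∀ a b : A, τ (a * b) = τ (b * a)

/-- Freeness of a family of unital *-subalgebras with respect to a linear functional `φ`: every
nonempty product of centred elements, neighbouring ones coming from different subalgebras,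
is centred. -/
def IsFree {B : Type*} [Ring B] [StarRing B] [Algebra ℂ B] [StarModule ℂ B] (φ : B →ₗ[ℂ] ℂ)
    {ι : Type*} (S : ι → StarSubalgebra ℂ B) : Prop :=
  ∀ (k : ℕ) (j : Fin (k + 1) → ι) (a : Fin (k + 1) → B),
    (∀ r, a r ∈ S (j r)) → (∀ r : Fin k, j r.castSucc ≠ j r.succ) →
      φ (List.ofFn fun r => a r - algebraMap ℂ B (φ (a r))).prod = 0

/-- `b` is a (standard) semicircular element: it is self-adjoint, and its moments are those of the
semicircle distribution on `[-2, 2]`. -/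
structure IsSemicircular {B : Type*} [Ring B] [StarRing B] [Algebra ℂ B] (φ : B →ₗ[ℂ] ℂ)
    (b : B) : Prop where
  isSelfAdjoint : IsSelfAdjoint b
  moment : ∀ k : ℕ, φ (b ^ k) =
    ((∫ t in (-2 : ℝ)..2, t ^ k * (1 / (2 * Real.pi) * Real.sqrt (4 - t ^ 2)) : ℝ) : ℂ)

section Matrices

variable {A : Type*} [CStarAlgebra A] (N : ℕ)

/-- The trace `τ_N = τ ∘ (1/N) tr_N` on `M_N(A)`. -/
def traceN (τ : A →L[ℂ] ℂ) : Matrix (Fin N) (Fin N) A →ₗ[ℂ] ℂ :=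
  (1 / (N : ℂ)) • ((τ : A →ₗ[ℂ] ℂ) ∘ₗ Matrix.traceLinearMap (Fin N) ℂ A)

variable (A) in
/-- The embedding of `M_N(ℂ)` into `M_N(A)`, `(a_{rs}) ↦ (a_{rs} 1)`. -/
def matEmb : Matrix (Fin N) (Fin N) ℂ →⋆ₐ[ℂ] Matrix (Fin N) (Fin N) A where
  toAlgHom := (Algebra.ofId ℂ A).mapMatrix
  map_star' M := by
    ext r s
    have h := algebraMap_star_comm (A := A) (M s r)
    simpa [Matrix.star_apply, Algebra.ofId_apply] using h

/-- `x 0, x 1, x 2, …` is an infinite sequence of free semicircular systems of `d` variables in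
`M_N(A)`, freely independent of each other and of `M_N(ℂ)`. (By associativity of freeness, this
is the freeness of `M_N(ℂ)` and all of the algebras generated by a single `x k i`.) -/
structure IsFreeSemicircularSequence (τ : A →L[ℂ] ℂ) {d : ℕ}
    (x : ℕ → Fin d → Matrix (Fin N) (Fin N) A) : Prop where
  semicircular : ∀ k i, IsSemicircular (traceN N τ) (x k i)
  free : IsFree (traceN N τ) (fun o : Option (ℕ × Fin d) =>
    o.elim (matEmb A N).range (fun p => StarAlgebra.adjoin ℂ {x p.1 p.2}))

end Matrices

/-! ## GUE matrices -/

/-- The suitably rescaled real coordinates of a Hermitian matrix of size `N`: the diagonal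
entries, and the real (above the diagonal) and imaginary (stored below the diagonal) parts of the
entries above the diagonal. -/
def gueCoord {N : ℕ} (M : Matrix (Fin N) (Fin N) ℂ) (p : Fin N × Fin N) : ℝ :=
  if p.1 = p.2 then Real.sqrt N * (M p.1 p.1).re
  else if p.1 < p.2 then Real.sqrt (2 * N) * (M p.1 p.2).re
  else Real.sqrt (2 * N) * (M p.2 p.1).im

/-- `X` is a `d`-tuple of independent GUE random matrices of size `N`. -/
structure IsGUETuple {Ω : Type*} [MeasurableSpace Ω] (μ : Measure Ω) {N d : ℕ}
    (X : Fin d → Ω → Matrix (Fin N) (Fin N) ℂ) : Prop where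
  measurable_entry : ∀ i r s, Measurable fun ω => X i ω r s
  isHermitian : ∀ i ω, (X i ω).IsHermitian
  law : ∀ i p, μ.map (fun ω => gueCoord (X i ω) p) = gaussianReal 0 1
  indep : iIndepFun (fun (q : Fin d × (Fin N × Fin N)) ω => gueCoord (X q.1 ω) q.2) μ

/-! ## Index sets

An index `I = {I_m, …, I_n}` is the list `[I_m, …, I_n]`; `m` is recovered from the length
`n - m + 1`. The empty list is the index `∅`, with `m = n + 1`. -/

/-- `c_S`, the largest of the integers that occur in the elements of `S`. -/
def maxLabel (S : Finset (List ℕ)) : ℕ := S.sup fun I => I.foldr max 0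

/-- The largest cardinality of the elements of `S`. -/
def depth (S : Finset (List ℕ)) : ℕ := S.sup List.length

/-- The `m` in `I = {I_m, …, I_n}`. -/
def startIdx (n : ℕ) (I : List ℕ) : ℕ := n + 1 - I.length

/-- The entry `I_l` of `I = {I_m, …, I_n}`, for `m ≤ l ≤ n`. -/
def entry (n : ℕ) (I : List ℕ) (l : ℕ) : ℕ := I.getD (l - startIdx n I) 0

/-- `I ↦ {I_m, …, I_n, c + 1}`. -/
def gPlus (S : Finset (List ℕ)) (I : List ℕ) : List ℕ := I ++ [maxLabel S + 1]

/-- `G(S) = G⁺(S) ∪ {∅}`. -/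
def setG (S : Finset (List ℕ)) : Finset (List ℕ) := S.image (gPlus S) ∪ {[]}

/-- The common shape of the maps `F_j^1` and `F_j^2`. For `1 ≤ j ≤ n`,
`I ↦ {I_m + a, …, I_j + a, I_j, …, I_n, 3c + 1}`, where nothing is shifted or
inserted if `j < m`; for `j = n + 1`, `I ↦ {I_m + a, …, I_n + a, b, 3c + 1}`. -/
def fBase (S : Finset (List ℕ)) (j a b : ℕ) (I : List ℕ) : List ℕ :=
  let n := depth S
  let m := startIdx n I
  if j ≤ n then
    if m ≤ j then
      (I.take (j + 1 - m)).map (· + a) ++ I.drop (j - m) ++ [3 * maxLabel S + 1]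
    else I ++ [3 * maxLabel S + 1]
  else I.map (· + a) ++ [b, 3 * maxLabel S + 1]

/-- `F_j^1`. -/
def f1 (S : Finset (List ℕ)) (j : ℕ) : List ℕ → List ℕ :=
  fBase S j (maxLabel S) (3 * maxLabel S + 2)

/-- `F_j^2`. -/
def f2 (S : Finset (List ℕ)) (j : ℕ) : List ℕ → List ℕ :=
  fBase S j (2 * maxLabel S) (3 * maxLabel S + 3)

/-- `F_j^1` with `3c + 3` added to every integer. -/
def f1t (S : Finset (List ℕ)) (j : ℕ) (I : List ℕ) : List ℕ :=
  (f1 S j I).map (· + (3 * maxLabel S + 3))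

/-- `F_j^2` with `3c + 3` added to every integer. -/
def f2t (S : Finset (List ℕ)) (j : ℕ) (I : List ℕ) : List ℕ :=
  (f2 S j I).map (· + (3 * maxLabel S + 3))

/-- `F_j(S)`. -/
def setFj (S : Finset (List ℕ)) (j : ℕ) : Finset (List ℕ) :=
  S.image (f1 S j) ∪ S.image (f2 S j) ∪ S.image (f1t S j) ∪ S.image (f2t S j)

/-- `F(S)`, the union of the `F_j(S)` for `1 ≤ j ≤ n + 1`. -/
def setF (S : Finset (List ℕ)) : Finset (List ℕ) :=
  (Finset.Icc 1 (depth S + 1)).biUnion (setFj S)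

/-- The symbols `F`, `G` and `F_j` of which a sequence `H` consists. -/
inductive Step where
  | F : Step
  | G : Step
  | Fj (j : ℕ) : Step

/-- The map on families of indices denoted by a symbol. -/
def Step.apply : Step → Finset (List ℕ) → Finset (List ℕ)
  | .F, S => setF S
  | .G, S => setG S
  | .Fj j, S => setFj S j

/-- `J_H = H_k ∘ ⋯ ∘ H_1 ({∅})` for `H = [H_1, …, H_k]`. -/
def indexSet (H : List Step) : Finset (List ℕ) := H.foldl (fun S h => h.apply S) {[]}

theorem indexSet_concat (H : List Step) (h : Step) :
    indexSet (H ++ [h]) = h.apply (indexSet H) := by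
  simp [indexSet]

/-- Every `F_j` in `H` is applied with `1 ≤ j ≤ n + 1`, where `n` is the largest cardinality of the
elements of the family to which it is applied. -/
def Admissible (H : List Step) : Prop :=
  ∀ (H' : List Step) (j : ℕ), (H' ++ [Step.Fj j]) <+: H →
    1 ≤ j ∧ j ≤ depth (indexSet H') + 1

/-! ## Noncommutative polynomials and derivatives -/

/-- Noncommutative polynomials in the variables `X_{i,I}`, `1 ≤ i ≤ d`, `I ∈ S`. For `S = J_H`
this is `𝒜_d^H`; adding a symbol to `H` replaces `J_H` by `setG J_H`, `setF J_H` or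
`setFj J_H j`. -/
abbrev Poly (d : ℕ) (S : Finset (List ℕ)) : Type := FreeAlgebra ℂ (Fin d × S)

section Derivatives

variable {Y : Type*} [DecidableEq Y]

/-- The algebra homomorphism sending `P` to the upper triangular matrix with diagonal
`P ⊗ 1, 1 ⊗ P` and off-diagonal entry `∂_v P`. -/
def derivHom (v : Y) : FreeAlgebra ℂ Y →ₐ[ℂ]
    Matrix (Fin 2) (Fin 2) (FreeAlgebra ℂ Y ⊗[ℂ] FreeAlgebra ℂ Y) :=
  FreeAlgebra.lift ℂ fun w =>
    !![FreeAlgebra.ι ℂ w ⊗ₜ 1, if v = w then 1 else 0; 0, 1 ⊗ₜ FreeAlgebra.ι ℂ w]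

/-- The noncommutative derivative `∂_v` with respect to the variable `v`; it is characterised by
`ncDeriv_ι` and the Leibniz rule `ncDeriv_mul`. -/
def ncDeriv (v : Y) : FreeAlgebra ℂ Y →ₗ[ℂ] FreeAlgebra ℂ Y ⊗[ℂ] FreeAlgebra ℂ Y :=
  Matrix.entryLinearMap ℂ _ (0 : Fin 2) (1 : Fin 2) ∘ₗ (derivHom v).toLinearMap

/-- The map `m (A ⊗ B) = B A`; the cyclic derivative is `𝒟_v = m ∘ ∂_v`. -/
def mulOp {B : Type*} [Ring B] [Algebra ℂ B] : B ⊗[ℂ] B →ₗ[ℂ] B :=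
  TensorProduct.lift (LinearMap.mul ℂ B).flip

theorem mulOp_tmul {B : Type*} [Ring B] [Algebra ℂ B] (a b : B) :
    mulOp (a ⊗ₜ[ℂ] b) = b * a := rfl

theorem ncDeriv_ι (v w : Y) : ncDeriv v (FreeAlgebra.ι ℂ w) = if v = w then 1 else 0 := by
  simp [ncDeriv, derivHom]

theorem derivHom_diag (v : Y) (P : FreeAlgebra ℂ Y) :
    derivHom v P 0 0 = P ⊗ₜ 1 ∧ derivHom v P 1 0 = 0 ∧ derivHom v P 1 1 = 1 ⊗ₜ P := by
  induction P using FreeAlgebra.induction with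
  | grade0 r =>
    refine ⟨?_, ?_, ?_⟩ <;>
      simp [Algebra.algebraMap_eq_smul_one, TensorProduct.smul_tmul', TensorProduct.tmul_smul,
        Algebra.TensorProduct.one_def]
  | grade1 w => simp [derivHom]
  | mul a b ha hb =>
    simp [Matrix.mul_apply, ha, hb, Algebra.TensorProduct.tmul_mul_tmul]
  | add a b ha hb => simp [ha, hb, TensorProduct.add_tmul, TensorProduct.tmul_add]

theorem ncDeriv_mul (v : Y) (P Q : FreeAlgebra ℂ Y) :
    ncDeriv v (P * Q) = ncDeriv v P * (1 ⊗ₜ Q) + (P ⊗ₜ 1) * ncDeriv v Q := by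
  simp [ncDeriv, Matrix.mul_apply, derivHom_diag, add_comm]

end Derivatives

section Operators

variable {d : ℕ}

/-- `J^h = {I ∈ J | #I = n - h}`. -/
def level (S : Finset (List ℕ)) (h : ℕ) : Finset S :=
  Finset.univ.filter fun I => I.1.length + h = depth S

/-- `∂_{i,h}`, the sum of the `∂_{i,I}` over `I ∈ J^h`. -/
def ncDerivLevel (S : Finset (List ℕ)) (i : Fin d) (h : ℕ) :
    Poly d S →ₗ[ℂ] Poly d S ⊗[ℂ] Poly d S :=
  ∑ I ∈ level S h, ncDeriv (i, I)

/-- The cyclic derivative `𝒟_{i,h} = m ∘ ∂_{i,h}`. -/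
def cycDerivLevel (S : Finset (List ℕ)) (i : Fin d) (h : ℕ) : Poly d S →ₗ[ℂ] Poly d S :=
  mulOp ∘ₗ ncDerivLevel S i h

/-- The substitution `P ↦ P(f(X))`, i.e. `X_{i,I} ↦ X_{i,f(I)}`. -/
def subst {S S' : Finset (List ℕ)} (f : List ℕ → List ℕ) (hf : ∀ I ∈ S, f I ∈ S') :
    Poly d S →ₐ[ℂ] Poly d S' :=
  FreeAlgebra.lift ℂ fun p => FreeAlgebra.ι ℂ (p.1, ⟨f p.2.1, hf p.2.1 p.2.2⟩)

/-- The inclusion of polynomial algebras coming from `S ⊆ S'`. -/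
def incl {S S' : Finset (List ℕ)} (h : S ⊆ S') : Poly d S →ₐ[ℂ] Poly d S' :=
  subst id fun _ hI => h hI

/-- The substitution `V ↦ V(X^∅)`, where `X^∅ = (X_{i,∅})_i`. -/
def substEmpty {S : Finset (List ℕ)} (h : [] ∈ S) : FreeAlgebra ℂ (Fin d) →ₐ[ℂ] Poly d S :=
  FreeAlgebra.lift ℂ fun i => FreeAlgebra.ι ℂ (i, ⟨[], h⟩)

theorem gPlus_mem (S : Finset (List ℕ)) : ∀ I ∈ S, gPlus S I ∈ setG S := fun _ hI =>
  Finset.mem_union_left _ (Finset.mem_image_of_mem _ hI)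

theorem nil_mem_setG (S : Finset (List ℕ)) : [] ∈ setG S :=
  Finset.mem_union_right _ (Finset.mem_singleton_self _)

theorem f1_mem (S : Finset (List ℕ)) (j : ℕ) : ∀ I ∈ S, f1 S j I ∈ setFj S j := fun I hI => by
  have := Finset.mem_image_of_mem (f1 S j) hI
  simp only [setFj, Finset.mem_union]; tauto

theorem f2_mem (S : Finset (List ℕ)) (j : ℕ) : ∀ I ∈ S, f2 S j I ∈ setFj S j := fun I hI => by
  have := Finset.mem_image_of_mem (f2 S j) hI
  simp only [setFj, Finset.mem_union]; tauto

theorem f1t_mem (S : Finset (List ℕ)) (j : ℕ) : ∀ I ∈ S, f1t S j I ∈ setFj S j := fun I hI => by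
  have := Finset.mem_image_of_mem (f1t S j) hI
  simp only [setFj, Finset.mem_union]; tauto

theorem f2t_mem (S : Finset (List ℕ)) (j : ℕ) : ∀ I ∈ S, f2t S j I ∈ setFj S j := fun I hI => by
  have := Finset.mem_image_of_mem (f2t S j) hI
  simp only [setFj, Finset.mem_union]; tauto

theorem setFj_subset (S : Finset (List ℕ)) (s : Fin (depth S + 1)) :
    setFj S (s + 1) ⊆ setF S :=
  Finset.subset_biUnion_of_mem (setFj S) (Finset.mem_Icc.2 ⟨by omega, by omega⟩)

/-- `t̃_l`: the `l`-th smallest element of the sequence `T` for `l ≥ 1`, and `t̃_0 = 0`. -/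
def ordTime (T : List ℝ) (l : ℕ) : ℝ := (0 :: T.insertionSort (· ≤ ·)).getD l 0

/-- The operator `∇_V^{H,T_{n+1}}` for `S = J_H`, `T = T_n` and `s = t_{n+1}`. -/
def nablaV (S : Finset (List ℕ)) (V : FreeAlgebra ℂ (Fin d)) (T : List ℝ) (s : ℝ)
    (Q : Poly d S) : Poly d (setG S) :=
  (1 / 2 : ℂ) • ∑ i : Fin d, ∑ h ∈ Finset.range (depth S + 1),
    ((Real.exp ((ordTime T h - s) / 2) : ℝ) : ℂ) •
      (subst (gPlus S) (gPlus_mem S) (cycDerivLevel S i h Q) *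
        substEmpty (nil_mem_setG S) (mulOp (ncDeriv i V)))

/-- `Θ (A ⊗ B ⊗ C ⊗ D) = B(F_s^1(X)) A(F̃_s^1(X)) D(F̃_s^2(X)) C(F_s^2(X))`. -/
def theta (S : Finset (List ℕ)) (s : ℕ) :
    (Poly d S ⊗[ℂ] Poly d S) ⊗[ℂ] (Poly d S ⊗[ℂ] Poly d S) →ₗ[ℂ] Poly d (setFj S s) :=
  LinearMap.mul' ℂ (Poly d (setFj S s)) ∘ₗ TensorProduct.map
    (mulOp ∘ₗ TensorProduct.map
      (subst (f1t S s) (f1t_mem S s)).toLinearMap (subst (f1 S s) (f1_mem S s)).toLinearMap)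
    (mulOp ∘ₗ TensorProduct.map
      (subst (f2 S s) (f2_mem S s)).toLinearMap (subst (f2t S s) (f2t_mem S s)).toLinearMap)

theorem theta_tmul (S : Finset (List ℕ)) (s : ℕ) (A B C D : Poly d S) :
    theta S s ((A ⊗ₜ B) ⊗ₜ (C ⊗ₜ D)) =
      subst (f1 S s) (f1_mem S s) B * subst (f1t S s) (f1t_mem S s) A *
        subst (f2t S s) (f2t_mem S s) D * subst (f2 S s) (f2_mem S s) C := by
  simp [theta, mulOp_tmul, mul_assoc]

/-- The operator `L_s^{H,T_{n+2}}` for `S = J_H`, `T = T_n`, `t = t_{n+1}` and `u = t_{n+2}`. For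
`s = n + 1` the condition `I_s = J_s` is satisfied by any `I, J`. -/
def opLs (S : Finset (List ℕ)) (T : List ℝ) (t u : ℝ) (s : ℕ) (Q : Poly d S) :
    Poly d (setFj S s) :=
  let n := depth S
  (1 / 2 : ℂ) • ∑ i : Fin d, ∑ j : Fin d,
    ∑ h ∈ Finset.range (n + 1), ∑ k ∈ Finset.range (n + 1),
    ∑ x ∈ Finset.range s, ∑ y ∈ Finset.range s,
      ((Real.exp ((ordTime T h + ordTime T k + ordTime T y + ordTime T x) / 2 - t - u) : ℝ) : ℂ) •
        ∑ I ∈ level S x, ∑ J ∈ level S y,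
          if s = n + 1 ∨ entry n I.1 s = entry n J.1 s then
            theta S s (TensorProduct.map (ncDeriv (j, I)) (ncDeriv (j, J))
              (ncDerivLevel S i k (cycDerivLevel S i h Q)))
          else 0

/-- The operator `L^{H,T_{n+2}}`: the sum over `1 ≤ s ≤ n + 1` of the operators `L_s^{H,T_{n+2}}`,
each one multiplied by the indicator of `t̃_{s-1} ≤ t_{n+2} ≤ t̃_s`, where the ordered times are
those of `T_{n+1}`. -/
def opL (S : Finset (List ℕ)) (T : List ℝ) (t u : ℝ) (Q : Poly d S) : Poly d (setF S) :=
  ∑ s : Fin (depth S + 1),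
    (Set.Icc (ordTime (t :: T) s) (ordTime (t :: T) (s + 1))).indicator
      (fun _ => incl (setFj_subset S s) (opLs S T t u (s + 1) Q)) u

end Operators

/-! ## The interpolation -/

section Interpolation

variable {A : Type*} [CStarAlgebra A] {N d : ℕ}

/-- The family indexed by `(i, I)`, `I = {I_m, …, I_n} ∈ S`, with entries
`e^{t̃_{m-1}/2} (∑_{l=m}^n (e^{-t̃_{l-1}} - e^{-t̃_l})^{1/2} x_i^{I_l} + e^{-t̃_n/2} b_i)`,
where `n` is the length of the sequence of times `T`. -/
def interp (S : Finset (List ℕ)) (T : List ℝ) (x : ℕ → Fin d → Matrix (Fin N) (Fin N) A)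
    (b : Fin d → Matrix (Fin N) (Fin N) A) (p : Fin d × S) : Matrix (Fin N) (Fin N) A :=
  let n := T.length
  let m := startIdx n p.2.1
  ((Real.exp (ordTime T (m - 1) / 2) : ℝ) : ℂ) •
    ((∑ l ∈ Finset.Icc m n,
        ((Real.sqrt (Real.exp (-ordTime T (l - 1)) - Real.exp (-ordTime T l)) : ℝ) : ℂ) •
          x (entry n p.2.1 l) p.1) +
      ((Real.exp (-ordTime T n / 2) : ℝ) : ℂ) • b p.1)

/-- `τ_N(P(X^{N,T}))`, for a tuple `M` of matrices over `ℂ` in place of `X^N`. -/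
def traceAt (τ : A →L[ℂ] ℂ) (x : ℕ → Fin d → Matrix (Fin N) (Fin N) A) {S : Finset (List ℕ)}
    (T : List ℝ) (P : Poly d S) (M : Fin d → Matrix (Fin N) (Fin N) ℂ) : ℂ :=
  traceN N τ (FreeAlgebra.lift ℂ (interp S T x fun i => matEmb A N (M i)) P)

/-- `τ(P(x^T))`, with `x = x 0` in place of the matrices. -/
def traceFree (τ : A →L[ℂ] ℂ) (x : ℕ → Fin d → Matrix (Fin N) (Fin N) A) {S : Finset (List ℕ)}
    (T : List ℝ) (P : Poly d S) : ℂ :=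
  traceN N τ (FreeAlgebra.lift ℂ (interp S T x (x 0)) P)

/-- The weight `e^{-N tr_N(V(M))}`. -/
def weight (V : FreeAlgebra ℂ (Fin d)) (M : Fin d → Matrix (Fin N) (Fin N) ℂ) : ℂ :=
  Complex.exp (-(N : ℂ) * (FreeAlgebra.lift ℂ M V).trace)

/-- The random variable `τ_N(P(X^{N,T})) e^{-N tr_N(V(X^N))}`. -/
def weighted (τ : A →L[ℂ] ℂ) (x : ℕ → Fin d → Matrix (Fin N) (Fin N) A)
    (V : FreeAlgebra ℂ (Fin d)) {Ω : Type*} (X : Fin d → Ω → Matrix (Fin N) (Fin N) ℂ)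
    {S : Finset (List ℕ)} (T : List ℝ) (P : Poly d S) (ω : Ω) : ℂ :=
  traceAt τ x T P (fun i => X i ω) * weight V (fun i => X i ω)

end Interpolation

end

end MasterEquation

open MasterEquation

/-! The new time t interpolates between the two sides. In every variable the matrix part e^{-t̃_n/2}
X_i^N is replaced by (e^{-t̃_n} - e^{-t})^{1/2} x_i^{c+1} + e^{-t/2} X_i^N, with the fresh label
c+1. At t = t̃_n this is X^{N,T_n}; as t → ∞ its law tends to that of x^{T_n}, since x^{c+1} and x^0
enter the limiting covariances in the same way. Hence τ_N(P(x^{T_n})) - τ_N(P(X^{N,T_n})) is the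
integral of a t-derivative, for each fixed value of the matrices (`integral_flow`); the expectation
against the weight is taken afterwards.

The derivative has two parts (`hasDerivAt_traceN_plusVal`). The part carried by x^{c+1} becomes τ_N
⊗ τ_N applied to the ∂_{i,k} 𝒟_{i,h} P, by the Schwinger-Dyson equation for free semicircular
elements. The part carried by X_i^N is a multiple of τ_N(X_i^N 𝒟_{i,h} P); Gaussian integration by
parts (`integral_traceN_mul_lift`) trades it for a term with 𝒟_i V, which is ∇_V, and for the
contraction A ⊗ B ↦ (1/N) ∑ τ_N(E_{rs} A E_{sr} B) of the same ∂_{i,k} 𝒟_{i,h} P. What remains is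
the difference between τ_N ⊗ τ_N and the contraction.

To compute it, A and B are evaluated at two copies of the interpolation which share the matrices and
exactly the semicircular increments after a time u. For u = 0 the copies agree in law with a single
family and give the contraction; for u = t they share only the matrices, so the expression
factorizes into τ_N(A) τ_N(B). The u-derivative pairs a letter of A with a letter of B and cuts both
words; the sum over r, s glues the four pieces into one trace with a factor 1/N², two of the pieces
being read in an independent pair of copies. This is Θ_s, and the label rules of F_s produce exactly
these four copies (`coef_fCopy`, `traceAt_theta`, `sum_ntr_mom`, `tensorSq_sub_contraction`).

Everything rests on one description of the law: the conditional expectation onto M_N(ℂ) of a word in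
affine combinations of the semicircular elements satisfies the recursion that defines `mom`, so it
depends only on means and covariances (`entryMean_prod_affVal`). Freeness is used only to obtain the
Schwinger-Dyson equation behind it. The covariances are read off the labels: a label determines its
position in a list (`Slotted`), so only increments over the same time interval can be correlated.
Integrability follows since an entry of a Hermitian matrix is bounded by traces of its even powers,
so the hypothesis on V controls functions of polynomial growth (`integrable_gnorm_pow`). -/

open MeasureTheory ProbabilityTheory
open scoped TensorProduct

namespace MasterEquation

noncomputable section

/-! ## Sums over the occurrences of a letter in a word -/

section SplitSum

variable {Y Y' M M' : Type*}

/-- The sum of `g U a V` over all decompositions `w = U ++ a :: V`. -/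
def splitSum [AddCommMonoid M] (g : List Y → Y → List Y → M) : List Y → M
  | [] => 0
  | a :: w => g [] a w + splitSum (fun U b V => g (a :: U) b V) w

variable [AddCommMonoid M] [AddCommMonoid M']

@[simp] theorem splitSum_nil (g : List Y → Y → List Y → M) : splitSum g [] = 0 := rfl

theorem splitSum_cons (g : List Y → Y → List Y → M) (a : Y) (w : List Y) :
    splitSum g (a :: w) = g [] a w + splitSum (fun U b V => g (a :: U) b V) w := rfl

theorem splitSum_congr {g g' : List Y → Y → List Y → M} {w : List Y}
    (h : ∀ U a V, w = U ++ a :: V → g U a V = g' U a V) : splitSum g w = splitSum g' w := by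
  induction w generalizing g g' with
  | nil => rfl
  | cons a w ih =>
    rw [splitSum_cons, splitSum_cons, h [] a w rfl,
      ih fun U b V hw => h (a :: U) b V (by rw [hw]; rfl)]

theorem splitSum_zero (w : List Y) : splitSum (fun _ _ _ => (0 : M)) w = 0 := by
  induction w with
  | nil => rfl
  | cons a w ih => rw [splitSum_cons, ih, zero_add]

theorem splitSum_add (g g' : List Y → Y → List Y → M) (w : List Y) :
    splitSum (fun U a V => g U a V + g' U a V) w = splitSum g w + splitSum g' w := by
  induction w generalizing g g' with
  | nil => simp
  | cons a w ih => rw [splitSum_cons, splitSum_cons, splitSum_cons, ih]; abel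

theorem map_splitSum {F : Type*} [FunLike F M M'] [AddMonoidHomClass F M M'] (f : F)
    (g : List Y → Y → List Y → M) (w : List Y) :
    f (splitSum g w) = splitSum (fun U a V => f (g U a V)) w := by
  induction w generalizing g with
  | nil => simp
  | cons a w ih => rw [splitSum_cons, splitSum_cons, map_add, ih]

theorem splitSum_append (g : List Y → Y → List Y → M) (w w' : List Y) :
    splitSum g (w ++ w') = splitSum (fun U a V => g U a (V ++ w')) w +
      splitSum (fun U a V => g (w ++ U) a V) w' := by
  induction w generalizing g with
  | nil => simp
  | cons a w ih => rw [List.cons_append, splitSum_cons, splitSum_cons, ih]; simp [add_assoc]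

theorem splitSum_map (f : Y → Y') (g : List Y' → Y' → List Y' → M) (w : List Y) :
    splitSum g (w.map f) = splitSum (fun U a V => g (U.map f) (f a) (V.map f)) w := by
  induction w generalizing g with
  | nil => rfl
  | cons a w ih => rw [List.map_cons, splitSum_cons, splitSum_cons, ih]; rfl

theorem splitSum_comm (g : List Y → Y → List Y → List Y' → Y' → List Y' → M)
    (w : List Y) (w' : List Y') :
    splitSum (fun U a V => splitSum (g U a V) w') w =
      splitSum (fun U' a' V' => splitSum (fun U a V => g U a V U' a' V') w) w' := by
  induction w generalizing g with
  | nil => simp [splitSum_zero]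
  | cons a w ih => simp only [splitSum_cons, ih, splitSum_add]

/-- Both sides run over the ordered pairs of marked letters in w = U a W b V; the left side chooses
a first, the right side b. Needed to compare the ways in which several pairings sit inside one word.
-/
theorem splitSum_assoc (h : List Y → Y → List Y → Y → List Y → M) (w : List Y) :
    splitSum (fun U a R => splitSum (fun W b V => h U a W b V) R) w =
      splitSum (fun R b V => splitSum (fun U a W => h U a W b V) R) w := by
  induction w generalizing h with
  | nil => rfl
  | cons a w ih =>
    rw [splitSum_cons, splitSum_cons, ih]
    simp only [splitSum_cons, splitSum_nil, splitSum_add, zero_add]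

theorem splitSum_smul {R : Type*} [Monoid R] [DistribMulAction R M] (c : R)
    (g : List Y → Y → List Y → M) (w : List Y) :
    splitSum (fun U a V => c • g U a V) w = c • splitSum g w :=
  (map_splitSum (DistribSMul.toAddMonoidHom M c) g w).symm

theorem splitSum_sum {ι : Type*} (s : Finset ι) (g : ι → List Y → Y → List Y → M) (w : List Y) :
    splitSum (fun U a V => ∑ i ∈ s, g i U a V) w = ∑ i ∈ s, splitSum (g i) w := by
  induction w generalizing g with
  | nil => simp
  | cons a w ih => simp only [splitSum_cons, ih, Finset.sum_add_distrib]

theorem continuous_splitSum {α : Type*} [TopologicalSpace α] [TopologicalSpace M]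
    [ContinuousAdd M] {g : α → List Y → Y → List Y → M} {w : List Y}
    (h : ∀ U a V, w = U ++ a :: V → Continuous fun x => g x U a V) :
    Continuous fun x => splitSum (g x) w := by
  induction w generalizing g with
  | nil => exact continuous_const
  | cons a w ih =>
    simp only [splitSum_cons]
    exact (h [] a w rfl).add (ih fun U b V hw => h (a :: U) b V (by rw [hw]; rfl))

end SplitSum

theorem splitSum_apply {Y κ κ' : Type*} (g : List Y → Y → List Y → Matrix κ κ' ℂ) (w : List Y)
    (r : κ) (s : κ') :
    splitSum g w r s = splitSum (fun U a V => g U a V r s) w :=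
  map_splitSum (Matrix.entryLinearMap ℂ ℂ r s) g w

theorem hasDerivAt_splitSum {Y : Type*} {g : ℝ → List Y → Y → List Y → ℂ}
    {g' : List Y → Y → List Y → ℂ} {w : List Y} {u : ℝ}
    (h : ∀ U a V, w = U ++ a :: V → HasDerivAt (fun x => g x U a V) (g' U a V) u) :
    HasDerivAt (fun x => splitSum (g x) w) (splitSum g' w) u := by
  induction w generalizing g g' with
  | nil => exact hasDerivAt_const u 0
  | cons a w ih =>
    simp only [splitSum_cons]
    exact (h [] a w rfl).add (ih fun U b V hw => h (a :: U) b V (by rw [hw]; rfl))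

/-! ## Matrix-valued moments of an operator-valued semicircular family -/

/-- The normalized trace on `M_N(ℂ)`. -/
def ntr (N : ℕ) : Matrix (Fin N) (Fin N) ℂ →ₗ[ℂ] ℂ :=
  (1 / (N : ℂ)) • Matrix.traceLinearMap (Fin N) ℂ ℂ

theorem ntr_apply {N : ℕ} (k : Matrix (Fin N) (Fin N) ℂ) : ntr N k = 1 / (N : ℂ) * k.trace := rfl

section Moments

variable {Y Y' : Type*} {N : ℕ}

/-- Auxiliary version of `mom`, with a bound on the depth of the recursion. -/
def momAux (C : Y → Y → ℂ) (m : Y → Matrix (Fin N) (Fin N) ℂ) :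
    ℕ → List Y → Matrix (Fin N) (Fin N) ℂ
  | _, [] => 1
  | 0, _ :: _ => 0
  | k + 1, v :: w => m v * momAux C m k w +
      splitSum (fun U a V => (C v a * ntr N (momAux C m k U)) • momAux C m k V) w

/-- The bound k is only fuel for the recursion: once it reaches the length of the word it no longer
matters. -/
theorem momAux_eq (C : Y → Y → ℂ) (m : Y → Matrix (Fin N) (Fin N) ℂ) (k l : ℕ) (w : List Y)
    (hk : w.length ≤ k) (hl : w.length ≤ l) : momAux C m k w = momAux C m l w := by
  induction k generalizing l w with
  | zero =>
    obtain rfl : w = [] := List.length_eq_zero_iff.1 (by omega)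
    cases l <;> rfl
  | succ k ih =>
    cases w with
    | nil => cases l <;> rfl
    | cons v w =>
      cases l with
      | zero => simp at hl
      | succ l =>
        simp only [List.length_cons] at hk hl
        rw [momAux, momAux, ih l w (by omega) (by omega)]
        congr 1
        refine splitSum_congr fun U a V hw => ?_
        have : w.length = U.length + V.length + 1 := by rw [hw]; simp; omega
        rw [ih l U (by omega) (by omega), ih l V (by omega) (by omega)]

/-- The `M_N(ℂ)`-valued moments of the affine combinations `Z_v` of free semicircular elements,
free from `M_N(ℂ)`, with means `m v` and covariances `C v w`. -/
def mom (C : Y → Y → ℂ) (m : Y → Matrix (Fin N) (Fin N) ℂ) (w : List Y) :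
    Matrix (Fin N) (Fin N) ℂ := momAux C m w.length w

@[simp] theorem mom_nil (C : Y → Y → ℂ) (m : Y → Matrix (Fin N) (Fin N) ℂ) : mom C m [] = 1 := rfl

theorem mom_cons (C : Y → Y → ℂ) (m : Y → Matrix (Fin N) (Fin N) ℂ) (v : Y) (w : List Y) :
    mom C m (v :: w) = m v * mom C m w +
      splitSum (fun U a V => (C v a * ntr N (mom C m U)) • mom C m V) w := by
  change momAux C m (w.length + 1) (v :: w) = _
  rw [momAux]
  congr 1
  refine splitSum_congr fun U a V hw => ?_
  have : w.length = U.length + V.length + 1 := by rw [hw]; simp; omega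
  rw [momAux_eq C m w.length U.length U (by omega) le_rfl,
    momAux_eq C m w.length V.length V (by omega) le_rfl]
  rfl

/-- Induction on the length of words. -/
theorem word_induction {p : List Y → Prop} (nil : p [])
    (cons : ∀ v w, (∀ w' : List Y, w'.length ≤ w.length → p w') → p (v :: w)) (w : List Y) :
    p w := by
  induction hn : w.length using Nat.strong_induction_on generalizing w with
  | _ n ih =>
    cases w with
    | nil => exact nil
    | cons v w =>
      refine cons v w fun w' hw' => ih w'.length ?_ w' rfl
      simp at hn; omega

theorem length_lt_of_split {w U V : List Y} {a : Y} (hw : w = U ++ a :: V) :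
    U.length < w.length ∧ V.length < w.length := by
  rw [hw]; simp; omega

/-- The recursion only calls shorter words, so it determines its solution. This is how conditional
expectations are recognized as `mom`. -/
theorem mom_unique {C : Y → Y → ℂ} {m : Y → Matrix (Fin N) (Fin N) ℂ}
    {E : List Y → Matrix (Fin N) (Fin N) ℂ} (h1 : E [] = 1)
    (h2 : ∀ v w, E (v :: w) = m v * E w +
      splitSum (fun U a V => (C v a * ntr N (E U)) • E V) w) (w : List Y) :
    E w = mom C m w := by
  induction w using word_induction with
  | nil => exact h1
  | cons v w ih =>
    rw [h2, mom_cons, ih w le_rfl]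
    congr 1
    refine splitSum_congr fun U a V hw => ?_
    have := length_lt_of_split hw
    rw [ih U (by omega), ih V (by omega)]

theorem mom_map (f : Y → Y') (C : Y' → Y' → ℂ) (m : Y' → Matrix (Fin N) (Fin N) ℂ) (w : List Y) :
    mom C m (w.map f) = mom (fun a b => C (f a) (f b)) (fun a => m (f a)) w := by
  refine mom_unique (E := fun w => mom C m (w.map f)) rfl (fun v w => ?_) w
  simp only [List.map_cons, mom_cons, splitSum_map]

theorem mom_congr {C C' : Y → Y → ℂ} {m m' : Y → Matrix (Fin N) (Fin N) ℂ} {w : List Y}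
    (hC : ∀ a ∈ w, ∀ b ∈ w, C a b = C' a b) (hm : ∀ a ∈ w, m a = m' a) :
    mom C m w = mom C' m' w := by
  -- Over the subtype of letters of w the hypotheses become equalities of functions, so that
  -- `mom_map` applies.
  have hw : w = w.attach.map (fun y => y.1) := by simp
  rw [hw, mom_map, mom_map]
  congr 1
  · ext a b; exact hC _ a.2 _ b.2
  · ext1 a; exact hm _ a.2

theorem mom_const_cons {C : Y → Y → ℂ} {m : Y → Matrix (Fin N) (Fin N) ℂ} {v : Y}
    (hv : ∀ a, C v a = 0) (w : List Y) : mom C m (v :: w) = m v * mom C m w := by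
  rw [mom_cons]
  simp [hv, splitSum_zero]

/-- Moments factorize along uncorrelated families. -/
theorem mom_append {C : Y → Y → ℂ} {m : Y → Matrix (Fin N) (Fin N) ℂ} {w w' : List Y}
    (h : ∀ a ∈ w, ∀ b ∈ w', C a b = 0) : mom C m (w ++ w') = mom C m w * mom C m w' := by
  induction w using word_induction with
  | nil => simp
  | cons v w ih =>
    -- The partner of v can never lie in w', so only pairings inside the first word remain.
    have hz : splitSum (fun U a V => (C v a * ntr N (mom C m (w ++ U))) • mom C m V) w' = 0 := by
      rw [← splitSum_zero w']
      refine splitSum_congr fun U a V hw => ?_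
      rw [h v (by simp) a (by rw [hw]; simp), zero_mul, zero_smul]
    rw [List.cons_append, mom_cons, mom_cons, splitSum_append, hz, add_zero,
      ih w le_rfl fun a ha => h a (List.mem_cons_of_mem _ ha), add_mul, mul_assoc]
    congr 1
    rw [show splitSum (fun U a V => (C v a * ntr N (mom C m U)) • mom C m V) w * mom C m w' =
      AddMonoidHom.mulRight (mom C m w') (splitSum (fun U a V =>
        (C v a * ntr N (mom C m U)) • mom C m V) w) from rfl, map_splitSum]
    refine splitSum_congr fun U a V hw => ?_
    have := length_lt_of_split hw
    rw [ih V (by omega) fun b hb => h b (by rw [hw]; simp [hb])]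
    simp

/-- The derivative of a moment with respect to the covariances. -/
def momDeriv (C C' : Y → Y → ℂ) (m : Y → Matrix (Fin N) (Fin N) ℂ) (w : List Y) :
    Matrix (Fin N) (Fin N) ℂ :=
  splitSum (fun P a R => splitSum (fun Q b D =>
    (C' a b * ntr N (mom C m Q)) • mom C m (P ++ D)) R) w

/-- The pairings are non-crossing: when a and b are paired through C', the word Q between them is
traced out separately, so v is itself one of the paired letters, or contributes its mean, or finds
its partner before a or after b. This is the product rule for the recursion of `mom`, in
combinatorial form. -/
theorem momDeriv_cons (C C' : Y → Y → ℂ) (m : Y → Matrix (Fin N) (Fin N) ℂ) (v : Y)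
    (w : List Y) :
    momDeriv C C' m (v :: w) = m v * momDeriv C C' m w +
      (splitSum (fun U a V => (C' v a * ntr N (mom C m U)) • mom C m V) w +
       splitSum (fun U a V => (C v a * ntr N (momDeriv C C' m U)) • mom C m V) w +
       splitSum (fun U a V => (C v a * ntr N (mom C m U)) • momDeriv C C' m V) w) := by
  have h1 : m v * momDeriv C C' m w = splitSum (fun P a R => splitSum (fun Q b D =>
      (C' a b * ntr N (mom C m Q)) • (m v * mom C m (P ++ D))) R) w := by
    rw [momDeriv, show ∀ z, m v * z = AddMonoidHom.mulLeft (m v) z from fun _ => rfl, map_splitSum]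
    simp only [map_splitSum]
    simp
  -- The partner of v precedes both letters of the differentiated pair.
  have h2 : splitSum (fun U a V => (C v a * ntr N (mom C m U)) • momDeriv C C' m V) w =
      splitSum (fun P a R => splitSum (fun Q b D => splitSum (fun U k V =>
        (C' a b * ntr N (mom C m Q)) • (C v k * ntr N (mom C m U)) • mom C m (V ++ D)) P) R) w := by
    simp only [momDeriv, ← splitSum_smul]
    rw [splitSum_assoc (fun U k P a R => splitSum (fun Q b D =>
      (C v k * ntr N (mom C m U)) • (C' a b * ntr N (mom C m Q)) • mom C m (P ++ D)) R)]
    refine splitSum_congr fun P a R _ => ?_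
    rw [splitSum_comm]
    simp only [smul_comm (C v _ * ntr N (mom C m _))]
  -- The partner of v follows both letters of the differentiated pair, which therefore lies in the
  -- word traced out between v and its partner.
  have h3 : splitSum (fun U a V => (C v a * ntr N (momDeriv C C' m U)) • mom C m V) w =
      splitSum (fun P a R => splitSum (fun Q b D => splitSum (fun U k V =>
        (C' a b * ntr N (mom C m Q)) • (C v k * ntr N (mom C m (P ++ U))) • mom C m V) D) R) w := by
    have e1 : ∀ P a, splitSum (fun Q b D => splitSum (fun U k V =>
        (C' a b * ntr N (mom C m Q)) • (C v k * ntr N (mom C m (P ++ U))) • mom C m V) D) =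
        splitSum (fun R k V => splitSum (fun Q b U =>
        (C' a b * ntr N (mom C m Q)) • (C v k * ntr N (mom C m (P ++ U))) • mom C m V) R) :=
      fun P a => funext fun R => splitSum_assoc (fun Q b U k V =>
        (C' a b * ntr N (mom C m Q)) • (C v k * ntr N (mom C m (P ++ U))) • mom C m V) R
    simp only [e1]
    rw [splitSum_assoc (fun P a R k V => splitSum (fun Q b U =>
        (C' a b * ntr N (mom C m Q)) • (C v k * ntr N (mom C m (P ++ U))) • mom C m V) R)]
    refine splitSum_congr fun U k V _ => ?_
    rw [momDeriv, map_splitSum, show ∀ z : ℂ, (C v k * z) • mom C m V =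
      ((LinearMap.toSpanSingleton ℂ _ (mom C m V)) ∘ₗ LinearMap.mulLeft ℂ (C v k)) z from
        fun _ => rfl, map_splitSum]
    refine splitSum_congr fun P a R _ => ?_
    rw [map_splitSum, map_splitSum]
    refine splitSum_congr fun Q b D _ => ?_
    simp [smul_smul]
    ring_nf
  rw [h1, h2, h3, momDeriv, splitSum_cons]
  simp only [List.nil_append, List.cons_append, mom_cons, splitSum_append, smul_add,
    splitSum_add, splitSum_smul]
  abel

/-- By induction on the length: differentiating the recursion of `mom` gives the recursion
`momDeriv_cons`. The means do not depend on the parameter. -/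
theorem hasDerivAt_mom {C : ℝ → Y → Y → ℂ} {C' : Y → Y → ℂ}
    {m : Y → Matrix (Fin N) (Fin N) ℂ} {u : ℝ}
    (h : ∀ a b, HasDerivAt (fun x => C x a b) (C' a b) u) (w : List Y) (r s : Fin N) :
    HasDerivAt (fun x => mom (C x) m w r s) (momDeriv (C u) C' m w r s) u := by
  induction w using word_induction generalizing r s with
  | nil => exact hasDerivAt_const u _
  | cons v w ih =>
    have hn : ∀ w' : List Y, w'.length ≤ w.length →
        HasDerivAt (fun x => ntr N (mom (C x) m w')) (ntr N (momDeriv (C u) C' m w')) u := by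
      intro w' hw'
      simp only [ntr_apply, Matrix.trace, Matrix.diag]
      exact (HasDerivAt.fun_sum fun i _ => ih w' hw' i i).const_mul _
    rw [momDeriv_cons, ← splitSum_add, ← splitSum_add]
    simp only [mom_cons, Matrix.add_apply, splitSum_apply, Matrix.mul_apply]
    refine (HasDerivAt.fun_sum fun i _ => (ih w le_rfl i s).const_mul _).add
      (hasDerivAt_splitSum fun U a V hw => ?_)
    have hl := length_lt_of_split hw
    refine (((h v a).mul (hn U (by omega))).mul (ih V (by omega) r s)).congr_deriv ?_
    simp only [Matrix.smul_apply, smul_eq_mul, Pi.mul_apply]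
    ring

theorem continuous_ntr : Continuous (ntr N) :=
  LinearMap.continuous_of_finiteDimensional _

theorem continuous_mom {α : Type*} [TopologicalSpace α] {C : α → Y → Y → ℂ}
    {m : α → Y → Matrix (Fin N) (Fin N) ℂ} (hC : ∀ a b, Continuous fun x => C x a b)
    (hm : ∀ a, Continuous fun x => m x a) (w : List Y) :
    Continuous fun x => mom (C x) (m x) w := by
  induction w using word_induction with
  | nil => exact continuous_const
  | cons v w ih =>
    simp only [mom_cons]
    refine ((hm v).matrix_mul (ih w le_rfl)).add (continuous_splitSum fun U a V hw => ?_)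
    have hl := length_lt_of_split hw
    exact ((hC v a).mul (continuous_ntr.comp (ih U (by omega)))).smul (ih V (by omega))

/-- The linear functional on noncommutative polynomials that extends `mom`. -/
def momL (C : Y → Y → ℂ) (m : Y → Matrix (Fin N) (Fin N) ℂ) :
    FreeAlgebra ℂ Y →ₗ[ℂ] Matrix (Fin N) (Fin N) ℂ :=
  (FreeAlgebra.basisFreeMonoid ℂ Y).constr ℂ fun w => mom C m w.toList

end Moments

/-! ### Monomials as a basis of the free algebra, and their noncommutative derivatives -/

section Words

variable {Y Y' : Type*}

/-- The monomial given by a word. -/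
def word (w : List Y) : FreeAlgebra ℂ Y := (w.map (FreeAlgebra.ι ℂ)).prod

@[simp] theorem word_nil : word ([] : List Y) = 1 := rfl

theorem word_cons (v : Y) (w : List Y) : word (v :: w) = FreeAlgebra.ι ℂ v * word w := by
  simp [word]

theorem lift_word {B : Type*} [Ring B] [Algebra ℂ B] (Z : Y → B) (w : List Y) :
    FreeAlgebra.lift ℂ Z (word w) = (w.map Z).prod := by
  simp [word, map_list_prod, Function.comp_def]

theorem basisFreeMonoid_apply (w : List Y) :
    FreeAlgebra.basisFreeMonoid ℂ Y (FreeMonoid.ofList w) = word w := by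
  simp [FreeAlgebra.basisFreeMonoid, FreeAlgebra.equivMonoidAlgebraFreeMonoid, word]

/-- The words span the free algebra, so a linear statement needs to be checked on monomials only. -/
theorem freeAlgebra_induction {p : FreeAlgebra ℂ Y → Prop} (hw : ∀ w, p (word w))
    (hadd : ∀ a b, p a → p b → p (a + b)) (hsmul : ∀ (c : ℂ) a, p a → p (c • a))
    (Q : FreeAlgebra ℂ Y) : p Q := by
  have h0 : p 0 := by simpa using hsmul 0 _ (hw [])
  have hQ : Q ∈ Submodule.span ℂ (Set.range (word (Y := Y))) := by
    have := (FreeAlgebra.basisFreeMonoid ℂ Y).mem_span Q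
    refine Submodule.span_mono ?_ this
    rintro _ ⟨w, rfl⟩
    exact ⟨w.toList, (basisFreeMonoid_apply _).symm⟩
  induction hQ using Submodule.span_induction with
  | mem x hx => obtain ⟨w, rfl⟩ := hx; exact hw w
  | zero => exact h0
  | add a b _ _ ha hb => exact hadd a b ha hb
  | smul c a _ ha => exact hsmul c a ha

theorem momL_word {N : ℕ} (C : Y → Y → ℂ) (m : Y → Matrix (Fin N) (Fin N) ℂ) (w : List Y) :
    momL C m (word w) = mom C m w := by
  rw [momL, ← basisFreeMonoid_apply, Module.Basis.constr_basis]
  rfl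

theorem continuous_momL {N : ℕ} {α : Type*} [TopologicalSpace α] {C : α → Y → Y → ℂ}
    {m : α → Y → Matrix (Fin N) (Fin N) ℂ} (hC : ∀ a b, Continuous fun x => C x a b)
    (hm : ∀ a, Continuous fun x => m x a) (Q : FreeAlgebra ℂ Y) :
    Continuous fun x => momL (C x) (m x) Q := by
  induction Q using freeAlgebra_induction with
  | hw w => simpa only [momL_word] using continuous_mom hC hm w
  | hadd a b ha hb => simp only [map_add]; exact ha.add hb
  | hsmul c a ha => simp only [map_smul]; exact ha.const_smul c

theorem ncDeriv_algebraMap [DecidableEq Y] (v : Y) (c : ℂ) :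
    ncDeriv v (algebraMap ℂ (FreeAlgebra ℂ Y) c) = 0 := by
  simp [ncDeriv, Matrix.algebraMap_matrix_apply]

theorem ncDeriv_one [DecidableEq Y] (v : Y) : ncDeriv v (1 : FreeAlgebra ℂ Y) = 0 := by
  simpa using ncDeriv_algebraMap v 1

/-- The noncommutative derivative of a monomial. -/
theorem ncDeriv_word [DecidableEq Y] (v : Y) (w : List Y) :
    ncDeriv v (word w) = splitSum (fun U a V => (if v = a then (1 : ℂ) else 0) •
      (word U ⊗ₜ[ℂ] word V)) w := by
  induction w with
  | nil => exact ncDeriv_one v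
  | cons b w ih =>
    rw [word_cons, ncDeriv_mul, ncDeriv_ι, ih, splitSum_cons,
      ← LinearMap.mulLeft_apply (R := ℂ) (_ ⊗ₜ[ℂ] _), map_splitSum]
    congr 1
    · split_ifs <;> simp
    · refine splitSum_congr fun U a V _ => ?_
      rw [map_smul, LinearMap.mulLeft_apply, Algebra.TensorProduct.tmul_mul_tmul, one_mul,
        word_cons]

end Words

end

end MasterEquation

open MeasureTheory ProbabilityTheory
open scoped TensorProduct

namespace MasterEquation

noncomputable section

/-! ## Reduced products -/

section Reduced

variable {G J : Type*} [Ring G]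

/-- The product of the entries of a sequence. -/
def sprod (w : List (J × G)) : G := (w.map Prod.snd).prod

@[simp] theorem sprod_nil : sprod ([] : List (J × G)) = 1 := rfl

theorem sprod_cons (a : J × G) (w : List (J × G)) : sprod (a :: w) = a.2 * sprod w := by
  simp [sprod]

theorem sprod_append (w w' : List (J × G)) : sprod (w ++ w') = sprod w * sprod w' := by
  simp [sprod]

variable [Algebra ℂ G]

/-- A sequence of centred elements of the subalgebras `S j`, neighbouring ones coming from
different subalgebras. -/
def IsReduced (S : J → Subalgebra ℂ G) (ψ : G →ₗ[ℂ] ℂ) (w : List (J × G)) : Prop :=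
  w.IsChain (fun a b => a.1 ≠ b.1) ∧ ∀ a ∈ w, a.2 ∈ S a.1 ∧ ψ a.2 = 0

variable {S : J → Subalgebra ℂ G} {ψ : G →ₗ[ℂ] ℂ}

/-- The centring of an element. -/
def centre (ψ : G →ₗ[ℂ] ℂ) (a : G) : G := a - algebraMap ℂ G (ψ a)

theorem eq_centre_add (a : G) : a = centre ψ a + algebraMap ℂ G (ψ a) := by simp [centre]

theorem map_centre (hψ : ψ 1 = 1) (a : G) : ψ (centre ψ a) = 0 := by
  simp [centre, Algebra.algebraMap_eq_smul_one, hψ]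

theorem centre_mem {j : J} {a : G} (ha : a ∈ S j) : centre ψ a ∈ S j :=
  sub_mem ha (algebraMap_mem _ _)

theorem IsReduced.tail {a : J × G} {w : List (J × G)} (h : IsReduced S ψ (a :: w)) :
    IsReduced S ψ w :=
  ⟨h.1.tail, fun b hb => h.2 b (List.mem_cons_of_mem _ hb)⟩

theorem IsReduced.cons {j : J} {a : G} {w : List (J × G)} (h : IsReduced S ψ w)
    (ha : a ∈ S j) (ha0 : ψ a = 0) (hj : ∀ b ∈ w.head?, j ≠ b.1) : IsReduced S ψ ((j, a) :: w) := by
  refine ⟨?_, ?_⟩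
  · cases w with
    | nil => simp
    | cons b w =>
      rw [List.isChain_cons_cons]
      exact ⟨hj b (by simp), h.1⟩
  · rintro b hb
    rcases List.mem_cons.1 hb with rfl | hb
    · exact ⟨ha, ha0⟩
    · exact h.2 b hb

theorem isReduced_nil : IsReduced S ψ [] := ⟨by simp, by simp⟩

/-- The reduced products span the algebra generated by the subalgebras. -/
theorem span_reduced (hψ : ψ 1 = 1) (hS : ⨆ j, S j = ⊤) :
    Submodule.span ℂ (sprod '' {w | IsReduced S ψ w}) = ⊤ := by
  set W := Submodule.span ℂ (sprod '' {w | IsReduced S ψ w}) with hW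
  have key : ∀ j, ∀ a ∈ S j, ∀ w, IsReduced S ψ w → a * sprod w ∈ W := by
    intro j a ha w hw
    have hmem : ∀ w, IsReduced S ψ w → sprod w ∈ W := fun w hw =>
      Submodule.subset_span ⟨w, hw, rfl⟩
    -- If v does not begin in `S j`, the centred part of b extends v to a reduced sequence, and the
    -- scalar part of b only multiplies `sprod v`.
    have h1 : ∀ b ∈ S j, ∀ v, IsReduced S ψ v → (∀ c ∈ v.head?, j ≠ c.1) → b * sprod v ∈ W := by
      intro b hb v hv hj
      rw [eq_centre_add (ψ := ψ) b, add_mul, Algebra.algebraMap_eq_smul_one, smul_one_mul]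
      refine add_mem ?_ (W.smul_mem _ (hmem v hv))
      have := hmem _ (hv.cons (centre_mem (ψ := ψ) hb) (map_centre hψ b) hj)
      rwa [sprod_cons] at this
    cases w with
    | nil => exact h1 a ha [] isReduced_nil (by simp)
    | cons c v =>
      by_cases hc : j = c.1
      -- Two neighbours from the same subalgebra are merged first; the tail then begins in a
      -- different one.
      · rw [sprod_cons, ← mul_assoc]
        refine h1 _ (mul_mem ha (hc ▸ (hw.2 c (by simp)).1)) v hw.tail fun b hb => ?_
        rw [hc]
        cases v with
        | nil => simp at hb
        | cons b' v =>
          obtain rfl : b' = b := by simpa using hb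
          exact (List.isChain_cons_cons.1 hw.1).1
      · exact h1 a ha _ hw (by simpa using hc)
  -- The elements that stabilize W under left multiplication form a subalgebra. It contains every `S
  -- j`, hence is everything, and it is applied to 1 ∈ W.
  let T : Subalgebra ℂ G :=
    { carrier := {a | ∀ b ∈ W, a * b ∈ W}
      mul_mem' := fun {a b} ha hb c hc => by rw [mul_assoc]; exact ha _ (hb _ hc)
      add_mem' := fun {a b} ha hb c hc => by rw [add_mul]; exact add_mem (ha _ hc) (hb _ hc)
      algebraMap_mem' := fun r c hc => by
        rw [Algebra.algebraMap_eq_smul_one, smul_one_mul]; exact W.smul_mem _ hc }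
  have hT : T = ⊤ := by
    rw [eq_top_iff, ← hS]
    refine iSup_le fun j a ha b hb => ?_
    induction hb using Submodule.span_induction with
    | mem x hx => obtain ⟨w, hw, rfl⟩ := hx; exact key j a ha w hw
    | zero => simp
    | add x y _ _ hx hy => rw [mul_add]; exact add_mem hx hy
    | smul c x _ hx => rw [mul_smul_comm]; exact W.smul_mem _ hx
  rw [eq_top_iff]
  intro a _
  have ha : a ∈ T := by rw [hT]; trivial
  have h1 : (1 : G) ∈ W := Submodule.subset_span ⟨[], isReduced_nil, rfl⟩
  simpa using ha 1 h1

/-- Reduced products of elements of free subalgebras are centred. -/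
def RespectsReduced (S : J → Subalgebra ℂ G) (ψ : G →ₗ[ℂ] ℂ) : Prop :=
  ∀ w, IsReduced S ψ w → w ≠ [] → ψ (sprod w) = 0

/-- Centring a splits the product into a longer reduced product and a scalar multiple of `sprod w`;
both have mean zero, w being nonempty. -/
theorem RespectsReduced.mul_left (h : RespectsReduced S ψ) (hψ : ψ 1 = 1) {j : J} {a : G}
    (ha : a ∈ S j) {w : List (J × G)} (hw : IsReduced S ψ w) (hne : w ≠ [])
    (hj : ∀ b ∈ w.head?, j ≠ b.1) : ψ (a * sprod w) = 0 := by
  have := h _ (hw.cons (centre_mem (ψ := ψ) ha) (map_centre hψ a) hj) (by simp)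
  rw [eq_centre_add (ψ := ψ) a, add_mul, map_add, Algebra.algebraMap_eq_smul_one, smul_one_mul,
    map_smul, h w hw hne, smul_zero, add_zero, ← this, sprod_cons]

theorem RespectsReduced.mul_right (h : RespectsReduced S ψ) (hψ : ψ 1 = 1) {j : J} {a : G}
    (ha : a ∈ S j) {w : List (J × G)} (hw : IsReduced S ψ w) (hne : w ≠ [])
    (hj : ∀ b ∈ w.getLast?, b.1 ≠ j) : ψ (sprod w * a) = 0 := by
  have hr : IsReduced S ψ (w ++ [(j, centre ψ a)]) := by
    refine ⟨List.isChain_append.2 ⟨hw.1, by simp, ?_⟩, ?_⟩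
    · simpa using hj
    · intro b hb
      rcases List.mem_append.1 hb with hb | hb
      · exact hw.2 b hb
      · obtain rfl := List.mem_singleton.1 hb
        exact ⟨centre_mem ha, map_centre hψ a⟩
  have := h _ hr (by simp)
  rw [eq_centre_add (ψ := ψ) a, mul_add, map_add, Algebra.algebraMap_eq_smul_one, mul_smul_one,
    map_smul, h w hw hne, smul_zero, add_zero, ← this, sprod_append]
  simp [sprod]

end Reduced

/-! ## The Schwinger-Dyson equation for free semicircular elements -/

section Free

variable {ι κ : Type*}

/-- The subalgebras generated by a single variable `X_p`, and by the letters in `κ`. -/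
def letterAlg (ι κ : Type*) : Option ι → Subalgebra ℂ (FreeAlgebra ℂ (ι ⊕ κ))
  | some p => Algebra.adjoin ℂ {FreeAlgebra.ι ℂ (Sum.inl p)}
  | none => Algebra.adjoin ℂ (Set.range fun q => FreeAlgebra.ι ℂ (Sum.inr q))

theorem iSup_letterAlg : ⨆ j, letterAlg ι κ j = ⊤ := by
  rw [eq_top_iff, ← FreeAlgebra.adjoin_range_ι, Algebra.adjoin_le_iff]
  rintro _ ⟨p | q, rfl⟩
  · exact le_iSup (letterAlg ι κ) (some p) (Algebra.subset_adjoin rfl)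
  · exact le_iSup (letterAlg ι κ) none (Algebra.subset_adjoin ⟨q, rfl⟩)

variable [DecidableEq ι] [DecidableEq κ]

theorem ncDeriv_letterAlg_of_ne {p : ι} {j : Option ι} (hj : j ≠ some p)
    {a : FreeAlgebra ℂ (ι ⊕ κ)} (ha : a ∈ letterAlg ι κ j) : ncDeriv (Sum.inl p) a = 0 := by
  have gen : ∀ X : Set (FreeAlgebra ℂ (ι ⊕ κ)),
      (∀ z ∈ X, ncDeriv (Sum.inl p) z = 0) → a ∈ Algebra.adjoin ℂ X →
      ncDeriv (Sum.inl p) a = 0 := by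
    intro X hX haX
    clear ha
    induction haX using Algebra.adjoin_induction with
    | mem z hz => exact hX z hz
    | algebraMap r => exact ncDeriv_algebraMap _ r
    | add y z _ _ hy hz => rw [map_add, hy, hz, add_zero]
    | mul y z _ _ hy hz => rw [ncDeriv_mul, hy, hz, zero_mul, mul_zero, add_zero]
  cases j with
  | none =>
    refine gen _ ?_ ha
    rintro _ ⟨q, rfl⟩
    simp [ncDeriv_ι]
  | some q =>
    refine gen _ ?_ ha
    rintro _ rfl
    rw [ncDeriv_ι, if_neg]
    rintro h
    exact hj (by rw [Sum.inl.inj h])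

/-- Cutting an element of the algebra of a single letter leaves two factors in that algebra, which
can then be absorbed next to reduced products. -/
theorem ncDeriv_letterAlg_mem {p : ι} {a : FreeAlgebra ℂ (ι ⊕ κ)}
    (ha : a ∈ letterAlg ι κ (some p)) : ncDeriv (Sum.inl p) a ∈ Submodule.span ℂ
      {t | ∃ b ∈ letterAlg ι κ (some p), ∃ c ∈ letterAlg ι κ (some p), b ⊗ₜ[ℂ] c = t} := by
  set T := Submodule.span ℂ
      {t | ∃ b ∈ letterAlg ι κ (some p), ∃ c ∈ letterAlg ι κ (some p), b ⊗ₜ[ℂ] c = t}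
  change a ∈ Algebra.adjoin ℂ _ at ha
  induction ha using Algebra.adjoin_induction with
  | mem z hz =>
    obtain rfl := hz
    rw [ncDeriv_ι, if_pos rfl]
    exact Submodule.subset_span ⟨1, one_mem _, 1, one_mem _, rfl⟩
  | algebraMap r => rw [ncDeriv_algebraMap]; exact zero_mem _
  | add y z _ _ hy hz => rw [map_add]; exact add_mem hy hz
  | mul y z hy' hz' hy hz =>
    rw [ncDeriv_mul]
    refine add_mem ?_ ?_
    · have : T ≤ T.comap (LinearMap.mulRight ℂ ((1 : FreeAlgebra ℂ (ι ⊕ κ)) ⊗ₜ[ℂ] z)) := by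
        refine Submodule.span_le.2 ?_
        rintro _ ⟨b, hb, c, hc, rfl⟩
        refine Submodule.subset_span ⟨b, hb, c * z, mul_mem hc hz', ?_⟩
        simp
      exact this hy
    · have : T ≤ T.comap (LinearMap.mulLeft ℂ (y ⊗ₜ[ℂ] (1 : FreeAlgebra ℂ (ι ⊕ κ)))) := by
        refine Submodule.span_le.2 ?_
        rintro _ ⟨b, hb, c, hc, rfl⟩
        refine Submodule.subset_span ⟨y * b, mul_mem hy' hb, c, hc, ?_⟩
        simp
      exact this hz

/-- The functional `ψ ⊗ ψ`. -/
def tensorSq {G : Type*} [AddCommGroup G] [Module ℂ G] (ψ : G →ₗ[ℂ] ℂ) : G ⊗[ℂ] G →ₗ[ℂ] ℂ :=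
  LinearMap.mul' ℂ ℂ ∘ₗ TensorProduct.map ψ ψ

@[simp] theorem tensorSq_tmul {G : Type*} [AddCommGroup G] [Module ℂ G] (ψ : G →ₗ[ℂ] ℂ) (a b : G) :
    tensorSq ψ (a ⊗ₜ b) = ψ a * ψ b := rfl

variable {ψ : FreeAlgebra ℂ (ι ⊕ κ) →ₗ[ℂ] ℂ}

/-- The derivative cuts W inside a letter coming from the algebra of p. What stands to the left of
the cut is a nonempty reduced product ending in another subalgebra, times an element of the algebra
of p, so its mean vanishes. The induction moves the letters of W one by one into U. -/
theorem tensorSq_mul_ncDeriv_sprod (h : RespectsReduced (letterAlg ι κ) ψ) (hψ : ψ 1 = 1) (p : ι)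
    (U W : List (Option ι × FreeAlgebra ℂ (ι ⊕ κ))) (hU : U ≠ [])
    (hUW : IsReduced (letterAlg ι κ) ψ (U ++ W)) :
    tensorSq ψ ((sprod U ⊗ₜ 1) * ncDeriv (Sum.inl p) (sprod W)) = 0 := by
  induction W generalizing U with
  | nil => rw [sprod_nil, ncDeriv_one, mul_zero, map_zero]
  | cons c W ih =>
    have hU' : IsReduced (letterAlg ι κ) ψ U :=
      ⟨(List.isChain_append.1 hUW.1).1, fun b hb => hUW.2 b (by simp [hb])⟩
    have h2 := ih (U ++ [c]) (by simp) (by simpa using hUW)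
    rw [sprod_cons, ncDeriv_mul, mul_add, map_add, ← mul_assoc (sprod U ⊗ₜ[ℂ] _) (c.2 ⊗ₜ 1),
      Algebra.TensorProduct.tmul_mul_tmul, one_mul]
    rw [sprod_append, sprod_cons, sprod_nil, mul_one] at h2
    rw [h2, add_zero]
    by_cases hc : c.1 = some p
    · have hmem := (hUW.2 c (by simp)).1
      rw [hc] at hmem
      have hd := ncDeriv_letterAlg_mem hmem
      generalize ncDeriv (Sum.inl p) c.2 = D at hd
      induction hd using Submodule.span_induction with
      | mem t ht =>
        obtain ⟨a', ha', b', hb', rfl⟩ := ht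
        rw [Algebra.TensorProduct.tmul_mul_tmul, Algebra.TensorProduct.tmul_mul_tmul,
          tensorSq_tmul, mul_one, h.mul_right hψ ha' hU' hU, zero_mul]
        intro b hb
        have := (List.isChain_append.1 hUW.1).2.2 b hb c (by simp)
        rwa [hc] at this
      | zero => simp
      | add s t _ _ hs ht => rw [add_mul, mul_add, map_add, hs, ht, add_zero]
      | smul r t _ ht => rw [smul_mul_assoc, mul_smul_comm, map_smul, ht, smul_zero]
    · rw [ncDeriv_letterAlg_of_ne hc (hUW.2 c (by simp)).1]
      simp

/-- The Schwinger-Dyson equation at the level of the free algebra. -/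
theorem schwingerDyson (h : RespectsReduced (letterAlg ι κ) ψ) (hψ : ψ 1 = 1) (p : ι)
    (h1 : ∀ a ∈ letterAlg ι κ (some p), ψ (FreeAlgebra.ι ℂ (Sum.inl p) * a) =
      tensorSq ψ (ncDeriv (Sum.inl p) a)) (Q : FreeAlgebra ℂ (ι ⊕ κ)) :
    ψ (FreeAlgebra.ι ℂ (Sum.inl p) * Q) = tensorSq ψ (ncDeriv (Sum.inl p) Q) := by
  have hx : FreeAlgebra.ι ℂ (Sum.inl p) ∈ letterAlg ι κ (some p) := Algebra.subset_adjoin rfl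
  have hx0 : ψ (FreeAlgebra.ι ℂ (Sum.inl p)) = 0 := by
    have := h1 1 (one_mem _)
    rw [mul_one] at this
    rw [this]
    rw [ncDeriv_one, map_zero]
  have hQ : Q ∈ Submodule.span ℂ (sprod '' {w | IsReduced (letterAlg ι κ) ψ w}) := by
    rw [span_reduced hψ iSup_letterAlg]; trivial
  induction hQ using Submodule.span_induction with
  | zero => simp
  | add s t _ _ hs ht => rw [mul_add, map_add, map_add, map_add, hs, ht]
  | smul r t _ ht => rw [mul_smul_comm, map_smul, map_smul, map_smul, ht]
  | mem t ht =>
    obtain ⟨w, hw, rfl⟩ := ht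
    cases w with
    | nil => exact h1 1 (one_mem _)
    | cons c W =>
      -- A cut after the first letter contributes nothing, so only the derivative of the first
      -- letter matters.
      have h3 := tensorSq_mul_ncDeriv_sprod h hψ p [c] W (by simp) hw
      rw [sprod_cons, sprod_nil, mul_one] at h3
      rw [sprod_cons, ncDeriv_mul, map_add, h3, add_zero]
      have hmem := (hw.2 c (by simp)).1
      by_cases hc : c.1 = some p
      · rw [hc] at hmem
        cases W with
        | nil =>
          rw [sprod_nil, mul_one, h1 _ hmem, ← Algebra.TensorProduct.one_def, mul_one]
        | cons b W =>
          have hj : ∀ b' ∈ (b :: W).head?, some p ≠ b'.1 := by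
            have := (List.isChain_cons_cons.1 hw.1).1
            rw [hc] at this
            simpa using this
          -- With a nonempty tail both sides vanish: on each of them some element of the algebra of
          -- p stands in front of the reduced tail, which begins elsewhere.
          rw [← mul_assoc, h.mul_left hψ (mul_mem hx hmem) hw.tail (by simp) hj]
          have hd := ncDeriv_letterAlg_mem hmem
          symm
          generalize ncDeriv (Sum.inl p) c.2 = D at hd
          induction hd using Submodule.span_induction with
          | mem t ht =>
            obtain ⟨a', ha', b', hb', rfl⟩ := ht
            rw [Algebra.TensorProduct.tmul_mul_tmul, tensorSq_tmul,
              h.mul_left hψ hb' hw.tail (by simp) hj, mul_zero]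
          | zero => simp
          | add s t _ _ hs ht => rw [add_mul, map_add, hs, ht, add_zero]
          | smul r t _ ht => rw [smul_mul_assoc, map_smul, ht, smul_zero]
      · rw [ncDeriv_letterAlg_of_ne hc hmem, zero_mul, map_zero]
        -- If the first letter is not from the algebra of p, its derivative is zero, and the
        -- variable multiplies a reduced product beginning in another subalgebra.
        have := h.mul_left hψ hx hw (by simp) (by simpa using fun h => hc h.symm)
        rwa [sprod_cons] at this

end Free

/-! ### Affine combinations of semicircular elements and matrices, and their lift to the free
algebra of letters -/

section Realization

variable {A : Type*} [CStarAlgebra A] {N d : ℕ}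

/-- The conditional expectation `id ⊗ τ` of `M_N(A)` onto `M_N(ℂ)`. -/
def entryMean (N : ℕ) (τ : A →L[ℂ] ℂ) :
    Matrix (Fin N) (Fin N) A →ₗ[ℂ] Matrix (Fin N) (Fin N) ℂ :=
  (τ : A →ₗ[ℂ] ℂ).mapMatrix

theorem entryMean_apply (τ : A →L[ℂ] ℂ) (M : Matrix (Fin N) (Fin N) A) (r s : Fin N) :
    entryMean N τ M r s = τ (M r s) := rfl

theorem traceN_eq (τ : A →L[ℂ] ℂ) (M : Matrix (Fin N) (Fin N) A) :
    traceN N τ M = ntr N (entryMean N τ M) := by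
  simp [traceN, ntr_apply, Matrix.trace, entryMean_apply]

theorem matEmb_apply (k : Matrix (Fin N) (Fin N) ℂ) (r s : Fin N) :
    matEmb A N k r s = algebraMap ℂ A (k r s) := rfl

theorem entryMean_matEmb_mul (τ : A →L[ℂ] ℂ) (k : Matrix (Fin N) (Fin N) ℂ)
    (M : Matrix (Fin N) (Fin N) A) :
    entryMean N τ (matEmb A N k * M) = k * entryMean N τ M := by
  ext r s
  simp [entryMean_apply, Matrix.mul_apply, matEmb_apply, ← Algebra.smul_def]

theorem entryMean_one {τ : A →L[ℂ] ℂ} (hτ : IsTrace τ) : entryMean N τ 1 = 1 := by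
  ext r s
  rw [entryMean_apply, Matrix.one_apply, Matrix.one_apply]
  split_ifs
  · exact hτ.map_one
  · exact map_zero τ

theorem ntr_one (hN : 1 ≤ N) : ntr N 1 = 1 := by
  have : (N : ℂ) ≠ 0 := by exact_mod_cast (by omega : N ≠ 0)
  simp [ntr_apply, this]

theorem traceN_one {τ : A →L[ℂ] ℂ} (hτ : IsTrace τ) (hN : 1 ≤ N) : traceN N τ 1 = 1 := by
  rw [traceN_eq, entryMean_one hτ, ntr_one hN]

theorem traceN_mul_comm {τ : A →L[ℂ] ℂ} (hτ : IsTrace τ) (M M' : Matrix (Fin N) (Fin N) A) :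
    traceN N τ (M * M') = traceN N τ (M' * M) := by
  simp only [traceN_eq, ntr_apply, Matrix.trace, Matrix.diag, entryMean_apply, Matrix.mul_apply,
    map_sum]
  rw [Finset.sum_comm]
  simp only [hτ.mul_comm]

/-- The entries of a matrix, recovered from the trace. -/
theorem entry_eq_ntr (hN : 1 ≤ N) (k : Matrix (Fin N) (Fin N) ℂ) (r s : Fin N) :
    k r s = N * ntr N (Matrix.single s r 1 * k) := by
  have : (N : ℂ) ≠ 0 := by exact_mod_cast (by omega : N ≠ 0)
  rw [ntr_apply, Matrix.trace_single_mul, one_smul]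
  field_simp

/-- The element `∑_p a_p x_p + m` of `M_N(A)` given by coefficients `a` and a matrix `m`. -/
def affVal (x : ℕ → Fin d → Matrix (Fin N) (Fin N) A)
    (v : (ℕ × Fin d →₀ ℂ) × Matrix (Fin N) (Fin N) ℂ) : Matrix (Fin N) (Fin N) A :=
  Finsupp.linearCombination ℂ (fun p : ℕ × Fin d => x p.1 p.2) v.1 + matEmb A N v.2

/-- The bilinear pairing of coefficient vectors. -/
def dot {ι : Type*} (a b : ι →₀ ℂ) : ℂ := Finsupp.linearCombination ℂ (fun p => b p) a

/-- Evaluation of the letters: the semicircular variables and the matrix units. -/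
def evalLetters (x : ℕ → Fin d → Matrix (Fin N) (Fin N) A) :
    FreeAlgebra ℂ ((ℕ × Fin d) ⊕ (Fin N × Fin N)) →ₐ[ℂ] Matrix (Fin N) (Fin N) A :=
  FreeAlgebra.lift ℂ (Sum.elim (fun p => x p.1 p.2) fun q => matEmb A N (Matrix.single q.1 q.2 1))

/-- The lift of `affVal` to the free algebra of letters. -/
def affLift (v : (ℕ × Fin d →₀ ℂ) × Matrix (Fin N) (Fin N) ℂ) :
    FreeAlgebra ℂ ((ℕ × Fin d) ⊕ (Fin N × Fin N)) :=
  Finsupp.linearCombination ℂ (fun p => FreeAlgebra.ι ℂ (Sum.inl p)) v.1 +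
    ∑ q : Fin N × Fin N, v.2 q.1 q.2 • FreeAlgebra.ι ℂ (Sum.inr q)

theorem sum_single (m : Matrix (Fin N) (Fin N) ℂ) :
    ∑ q : Fin N × Fin N, m q.1 q.2 • Matrix.single q.1 q.2 (1 : ℂ) = m := by
  conv_rhs => rw [Matrix.matrix_eq_sum_single m]
  rw [Fintype.sum_prod_type]
  simp [Matrix.smul_single]

theorem evalLetters_affLift (x : ℕ → Fin d → Matrix (Fin N) (Fin N) A)
    (v : (ℕ × Fin d →₀ ℂ) × Matrix (Fin N) (Fin N) ℂ) :
    evalLetters x (affLift v) = affVal x v := by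
  rw [affLift, affVal, map_add]
  congr 1
  · rw [Finsupp.linearCombination_apply, Finsupp.linearCombination_apply, Finsupp.sum,
      Finsupp.sum, map_sum]
    simp [evalLetters]
  · conv_rhs => rw [← sum_single v.2, map_sum]
    rw [map_sum]
    refine Finset.sum_congr rfl fun q _ => ?_
    rw [map_smul, map_smul]
    simp [evalLetters]

theorem ncDeriv_affLift (p : ℕ × Fin d)
    (v : (ℕ × Fin d →₀ ℂ) × Matrix (Fin N) (Fin N) ℂ) :
    ncDeriv (Sum.inl p) (affLift v) = v.1 p • (1 ⊗ₜ[ℂ] 1) := by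
  rw [affLift, map_add, map_sum, Finsupp.linearCombination_apply, Finsupp.sum, map_sum]
  simp only [map_smul, ncDeriv_ι]
  simp only [Algebra.TensorProduct.one_def, Sum.inl.injEq, reduceCtorEq, if_false, smul_zero,
    Finset.sum_const_zero, add_zero, smul_ite]
  rw [Finset.sum_ite_eq]
  split_ifs with h
  · rfl
  · rw [Finsupp.notMem_support_iff.1 h, zero_smul]

theorem ncDeriv_prod_affLift (p : ℕ × Fin d)
    (w : List ((ℕ × Fin d →₀ ℂ) × Matrix (Fin N) (Fin N) ℂ)) :
    ncDeriv (Sum.inl p) (w.map affLift).prod = splitSum (fun U v V =>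
      v.1 p • ((U.map affLift).prod ⊗ₜ[ℂ] (V.map affLift).prod)) w := by
  induction w with
  | nil => simpa using ncDeriv_one _
  | cons b w ih =>
    rw [List.map_cons, List.prod_cons, ncDeriv_mul, ncDeriv_affLift, ih, splitSum_cons,
      ← LinearMap.mulLeft_apply (R := ℂ) (_ ⊗ₜ[ℂ] _), map_splitSum]
    congr 1
    · rw [smul_mul_assoc, Algebra.TensorProduct.tmul_mul_tmul, one_mul, one_mul]
      rfl
    · refine splitSum_congr fun U a V _ => ?_
      rw [map_smul, LinearMap.mulLeft_apply, Algebra.TensorProduct.tmul_mul_tmul, one_mul,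
        List.map_cons, List.prod_cons]

end Realization

end

end MasterEquation

open MeasureTheory ProbabilityTheory
open scoped TensorProduct

namespace MasterEquation

noncomputable section

/-! ## Moments of the semicircle distribution -/

/-- The moments of the semicircle distribution on `[-2, 2]`. -/
def scMoment (k : ℕ) : ℝ :=
  ∫ t in (-2 : ℝ)..2, t ^ k * (1 / (2 * Real.pi) * Real.sqrt (4 - t ^ 2))

theorem scMoment_zero : scMoment 0 = 1 := by
  have h := intervalIntegral.integral_comp_mul_left (a := -1) (b := 1)
    (fun t : ℝ => Real.sqrt (4 - t ^ 2)) (two_ne_zero)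
  have h1 : ∀ t : ℝ, Real.sqrt (4 - (2 * t) ^ 2) = 2 * Real.sqrt (1 - t ^ 2) := by
    intro t
    rw [show 4 - (2 * t) ^ 2 = 2 ^ 2 * (1 - t ^ 2) by ring, Real.sqrt_mul (by positivity),
      Real.sqrt_sq (by norm_num)]
  simp only [h1, intervalIntegral.integral_const_mul, integral_sqrt_one_sub_sq] at h
  norm_num at h
  have hpi := Real.pi_ne_zero
  simp only [scMoment, pow_zero, one_mul, intervalIntegral.integral_const_mul]
  rw [show ∫ t in (-2 : ℝ)..2, Real.sqrt (4 - t ^ 2) = 2 * Real.pi by linarith]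
  field_simp

theorem scMoment_odd {k : ℕ} (hk : Odd k) : scMoment k = 0 := by
  have h := intervalIntegral.integral_comp_neg (a := -2) (b := 2)
    (fun t : ℝ => t ^ k * (1 / (2 * Real.pi) * Real.sqrt (4 - t ^ 2)))
  simp only [hk.neg_pow, neg_sq, neg_mul, intervalIntegral.integral_neg, neg_neg] at h
  change - scMoment k = scMoment k at h
  linarith

/-- The derivative of t^{k+1} (4 - t²)^{3/2} / (2π) integrates to zero over [-2, 2], since the
function vanishes at both ends. -/
theorem scMoment_add_two (k : ℕ) : (k + 4 : ℝ) * scMoment (k + 2) = 4 * (k + 1) * scMoment k := by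
  have hc : ∀ j : ℕ, IntervalIntegrable (fun t : ℝ => t ^ j *
      (1 / (2 * Real.pi) * Real.sqrt (4 - t ^ 2))) volume (-2) 2 := fun j =>
    Continuous.intervalIntegrable (by fun_prop) _ _
  have h := intervalIntegral.integral_eq_sub_of_hasDerivAt_of_le (a := -2) (b := 2)
    (f := fun t : ℝ => t ^ (k + 1) * ((4 - t ^ 2) * (1 / (2 * Real.pi) * Real.sqrt (4 - t ^ 2))))
    (f' := fun t => 4 * (k + 1) * (t ^ k * (1 / (2 * Real.pi) * Real.sqrt (4 - t ^ 2))) -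
      (k + 4) * (t ^ (k + 2) * (1 / (2 * Real.pi) * Real.sqrt (4 - t ^ 2)))) (by norm_num)
    (by fun_prop) ?_ (((hc k).const_mul _).sub ((hc (k + 2)).const_mul _))
  · rw [intervalIntegral.integral_sub ((hc k).const_mul _) ((hc (k + 2)).const_mul _),
      intervalIntegral.integral_const_mul, intervalIntegral.integral_const_mul] at h
    norm_num at h
    simp only [scMoment]
    norm_num
    linarith
  · intro t ht
    have hp : 0 < 4 - t ^ 2 := by nlinarith [ht.1, ht.2]
    have hs : 0 < Real.sqrt (4 - t ^ 2) := Real.sqrt_pos.2 hp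
    have hq : HasDerivAt (fun t : ℝ => 4 - t ^ 2) (-(2 * t)) t := by
      simpa using (hasDerivAt_pow 2 t).const_sub 4
    have hd := (hasDerivAt_pow (k + 1) t).mul
      (hq.mul ((hq.sqrt hp.ne').const_mul (1 / (2 * Real.pi))))
    refine hd.congr_deriv ?_
    have hsq : Real.sqrt (4 - t ^ 2) ^ 2 = 4 - t ^ 2 := Real.sq_sqrt hp.le
    have h5 : (4 - t ^ 2) * (1 / (2 * Real.pi) * (-(2 * t) / (2 * Real.sqrt (4 - t ^ 2)))) =
        -(1 / (2 * Real.pi) * t * Real.sqrt (4 - t ^ 2)) := by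
      have : (4 - t ^ 2) / Real.sqrt (4 - t ^ 2) = Real.sqrt (4 - t ^ 2) := Real.div_sqrt
      calc _ = -(1 / (2 * Real.pi) * t * ((4 - t ^ 2) / Real.sqrt (4 - t ^ 2))) := by
            field_simp
        _ = _ := by rw [this]
    simp only [Pi.mul_apply]
    rw [h5, Nat.add_sub_cancel]
    push_cast
    ring

/-- `scMoment_add_two` is the first-order recursion of the Catalan numbers, here taken from the
central binomial coefficients. -/
theorem scMoment_even (j : ℕ) : scMoment (2 * j) = catalan j := by
  induction j with
  | zero => simp [scMoment_zero]
  | succ j ih =>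
    have h := scMoment_add_two (2 * j)
    rw [ih] at h
    have h1 : ∀ j : ℕ, ((j : ℝ) + 1) * catalan j = Nat.centralBinom j := fun j => by
      exact_mod_cast succ_mul_catalan_eq_centralBinom j
    have h2 : ((j : ℝ) + 1) * Nat.centralBinom (j + 1) = 2 * (2 * j + 1) * Nat.centralBinom j := by
      exact_mod_cast Nat.succ_mul_centralBinom_succ j
    have h3 := h1 (j + 1)
    rw [← h3, ← h1 j] at h2
    push_cast at h h2 ⊢
    rw [show 2 * (j + 1) = 2 * j + 2 by ring]
    have hj : ((j : ℝ) + 1) * (j + 2) ≠ 0 := by positivity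
    apply mul_left_cancel₀ hj
    linear_combination ((j : ℝ) + 1) / 2 * h - h2

/-- This is the Catalan convolution, once the vanishing odd moments are discarded. It is the
Schwinger-Dyson equation of one semicircular variable, tested on powers. -/
theorem scMoment_recursion (k : ℕ) : scMoment (k + 2) =
    ∑ ij ∈ Finset.HasAntidiagonal.antidiagonal k, scMoment ij.1 * scMoment ij.2 := by
  rcases Nat.even_or_odd' k with ⟨j, rfl | rfl⟩
  · rw [show 2 * j + 2 = 2 * (j + 1) by ring, scMoment_even, catalan_succ']
    push_cast
    symm
    have hinj : Function.Injective fun p : ℕ × ℕ => (2 * p.1, 2 * p.2) := fun p q h => by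
      simp only [Prod.mk.injEq] at h
      ext <;> omega
    have hsub : (Finset.HasAntidiagonal.antidiagonal j).image (fun p => (2 * p.1, 2 * p.2)) ⊆
        Finset.HasAntidiagonal.antidiagonal (2 * j) := by
      intro p hp
      obtain ⟨q, hq, rfl⟩ := Finset.mem_image.1 hp
      rw [Finset.HasAntidiagonal.mem_antidiagonal] at hq ⊢
      dsimp only
      omega
    -- The pairs outside the image have odd entries and do not contribute.
    rw [← Finset.sum_subset hsub, Finset.sum_image hinj.injOn]
    · simp only [scMoment_even]
    · rintro ⟨a, b⟩ hp hq
      rw [Finset.HasAntidiagonal.mem_antidiagonal] at hp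
      dsimp only at hp
      rcases Nat.even_or_odd' a with ⟨a', rfl | rfl⟩
      · exfalso
        refine hq (Finset.mem_image.2 ⟨(a', j - a'), ?_, ?_⟩)
        · rw [Finset.HasAntidiagonal.mem_antidiagonal]
          dsimp only
          omega
        · ext <;> dsimp only
          omega
      · rw [scMoment_odd ⟨a', rfl⟩, zero_mul]
  · rw [scMoment_odd ⟨j + 1, by ring⟩]
    symm
    refine Finset.sum_eq_zero fun p hp => ?_
    have := (Finset.HasAntidiagonal.mem_antidiagonal).1 hp
    rcases Nat.even_or_odd p.1 with h | h
    · rw [scMoment_odd (k := p.2), mul_zero]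
      rw [Nat.odd_iff]; rw [Nat.even_iff] at h; omega
    · rw [scMoment_odd h, zero_mul]

end

end MasterEquation

open MeasureTheory ProbabilityTheory
open scoped TensorProduct

namespace MasterEquation

noncomputable section

/-! ### The Schwinger-Dyson equation and the matrix-valued moments of free semicircular families -/

section SemicircularFamily

variable {A : Type*} [CStarAlgebra A] {N d : ℕ}

theorem ncDeriv_ι_pow {Y : Type*} [DecidableEq Y] (v : Y) (k : ℕ) :
    ncDeriv v (FreeAlgebra.ι ℂ v ^ (k + 1)) = ∑ ij ∈ Finset.HasAntidiagonal.antidiagonal k,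
      (FreeAlgebra.ι ℂ v ^ ij.1) ⊗ₜ[ℂ] (FreeAlgebra.ι ℂ v ^ ij.2) := by
  induction k with
  | zero => simp [ncDeriv_ι, Algebra.TensorProduct.one_def]
  | succ k ih =>
    rw [pow_succ', ncDeriv_mul, ih, Finset.Nat.sum_antidiagonal_succ, ncDeriv_ι, if_pos rfl,
      one_mul, Finset.mul_sum]
    simp [pow_succ']

variable {τ : A →L[ℂ] ℂ} {x : ℕ → Fin d → Matrix (Fin N) (Fin N) A}

/-- The functional `τ_N` on the free algebra of letters. -/
def letterTrace (τ : A →L[ℂ] ℂ) (x : ℕ → Fin d → Matrix (Fin N) (Fin N) A) :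
    FreeAlgebra ℂ ((ℕ × Fin d) ⊕ (Fin N × Fin N)) →ₗ[ℂ] ℂ :=
  traceN N τ ∘ₗ (evalLetters x).toLinearMap

theorem letterTrace_apply (Q : FreeAlgebra ℂ ((ℕ × Fin d) ⊕ (Fin N × Fin N))) :
    letterTrace τ x Q = traceN N τ (evalLetters x Q) := rfl

theorem evalLetters_mem {j : Option (ℕ × Fin d)}
    {a : FreeAlgebra ℂ ((ℕ × Fin d) ⊕ (Fin N × Fin N))} (ha : a ∈ letterAlg _ _ j) :
    evalLetters x a ∈ j.elim (matEmb A N).range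
      (fun p => StarAlgebra.adjoin ℂ {x p.1 p.2}) := by
  have gen : ∀ (X : Set (FreeAlgebra ℂ ((ℕ × Fin d) ⊕ (Fin N × Fin N))))
      (S : StarSubalgebra ℂ (Matrix (Fin N) (Fin N) A)), (∀ z ∈ X, evalLetters x z ∈ S) →
      a ∈ Algebra.adjoin ℂ X → evalLetters x a ∈ S := by
    intro X S hX haX
    have : Algebra.adjoin ℂ X ≤ S.toSubalgebra.comap (evalLetters x) := Algebra.adjoin_le hX
    exact this haX
  cases j with
  | none =>
    refine gen _ _ ?_ ha
    rintro _ ⟨q, rfl⟩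
    exact ⟨Matrix.single q.1 q.2 1, by simp [evalLetters]⟩
  | some p =>
    refine gen _ _ ?_ ha
    rintro _ rfl
    have : evalLetters x (FreeAlgebra.ι ℂ (Sum.inl p)) = x p.1 p.2 := by simp [evalLetters]
    rw [this]
    exact StarAlgebra.subset_adjoin ℂ _ rfl

/-- A reduced sequence of letters evaluates to an alternating product of centred elements of the
free subalgebras, for which the centring in `IsFree` changes nothing. -/
theorem respectsReduced_letterTrace (hx : IsFreeSemicircularSequence N τ x) :
    RespectsReduced (letterAlg (ℕ × Fin d) (Fin N × Fin N)) (letterTrace τ x) := by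
  intro w hw hne
  obtain ⟨k, hk⟩ : ∃ k, w.length = k + 1 :=
    ⟨w.length - 1, by have := List.length_pos_iff.2 hne; omega⟩
  have h := hx.free k (fun r => (w.get (r.cast hk.symm)).1)
    (fun r => evalLetters x (w.get (r.cast hk.symm)).2)
    (fun r => evalLetters_mem (hw.2 _ (List.get_mem _ _)).1) (fun r => by
      have := List.isChain_iff_getElem.1 hw.1 r.1 (by omega)
      exact this)
  have h0 : ∀ r : Fin (k + 1), traceN N τ (evalLetters x (w.get (r.cast hk.symm)).2) = 0 :=
    fun r => (hw.2 _ (List.get_mem _ _)).2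
  simp only [h0, map_zero, sub_zero] at h
  rw [letterTrace_apply, sprod, map_list_prod, List.map_map, ← h]
  congr 2
  refine List.ext_get (by simp [hk]) fun n h1 h2 => ?_
  rw [List.get_ofFn]
  simp

/-- Freeness reduces the equation to polynomials in a single variable, where by linearity it is the
moment recursion `scMoment_recursion`. -/
theorem schwingerDyson_letterTrace (hτ : IsTrace τ) (hN : 1 ≤ N)
    (hx : IsFreeSemicircularSequence N τ x) (p : ℕ × Fin d)
    (Q : FreeAlgebra ℂ ((ℕ × Fin d) ⊕ (Fin N × Fin N))) :
    letterTrace τ x (FreeAlgebra.ι ℂ (Sum.inl p) * Q) =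
      tensorSq (letterTrace τ x) (ncDeriv (Sum.inl p) Q) := by
  refine schwingerDyson (respectsReduced_letterTrace hx)
    (by rw [letterTrace_apply, map_one, traceN_one hτ hN]) p (fun a ha => ?_) Q
  have hm : ∀ k, letterTrace τ x (FreeAlgebra.ι ℂ (Sum.inl p) ^ k) = (scMoment k : ℂ) := by
    intro k
    rw [letterTrace_apply, map_pow]
    have : evalLetters x (FreeAlgebra.ι ℂ (Sum.inl p)) = x p.1 p.2 := by simp [evalLetters]
    rw [this, (hx.semicircular p.1 p.2).moment]
    rfl
  rw [letterAlg, Algebra.adjoin_singleton_eq_range_aeval] at ha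
  obtain ⟨q, rfl⟩ := ha
  change letterTrace τ x (FreeAlgebra.ι ℂ (Sum.inl p) * Polynomial.aeval _ q) =
    tensorSq (letterTrace τ x) (ncDeriv (Sum.inl p) (Polynomial.aeval _ q))
  induction q using Polynomial.induction_on' with
  | add f g hf hg => simp only [map_add, mul_add, hf, hg]
  | monomial k c =>
    rw [← Polynomial.C_mul_X_pow_eq_monomial]
    simp only [map_mul, Polynomial.aeval_C, map_pow, Polynomial.aeval_X,
      Algebra.algebraMap_eq_smul_one, smul_one_mul, mul_smul_comm, map_smul]
    congr 1
    rw [← pow_succ', hm]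
    cases k with
    | zero => rw [pow_zero, ncDeriv_one, map_zero, zero_add, scMoment_odd odd_one, Complex.ofReal_zero]
    | succ k =>
      rw [ncDeriv_ι_pow, map_sum, scMoment_recursion]
      push_cast
      simp only [tensorSq_tmul, hm]

/-- The Schwinger-Dyson equation for affine combinations of semicircular elements. -/
theorem traceN_mul_prod_affVal (hτ : IsTrace τ) (hN : 1 ≤ N)
    (hx : IsFreeSemicircularSequence N τ x) (a : ℕ × Fin d →₀ ℂ)
    (w : List ((ℕ × Fin d →₀ ℂ) × Matrix (Fin N) (Fin N) ℂ)) :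
    traceN N τ (Finsupp.linearCombination ℂ (fun p : ℕ × Fin d => x p.1 p.2) a *
      (w.map (affVal x)).prod) =
    splitSum (fun U v V => dot a v.1 * (traceN N τ (U.map (affVal x)).prod *
      traceN N τ (V.map (affVal x)).prod)) w := by
  have hw : ∀ w : List ((ℕ × Fin d →₀ ℂ) × Matrix (Fin N) (Fin N) ℂ),
      (w.map (affVal x)).prod = evalLetters x (w.map affLift).prod := by
    intro w
    rw [map_list_prod, List.map_map]
    congr 2
    ext1 v
    exact (evalLetters_affLift x v).symm
  have hp : ∀ p : ℕ × Fin d, traceN N τ (x p.1 p.2 * (w.map (affVal x)).prod) =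
      splitSum (fun U v V => v.1 p * (traceN N τ (U.map (affVal x)).prod *
        traceN N τ (V.map (affVal x)).prod)) w := by
    intro p
    have h := schwingerDyson_letterTrace hτ hN hx p (w.map affLift).prod
    have hxp : evalLetters x (FreeAlgebra.ι ℂ (Sum.inl p)) = x p.1 p.2 := by simp [evalLetters]
    rw [letterTrace_apply, map_mul, hxp, ncDeriv_prod_affLift, map_splitSum] at h
    simp only [hw]
    rw [h]
    simp only [map_smul, tensorSq_tmul, letterTrace_apply, smul_eq_mul]
  rw [Finsupp.linearCombination_apply, Finsupp.sum, Finset.sum_mul, map_sum]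
  simp only [smul_mul_assoc, map_smul, hp, ← splitSum_smul]
  rw [← splitSum_sum]
  refine splitSum_congr fun U v V _ => ?_
  rw [dot, Finsupp.linearCombination_apply, Finsupp.sum, Finset.sum_mul]
  simp only [smul_eq_mul, mul_assoc]

theorem affVal_const (x : ℕ → Fin d → Matrix (Fin N) (Fin N) A)
    (k : Matrix (Fin N) (Fin N) ℂ) : affVal x (0, k) = matEmb A N k := by
  simp [affVal]

theorem dot_zero_right {ι : Type*} (a : ι →₀ ℂ) : dot a 0 = 0 := by
  simp [dot, Finsupp.linearCombination_apply]

theorem dot_zero_left {ι : Type*} (a : ι →₀ ℂ) : dot 0 a = 0 := by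
  simp [dot]

/-- The matrix-valued moments of affine combinations of semicircular elements. -/
theorem entryMean_prod_affVal (hτ : IsTrace τ) (hN : 1 ≤ N)
    (hx : IsFreeSemicircularSequence N τ x)
    (w : List ((ℕ × Fin d →₀ ℂ) × Matrix (Fin N) (Fin N) ℂ)) :
    entryMean N τ (w.map (affVal x)).prod = mom (fun v w => dot v.1 w.1) Prod.snd w := by
  refine mom_unique (E := fun w => entryMean N τ (w.map (affVal x)).prod)
    (entryMean_one hτ) (fun v w => ?_) w
  have key : entryMean N τ (Finsupp.linearCombination ℂ (fun p : ℕ × Fin d => x p.1 p.2) v.1 *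
      (w.map (affVal x)).prod) = splitSum (fun U a V => (dot v.1 a.1 *
        ntr N (entryMean N τ (U.map (affVal x)).prod)) •
          entryMean N τ (V.map (affVal x)).prod) w := by
    ext r s
    rw [splitSum_apply, entry_eq_ntr hN (entryMean N τ (_ * _)) r s, ← entryMean_matEmb_mul,
      ← traceN_eq, traceN_mul_comm hτ, mul_assoc]
    -- The matrix unit is appended as one more letter. It has no semicircular part, hence is never a
    -- partner, and stays in the right-hand word V, where it reads off an entry of the conditional
    -- expectation of V.
    have h := traceN_mul_prod_affVal hτ hN hx v.1 (w ++ [(0, Matrix.single s r 1)])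
    rw [List.map_append, List.prod_append, List.map_singleton, List.prod_singleton, affVal_const,
      splitSum_append, splitSum_cons, splitSum_nil, dot_zero_right, zero_mul, add_zero,
      add_zero] at h
    rw [h, ← smul_eq_mul, ← splitSum_smul]
    refine splitSum_congr fun U a V _ => ?_
    rw [List.map_append, List.prod_append, List.map_singleton, List.prod_singleton, affVal_const,
      traceN_mul_comm hτ _ (matEmb A N _), traceN_eq τ (matEmb A N _ * _), entryMean_matEmb_mul,
      Matrix.smul_apply, entry_eq_ntr hN (entryMean N τ (V.map (affVal x)).prod), traceN_eq]
    simp only [smul_eq_mul]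
    ring
  rw [List.map_cons, List.prod_cons, ← key, affVal, add_mul, map_add, entryMean_matEmb_mul,
    add_comm]

/-- The moments of a family `f` of affine combinations of semicircular elements. -/
theorem entryMean_lift_affVal (hτ : IsTrace τ) (hN : 1 ≤ N)
    (hx : IsFreeSemicircularSequence N τ x) {Y : Type*}
    (f : Y → (ℕ × Fin d →₀ ℂ) × Matrix (Fin N) (Fin N) ℂ) (Q : FreeAlgebra ℂ Y) :
    entryMean N τ (FreeAlgebra.lift ℂ (fun v => affVal x (f v)) Q) =
      momL (fun v w => dot (f v).1 (f w).1) (fun v => (f v).2) Q := by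
  induction Q using freeAlgebra_induction with
  | hw w =>
    rw [lift_word, momL_word, ← mom_map f (fun v w => dot v.1 w.1) Prod.snd, ← entryMean_prod_affVal hτ hN hx, List.map_map]
    rfl
  | hadd a b ha hb => simp only [map_add, ha, hb]
  | hsmul c a ha => simp only [map_smul, ha]

/-- On a word the derivatives mark each possible partner once, so this is `traceN_mul_prod_affVal`
rewritten in terms of ∂_v. -/
theorem traceN_mul_lift_affVal (hτ : IsTrace τ) (hN : 1 ≤ N)
    (hx : IsFreeSemicircularSequence N τ x) {Y : Type*} [Fintype Y] [DecidableEq Y]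
    (f : Y → (ℕ × Fin d →₀ ℂ) × Matrix (Fin N) (Fin N) ℂ) (a : ℕ × Fin d →₀ ℂ)
    (Q : FreeAlgebra ℂ Y) :
    traceN N τ (Finsupp.linearCombination ℂ (fun p : ℕ × Fin d => x p.1 p.2) a *
      FreeAlgebra.lift ℂ (fun v => affVal x (f v)) Q) =
    ∑ v, dot a (f v).1 * tensorSq (traceN N τ ∘ₗ
      (FreeAlgebra.lift ℂ (fun v => affVal x (f v))).toLinearMap) (ncDeriv v Q) := by
  induction Q using freeAlgebra_induction with
  | hw w =>
    have h := traceN_mul_prod_affVal hτ hN hx a (w.map f)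
    rw [List.map_map, splitSum_map] at h
    rw [lift_word]
    refine h.trans ?_
    simp only [ncDeriv_word, map_splitSum, ← smul_eq_mul (a := dot a _), ← splitSum_smul,
      ← splitSum_sum]
    refine splitSum_congr fun U b V _ => ?_
    simp only [ite_smul, one_smul, zero_smul]
    rw [Finset.sum_eq_single b (fun v _ hv => by rw [if_neg hv, map_zero, smul_zero]) (by simp),
      if_pos rfl, tensorSq_tmul]
    simp only [LinearMap.comp_apply, AlgHom.toLinearMap_apply, lift_word, List.map_map]
    rfl
  | hadd b c hb hc => simp only [map_add, mul_add, hb, hc, Finset.sum_add_distrib]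
  | hsmul r b hb =>
    simp only [map_smul, mul_smul_comm, hb, Finset.smul_sum]

end SemicircularFamily

end

end MasterEquation

open MeasureTheory ProbabilityTheory
open scoped TensorProduct

namespace MasterEquation

noncomputable section

/-! ## Gaussian integration by parts -/

/-- The Gaussian density φ satisfies φ' = -gφ, and the integral of (fφ)' is zero. The three
integrability hypotheses replace boundary conditions at infinity. -/
theorem integral_mul_gaussianReal {f f' : ℝ → ℂ} (hd : ∀ g, HasDerivAt f (f' g) g)
    (hf : Integrable f (gaussianReal 0 1)) (hf' : Integrable f' (gaussianReal 0 1))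
    (hgf : Integrable (fun g : ℝ => (g : ℂ) * f g) (gaussianReal 0 1)) :
    ∫ g, (g : ℂ) * f g ∂(gaussianReal 0 1) = ∫ g, f' g ∂(gaussianReal 0 1) := by
  have hi : ∀ h : ℝ → ℂ, Integrable h (gaussianReal 0 1) →
      Integrable (fun g => gaussianPDFReal 0 1 g • h g) := by
    intro h hh
    rw [gaussianReal_of_var_ne_zero _ one_ne_zero,
      integrable_withDensity_iff_integrable_smul' (measurable_gaussianPDF 0 1)
        (ae_of_all _ fun _ => gaussianPDF_lt_top)] at hh
    simpa only [toReal_gaussianPDF] using hh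
  have hp : ∀ g, HasDerivAt (gaussianPDFReal 0 1) (-g * gaussianPDFReal 0 1 g) g := by
    intro g
    have h1 : HasDerivAt (fun x : ℝ => -(x - 0) ^ 2 / (2 * ((1 : NNReal) : ℝ))) (-g) g := by
      have h0 := ((((hasDerivAt_id g).sub_const 0).pow 2).neg).div_const
        (2 * ((1 : NNReal) : ℝ))
      refine h0.congr_deriv ?_
      simp
      ring
    have := (h1.exp).const_mul (Real.sqrt (2 * Real.pi * (1 : NNReal)))⁻¹
    refine this.congr_deriv ?_
    rw [gaussianPDFReal_def]
    ring
  have h := integral_eq_zero_of_hasDerivAt_of_integrable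
    (f := fun g => gaussianPDFReal 0 1 g • f g)
    (f' := fun g => gaussianPDFReal 0 1 g • f' g - gaussianPDFReal 0 1 g • ((g : ℂ) * f g))
    (fun g => ((hp g).smul (hd g)).congr_deriv (by
      simp only [Complex.real_smul]; push_cast; ring))
    ((hi _ hf').sub (hi _ hgf)) (hi _ hf)
  rw [integral_sub (hi _ hf') (hi _ hgf), sub_eq_zero] at h
  rw [integral_gaussianReal_eq_integral_smul one_ne_zero,
    integral_gaussianReal_eq_integral_smul one_ne_zero, h]

/-! ### Integration by parts in one of several independent Gaussian coordinates -/

section Vector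

variable {Ω Q : Type*} [MeasurableSpace Ω] {μ : Measure Ω} [IsProbabilityMeasure μ]
  [Fintype Q] [DecidableEq Q]

/-- Gaussian integration by parts with respect to one of finitely many independent standard
Gaussian variables. -/
theorem integral_mul_gaussian_vector {G : Ω → Q → ℝ} (hm : ∀ q, Measurable fun ω => G ω q)
    (hlaw : ∀ q, μ.map (fun ω => G ω q) = gaussianReal 0 1)
    (hind : iIndepFun (fun q ω => G ω q) μ) (q : Q) {Ψ Ψ' : (Q → ℝ) → ℂ}
    (hΨ : Measurable Ψ) (hΨ' : Measurable Ψ')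
    (hd : ∀ y, HasDerivAt (fun g : ℝ => Ψ (Function.update y q g)) (Ψ' y) (y q))
    (h1 : Integrable (fun ω => Ψ (G ω)) μ) (h2 : Integrable (fun ω => (G ω q : ℂ) * Ψ (G ω)) μ)
    (h3 : Integrable (fun ω => Ψ' (G ω)) μ) :
    ∫ ω, (G ω q : ℂ) * Ψ (G ω) ∂μ = ∫ ω, Ψ' (G ω) ∂μ := by
  have hGm : Measurable G := measurable_pi_lambda _ hm
  have hRm : Measurable fun ω => Function.update (G ω) q 0 :=
    measurable_pi_lambda _ fun r => by
      by_cases h : r = q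
      · subst h; simp
      · simpa [h] using hm r
  -- Coordinate q is independent of the vector in which it has been reset to 0; the latter retains
  -- all other coordinates.
  have hI : IndepFun (fun ω => G ω q) (fun ω => Function.update (G ω) q 0) μ := by
    have h := hind.indepFun_finset {q} (Finset.univ.erase q) (by simp) hm
    have h' := h.comp (φ := fun y : (({q} : Finset Q) → ℝ) => y ⟨q, Finset.mem_singleton_self q⟩)
      (ψ := fun y r => if hr : r = q then 0 else
        y ⟨r, Finset.mem_erase.2 ⟨hr, Finset.mem_univ r⟩⟩)
      (measurable_pi_apply (X := fun _ : ({q} : Finset Q) => ℝ) _)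
      (measurable_pi_lambda _ fun r => by
        by_cases hr : r = q
        · simp [hr]
        · simpa [hr] using measurable_pi_apply _)
    have e : (fun ω => Function.update (G ω) q 0) = (fun (y : Finset.univ.erase q → ℝ) r =>
        if hr : r = q then 0 else y ⟨r, Finset.mem_erase.2 ⟨hr, Finset.mem_univ r⟩⟩) ∘
        fun ω (i : Finset.univ.erase q) => G ω i := by
      ext ω r
      by_cases hr : r = q
      · subst hr; simp
      · simp [hr]
    rw [e]
    exact h'
  have hlawp := hI.map_prod_eq_prod_map_map (hm q).aemeasurable hRm.aemeasurable
  rw [hlaw q] at hlawp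
  set ν := μ.map fun ω => Function.update (G ω) q 0
  have : IsProbabilityMeasure ν := Measure.isProbabilityMeasure_map hRm.aemeasurable
  have hpm : Measurable fun ω => (G ω q, Function.update (G ω) q 0) := (hm q).prodMk hRm
  have hum : Measurable fun p : ℝ × (Q → ℝ) => Function.update p.2 q p.1 :=
    measurable_pi_lambda _ fun r => by
      by_cases h : r = q
      · subst h; simpa using measurable_fst
      · simpa [h, Function.comp_def] using (measurable_pi_apply r).comp measurable_snd
  -- Restoring coordinate q recovers G, so an expectation becomes an iterated integral with the
  -- Gaussian variable innermost.
  have key : ∀ Φ : (Q → ℝ) → ℂ, Measurable Φ → Integrable (fun ω => Φ (G ω)) μ →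
      Integrable (fun p : ℝ × (Q → ℝ) => Φ (Function.update p.2 q p.1))
        ((gaussianReal 0 1).prod ν) ∧ ∫ ω, Φ (G ω) ∂μ =
        ∫ y, ∫ g, Φ (Function.update y q g) ∂(gaussianReal 0 1) ∂ν := by
    intro Φ hΦ hi
    have hmeas : Measurable fun p : ℝ × (Q → ℝ) => Φ (Function.update p.2 q p.1) := hΦ.comp hum
    have he : ∀ ω, Φ (Function.update (Function.update (G ω) q 0) q (G ω q)) = Φ (G ω) := by
      intro ω; simp
    have hi' : Integrable (fun p : ℝ × (Q → ℝ) => Φ (Function.update p.2 q p.1))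
        ((gaussianReal 0 1).prod ν) := by
      rw [← hlawp, integrable_map_measure hmeas.aestronglyMeasurable hpm.aemeasurable]
      simpa only [Function.comp_def, he] using hi
    refine ⟨hi', ?_⟩
    rw [← integral_prod_symm _ hi', ← hlawp, integral_map hpm.aemeasurable
      hmeas.aestronglyMeasurable]
    simp only [he]
  have hm2 : Measurable fun y : Q → ℝ => (y q : ℂ) * Ψ y :=
    (Complex.measurable_ofReal.comp (measurable_pi_apply q)).mul hΨ
  obtain ⟨i1, -⟩ := key Ψ hΨ h1
  obtain ⟨i2, e2⟩ := key (fun y => (y q : ℂ) * Ψ y) hm2 h2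
  obtain ⟨i3, e3⟩ := key Ψ' hΨ' h3
  rw [e2, e3]
  refine integral_congr_ae ?_
  filter_upwards [i1.prod_left_ae, i2.prod_left_ae, i3.prod_left_ae] with y j1 j2 j3
  simp only [Function.update_self] at j2 ⊢
  -- The hypothesis `hd` differentiates at the base point only; taken at `Function.update y q g`, it
  -- gives the derivative of the slice through y at every g.
  refine integral_mul_gaussianReal (fun g => ?_) j1 j3 j2
  simpa using hd (Function.update y q g)

end Vector

/-! ## Coordinates of Hermitian matrices -/

section Coordinates

variable {N d : ℕ}

/-- The matrices dual to the coordinates `gueCoord`. -/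
def gueBasis (N : ℕ) (p : Fin N × Fin N) : Matrix (Fin N) (Fin N) ℂ :=
  if p.1 = p.2 then ((1 / Real.sqrt N : ℝ) : ℂ) • Matrix.single p.1 p.1 1
  else if p.1 < p.2 then ((1 / Real.sqrt (2 * N) : ℝ) : ℂ) •
    (Matrix.single p.1 p.2 1 + Matrix.single p.2 p.1 1)
  else (((1 / Real.sqrt (2 * N) : ℝ) : ℂ) * Complex.I) •
    (Matrix.single p.2 p.1 1 - Matrix.single p.1 p.2 1)

/-- Twice either sum is the sum over p of the terms at p and at the transposed pair, so identities
for Hermitian coordinates can be checked on the blocks {(r, s), (s, r)}. -/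
theorem sum_prod_eq_of_symm {M : Type*} [AddCommGroup M] [Module ℂ M]
    {f g : Fin N × Fin N → M} (hd : ∀ r, f (r, r) = g (r, r))
    (h : ∀ r s, r < s → f (r, s) + f (s, r) = g (r, s) + g (s, r)) :
    ∑ p, f p = ∑ p, g p := by
  have hs : ∀ f : Fin N × Fin N → M, (2 : ℂ) • ∑ p, f p = ∑ p : Fin N × Fin N,
      (f (p.1, p.2) + f (p.2, p.1)) := by
    intro f
    rw [Finset.sum_add_distrib, two_smul]
    congr 1
    rw [Fintype.sum_prod_type, Fintype.sum_prod_type, Finset.sum_comm]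
  have : (2 : ℂ) • ∑ p, f p = (2 : ℂ) • ∑ p, g p := by
    rw [hs, hs]
    refine Finset.sum_congr rfl fun p _ => ?_
    rcases lt_trichotomy p.1 p.2 with hp | hp | hp
    · exact h _ _ hp
    · rw [hp, hd]
    · rw [add_comm, h _ _ hp, add_comm]
  exact smul_right_injective M (two_ne_zero' ℂ) this

theorem sqrt_two_mul_natCast (N : ℕ) : Real.sqrt (2 * N) * Real.sqrt (2 * N) = 2 * N :=
  Real.mul_self_sqrt (by positivity)

theorem sum_gueCoord (hN : 1 ≤ N) {M : Matrix (Fin N) (Fin N) ℂ} (hM : M.IsHermitian) :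
    ∑ p, (gueCoord M p : ℂ) • gueBasis N p = M := by
  have hN' : (0 : ℝ) < N := by exact_mod_cast hN
  have h1 : Real.sqrt N ≠ 0 := (Real.sqrt_pos.2 hN').ne'
  have h2 : Real.sqrt (2 * N) ≠ 0 := (Real.sqrt_pos.2 (by positivity)).ne'
  rw [← sum_single M]
  conv_lhs => rw [sum_single M]
  refine sum_prod_eq_of_symm (fun r => ?_) fun r s hrs => ?_
  · have hre : ((M r r).re : ℂ) = M r r := by
      have := hM.apply r r
      exact Complex.conj_eq_iff_re.1 this
    simp only [gueCoord, gueBasis, if_true, smul_smul]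
    rw [← Complex.ofReal_mul, show Real.sqrt N * (M r r).re * (1 / Real.sqrt N) = (M r r).re by
      field_simp, hre]
  · have hsr : M s r = (starRingEnd ℂ) (M r s) := (hM.apply s r).symm
    have e1 : ∀ a : ℝ, Real.sqrt (2 * N) * a * (1 / Real.sqrt (2 * N)) = a := fun a => by
      field_simp
    simp only [gueCoord, gueBasis, hrs.ne, hrs.ne', hrs, not_lt_of_gt hrs, if_true, if_false,
      smul_smul]
    rw [← mul_assoc, ← Complex.ofReal_mul, ← Complex.ofReal_mul, e1, e1, hsr]
    conv_rhs => rw [← Complex.re_add_im (M r s)]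
    simp only [map_add, map_mul, Complex.conj_ofReal, Complex.conj_I]
    module

/-- This is the GUE covariance (1/N) ∑ E_{rs} ⊗ E_{sr}. For r < s the symmetric and antisymmetric
directions contribute (1/2N)[(E_{rs} + E_{sr})^{⊗2} - (E_{rs} - E_{sr})^{⊗2}], in which only the
mixed terms survive. -/
theorem sum_gueBasis {M : Type*} [AddCommGroup M] [Module ℂ M] (hN : 1 ≤ N)
    (F : Matrix (Fin N) (Fin N) ℂ →ₗ[ℂ] Matrix (Fin N) (Fin N) ℂ →ₗ[ℂ] M) :
    ∑ p, F (gueBasis N p) (gueBasis N p) = (1 / (N : ℂ)) • ∑ p : Fin N × Fin N,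
      F (Matrix.single p.1 p.2 1) (Matrix.single p.2 p.1 1) := by
  have hN' : (0 : ℝ) < N := by exact_mod_cast hN
  have hN0 : (N : ℂ) ≠ 0 := by exact_mod_cast (by omega : N ≠ 0)
  rw [Finset.smul_sum]
  refine sum_prod_eq_of_symm (fun r => ?_) fun r s hrs => ?_
  · simp only [gueBasis, if_true, map_smul, LinearMap.smul_apply, smul_smul]
    rw [← Complex.ofReal_mul, div_mul_div_comm, Real.mul_self_sqrt hN'.le]
    simp
  · simp only [gueBasis, hrs.ne, hrs.ne', hrs, not_lt_of_gt hrs, if_true, if_false,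
      map_smul, LinearMap.smul_apply, map_add, map_sub, LinearMap.add_apply, LinearMap.sub_apply]
    have e : ((1 / Real.sqrt (2 * N) : ℝ) : ℂ) * ((1 / Real.sqrt (2 * N) : ℝ) : ℂ) =
        1 / (2 * N) := by
      rw [← Complex.ofReal_mul, div_mul_div_comm, sqrt_two_mul_natCast]
      push_cast; ring
    simp only [smul_smul, smul_add, smul_sub]
    have e' : ((1 / Real.sqrt (2 * N) : ℝ) : ℂ) * Complex.I *
        (((1 / Real.sqrt (2 * N) : ℝ) : ℂ) * Complex.I) = - (1 / (2 * N)) := by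
      rw [mul_mul_mul_comm, e, Complex.I_mul_I]; ring
    rw [e, e']
    have e3 : (1 / (N : ℂ)) = 1 / (2 * N) + 1 / (2 * N) := by field_simp; norm_num
    rw [e3]
    module

end Coordinates

/-! ## Integrability of polynomial functions of the GUE matrices -/

section Integrability

variable {N d : ℕ}

/-- A norm-like function of a tuple of matrices. -/
def gnorm (M : Fin d → Matrix (Fin N) (Fin N) ℂ) : ℝ :=
  1 + ∑ q : Fin d × Fin N × Fin N, ‖M q.1 q.2.1 q.2.2‖

theorem one_le_gnorm (M : Fin d → Matrix (Fin N) (Fin N) ℂ) : 1 ≤ gnorm M := by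
  have : 0 ≤ ∑ q : Fin d × Fin N × Fin N, ‖M q.1 q.2.1 q.2.2‖ := by positivity
  unfold gnorm; linarith

theorem norm_entry_le_gnorm (M : Fin d → Matrix (Fin N) (Fin N) ℂ) (i : Fin d) (r s : Fin N) :
    ‖M i r s‖ ≤ gnorm M := by
  have := Finset.single_le_sum (f := fun q : Fin d × Fin N × Fin N => ‖M q.1 q.2.1 q.2.2‖)
    (fun _ _ => norm_nonneg _) (Finset.mem_univ (i, r, s))
  dsimp only at this
  unfold gnorm; linarith

theorem sum_pow_le_card_pow_mul {ι : Type*} (s : Finset ι) (f : ι → ℝ) (hf : ∀ i ∈ s, 0 ≤ f i)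
    {n : ℕ} (hn : n ≠ 0) : (∑ i ∈ s, f i) ^ n ≤ (s.card : ℝ) ^ n * ∑ i ∈ s, f i ^ n := by
  rcases s.eq_empty_or_nonempty with rfl | hs
  · simp [hn]
  obtain ⟨i, hi, hmax⟩ := s.exists_max_image f hs
  have h1 : ∑ j ∈ s, f j ≤ s.card * f i := by
    simpa using Finset.sum_le_card_nsmul s f (f i) hmax
  calc (∑ j ∈ s, f j) ^ n ≤ (s.card * f i) ^ n :=
        pow_le_pow_left₀ (Finset.sum_nonneg hf) h1 n
    _ = s.card ^ n * f i ^ n := mul_pow _ _ _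
    _ ≤ s.card ^ n * ∑ j ∈ s, f j ^ n := by
        gcongr
        exact Finset.single_le_sum (f := fun j => f j ^ n) (fun j hj => pow_nonneg (hf j hj) n) hi

theorem re_sq_apply {K : Matrix (Fin N) (Fin N) ℂ} (hK : K.IsHermitian) (r : Fin N) :
    ((K ^ 2) r r).re = ∑ s, ‖K r s‖ ^ 2 := by
  rw [sq, Matrix.mul_apply, Complex.re_sum]
  refine Finset.sum_congr rfl fun s _ => ?_
  rw [← hK.apply s r, Complex.star_def, Complex.mul_conj, Complex.ofReal_re,
    Complex.normSq_eq_norm_sq]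

/-- Repeated squaring: (K²)_{rr} = ∑_s |K_{rs}|² for Hermitian K. At each later step the same
identity is applied to a power of K and only the diagonal term is kept. -/
theorem norm_pow_le_re_pow_apply {K : Matrix (Fin N) (Fin N) ℂ} (hK : K.IsHermitian)
    (r s : Fin N) (j : ℕ) : ‖K r s‖ ^ 2 ^ (j + 1) ≤ ((K ^ 2 ^ (j + 1)) r r).re := by
  induction j with
  | zero =>
    rw [zero_add, pow_one, re_sq_apply hK]
    exact Finset.single_le_sum (f := fun s => ‖K r s‖ ^ 2) (fun _ _ => by positivity)
      (Finset.mem_univ s)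
  | succ j ih =>
    rw [pow_succ 2 (j + 1), pow_mul, pow_mul K, re_sq_apply (hK.pow _)]
    refine le_trans ?_ (Finset.single_le_sum (f := fun s => ‖(K ^ 2 ^ (j + 1)) r s‖ ^ 2)
      (fun _ _ => by positivity) (Finset.mem_univ r))
    gcongr
    exact ih.trans (Complex.re_le_norm _)

theorem norm_pow_le_norm_trace_pow {K : Matrix (Fin N) (Fin N) ℂ} (hK : K.IsHermitian)
    (r s : Fin N) (j : ℕ) : ‖K r s‖ ^ 2 ^ (j + 1) ≤ ‖(K ^ 2 ^ (j + 1)).trace‖ := by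
  refine le_trans ?_ (Complex.re_le_norm _)
  rw [Matrix.trace, Complex.re_sum]
  refine (norm_pow_le_re_pow_apply hK r s j).trans ?_
  exact Finset.single_le_sum (f := fun r => ((K ^ 2 ^ (j + 1)) r r).re)
    (fun t _ => le_trans (by positivity) (norm_pow_le_re_pow_apply hK t t j)) (Finset.mem_univ r)

variable {Ω : Type*} [MeasurableSpace Ω] {μ : Measure Ω}
  {X : Fin d → Ω → Matrix (Fin N) (Fin N) ℂ}

/-- The GUE matrices as a random element of a space with a Borel structure. -/
theorem measurable_tuple (hX : IsGUETuple μ X) :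
    Measurable fun ω => (fun i r s => X i ω r s : Fin d → Fin N → Fin N → ℂ) :=
  measurable_pi_lambda _ fun i => measurable_pi_lambda _ fun r => measurable_pi_lambda _ fun s =>
    hX.measurable_entry i r s

theorem measurable_comp_tuple (hX : IsGUETuple μ X)
    {F : (Fin d → Matrix (Fin N) (Fin N) ℂ) → ℂ} (hF : Continuous F) :
    Measurable fun ω => F fun i => X i ω := by
  have h : Continuous fun M : Fin d → Fin N → Fin N → ℂ => F M := hF
  exact h.measurable.comp (measurable_tuple hX)

theorem measurable_comp_tuple₂ (hX : IsGUETuple μ X) {α : Type*} [TopologicalSpace α]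
    [SecondCountableTopology α] [MeasurableSpace α] [BorelSpace α]
    {F : α → (Fin d → Matrix (Fin N) (Fin N) ℂ) → ℂ}
    (hF : Continuous fun p : α × (Fin d → Matrix (Fin N) (Fin N) ℂ) => F p.1 p.2) :
    Measurable fun p : α × Ω => F p.1 fun i => X i p.2 := by
  have h : Continuous fun p : α × (Fin d → Fin N → Fin N → ℂ) => F p.1 p.2 := hF
  exact h.measurable.comp (measurable_fst.prodMk ((measurable_tuple hX).comp measurable_snd))

theorem continuous_lift {Y : Type*} {B : Type*} [Ring B] [Algebra ℂ B] [TopologicalSpace B]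
    [IsTopologicalRing B] {α : Type*} [TopologicalSpace α] {Z : α → Y → B}
    (hZ : ∀ v, Continuous fun a => Z a v) (Q : FreeAlgebra ℂ Y) :
    Continuous fun a => FreeAlgebra.lift ℂ (Z a) Q := by
  induction Q using FreeAlgebra.induction with
  | grade0 c => simp only [AlgHom.commutes]; exact continuous_const
  | grade1 v => simpa only [FreeAlgebra.lift_ι_apply] using hZ v
  | mul a b ha hb => simp only [map_mul]; exact ha.mul hb
  | add a b ha hb => simp only [map_add]; exact ha.add hb

theorem continuous_weight (V : FreeAlgebra ℂ (Fin d)) :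
    Continuous fun M : Fin d → Matrix (Fin N) (Fin N) ℂ => weight V M := by
  have h : Continuous fun M : Fin d → Matrix (Fin N) (Fin N) ℂ =>
      (FreeAlgebra.lift ℂ M V).trace :=
    (continuous_lift (fun v => continuous_apply v) V).matrix_trace
  exact Complex.continuous_exp.comp (continuous_const.mul h)

/-- The hypothesis concerns traces of polynomials only. It controls entries because a high even
power of |X_{rs}| is at most the modulus of the trace of that power of X. -/
theorem integrable_gnorm_pow (V : FreeAlgebra ℂ (Fin d))
    (hV : ∀ Q : FreeAlgebra ℂ (Fin d), Integrable (fun ω =>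
      (1 / (N : ℂ)) * (FreeAlgebra.lift ℂ (fun i => X i ω) Q).trace *
        weight V (fun i => X i ω)) μ)
    (hN : 1 ≤ N) (hX : IsGUETuple μ X) (k : ℕ) :
    Integrable (fun ω => gnorm (fun i => X i ω) ^ k * ‖weight V fun i => X i ω‖) μ := by
  have hN0 : (N : ℂ) ≠ 0 := by exact_mod_cast (by omega : N ≠ 0)
  have hV' : ∀ Q : FreeAlgebra ℂ (Fin d), Integrable (fun ω =>
      (FreeAlgebra.lift ℂ (fun i => X i ω) Q).trace * weight V (fun i => X i ω)) μ := by
    intro Q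
    have := (hV Q).const_mul (N : ℂ)
    refine this.congr (ae_of_all _ fun ω => ?_)
    dsimp only
    field_simp
  have hwm : Measurable fun ω => weight V fun i => X i ω :=
    measurable_comp_tuple hX (continuous_weight V)
  have hw : Integrable (fun ω => ‖weight V fun i => X i ω‖) μ := by
    have := (hV 1).norm
    simpa [hN0] using this
  have hem : ∀ q : Fin d × Fin N × Fin N, Measurable fun ω => ‖X q.1 ω q.2.1 q.2.2‖ :=
    fun q => (hX.measurable_entry _ _ _).norm
  -- An exponent above k for which `norm_pow_le_norm_trace_pow` holds; the passage from k to n is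
  -- free because `gnorm` is at least 1.
  set n := 2 ^ (k + 1) with hn
  have hkn : k ≤ n := (Nat.lt_two_pow_self.le).trans (Nat.pow_le_pow_right (by norm_num) (by omega))
  have hent : ∀ q : Fin d × Fin N × Fin N,
      Integrable (fun ω => ‖X q.1 ω q.2.1 q.2.2‖ ^ n * ‖weight V fun i => X i ω‖) μ := by
    intro q
    refine (hV' (FreeAlgebra.ι ℂ q.1 ^ n)).norm.mono'
      (((hem q).pow_const n).mul hwm.norm).aestronglyMeasurable (ae_of_all _ fun ω => ?_)
    rw [map_pow, FreeAlgebra.lift_ι_apply, Real.norm_of_nonneg (by positivity), norm_mul]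
    exact mul_le_mul_of_nonneg_right
      (norm_pow_le_norm_trace_pow (hX.isHermitian _ _) _ _ _) (norm_nonneg _)
  -- The constant 1 in `gnorm` is treated as one more summand, so that a single power inequality
  -- covers all terms.
  have hsum : ∀ M : Fin d → Matrix (Fin N) (Fin N) ℂ, gnorm M =
      ∑ o : Option (Fin d × Fin N × Fin N), o.elim 1 fun q => ‖M q.1 q.2.1 q.2.2‖ := by
    intro M
    rw [Fintype.sum_option]
    rfl
  have hgm : Measurable fun ω => gnorm fun i => X i ω := by
    unfold gnorm
    exact measurable_const.add (Finset.measurable_fun_sum _ fun q _ => hem q)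
  have hbound : Integrable (fun ω => (Fintype.card (Option (Fin d × Fin N × Fin N)) : ℝ) ^ n *
      ∑ o : Option (Fin d × Fin N × Fin N), (o.elim 1 fun q => ‖X q.1 ω q.2.1 q.2.2‖ ^ n) *
        ‖weight V fun i => X i ω‖) μ := by
    refine Integrable.const_mul (integrable_finsetSum _ fun o _ => ?_) _
    cases o with
    | none => simpa using hw
    | some q => exact hent q
  refine hbound.mono' ((hgm.pow_const k).mul hwm.norm).aestronglyMeasurable
    (ae_of_all _ fun ω => ?_)
  have h0 : 0 ≤ gnorm fun i => X i ω := zero_le_one.trans (one_le_gnorm _)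
  rw [Real.norm_of_nonneg (by positivity), ← Finset.sum_mul, ← mul_assoc]
  gcongr
  refine (pow_le_pow_right₀ (one_le_gnorm _) hkn).trans ?_
  rw [hsum]
  refine (sum_pow_le_card_pow_mul Finset.univ _ (fun o _ => ?_) (by positivity)).trans ?_
  · cases o <;> simp
  · rw [Finset.card_univ]
    gcongr with o
    cases o <;> simp

end Integrability

end

end MasterEquation

open MeasureTheory ProbabilityTheory
open scoped TensorProduct

namespace MasterEquation

noncomputable section

/-! ## Derivatives of evaluations of noncommutative polynomials -/

section Sandwich

variable {Y B : Type*} [Ring B] [Algebra ℂ B]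

/-- The linear map `P ⊗ Q ↦ P(Z) h Q(Z)`. -/
def sandwich (h : B) (Z : Y → B) : FreeAlgebra ℂ Y ⊗[ℂ] FreeAlgebra ℂ Y →ₗ[ℂ] B :=
  LinearMap.mul' ℂ B ∘ₗ TensorProduct.map
    (LinearMap.mulRight ℂ h ∘ₗ (FreeAlgebra.lift ℂ Z).toLinearMap)
    (FreeAlgebra.lift ℂ Z).toLinearMap

@[simp] theorem sandwich_tmul (h : B) (Z : Y → B) (P Q : FreeAlgebra ℂ Y) :
    sandwich h Z (P ⊗ₜ Q) = FreeAlgebra.lift ℂ Z P * h * FreeAlgebra.lift ℂ Z Q := rfl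

theorem sandwich_mul_right (h : B) (Z : Y → B) (T : FreeAlgebra ℂ Y ⊗[ℂ] FreeAlgebra ℂ Y)
    (Q : FreeAlgebra ℂ Y) :
    sandwich h Z (T * (1 ⊗ₜ Q)) = sandwich h Z T * FreeAlgebra.lift ℂ Z Q := by
  induction T using TensorProduct.induction_on with
  | zero => simp
  | tmul a b => simp [mul_assoc]
  | add a b ha hb => rw [add_mul, map_add, ha, hb, map_add, add_mul]

theorem sandwich_mul_left (h : B) (Z : Y → B) (T : FreeAlgebra ℂ Y ⊗[ℂ] FreeAlgebra ℂ Y)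
    (P : FreeAlgebra ℂ Y) :
    sandwich h Z ((P ⊗ₜ 1) * T) = FreeAlgebra.lift ℂ Z P * sandwich h Z T := by
  induction T using TensorProduct.induction_on with
  | zero => simp
  | tmul a b => simp [mul_assoc]
  | add a b ha hb => rw [mul_add, map_add, ha, hb, map_add, mul_add]

theorem sandwich_add (h h' : B) (Z : Y → B) (T : FreeAlgebra ℂ Y ⊗[ℂ] FreeAlgebra ℂ Y) :
    sandwich (h + h') Z T = sandwich h Z T + sandwich h' Z T := by
  induction T using TensorProduct.induction_on with
  | zero => simp
  | tmul a b => simp [mul_add, add_mul]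
  | add a b ha hb => rw [map_add, ha, hb, map_add, map_add]; abel

theorem sandwich_smul (c : ℂ) (h : B) (Z : Y → B) (T : FreeAlgebra ℂ Y ⊗[ℂ] FreeAlgebra ℂ Y) :
    sandwich (c • h) Z T = c • sandwich h Z T := by
  induction T using TensorProduct.induction_on with
  | zero => simp
  | tmul a b => simp
  | add a b ha hb => rw [map_add, ha, hb, map_add, smul_add]

/-- A trace of `P(Z) h Q(Z)` only depends on `m (P ⊗ Q) = Q P`. -/
theorem trace_sandwich {M : Type*} [AddCommGroup M] [Module ℂ M] (φ : B →ₗ[ℂ] M)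
    (hφ : ∀ a b, φ (a * b) = φ (b * a)) (h : B) (Z : Y → B)
    (T : FreeAlgebra ℂ Y ⊗[ℂ] FreeAlgebra ℂ Y) :
    φ (sandwich h Z T) = φ (h * FreeAlgebra.lift ℂ Z (mulOp T)) := by
  induction T using TensorProduct.induction_on with
  | zero => simp
  | tmul a b => rw [sandwich_tmul, mulOp_tmul, map_mul (FreeAlgebra.lift ℂ Z), mul_assoc, hφ,
    mul_assoc]
  | add a b ha hb => rw [map_add, map_add, ha, hb, map_add, map_add, mul_add, map_add]

end Sandwich

section LiftDeriv

variable {Y A : Type*} [Fintype Y] [DecidableEq Y] [CStarAlgebra A] {N : ℕ}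

theorem hasDerivAt_mul_entry {F G : ℝ → Matrix (Fin N) (Fin N) A}
    {F' G' : Matrix (Fin N) (Fin N) A} {u : ℝ}
    (hF : ∀ r s, HasDerivAt (fun t => F t r s) (F' r s) u)
    (hG : ∀ r s, HasDerivAt (fun t => G t r s) (G' r s) u) (r s : Fin N) :
    HasDerivAt (fun t => (F t * G t) r s) ((F' * G u + F u * G') r s) u := by
  simp only [Matrix.mul_apply, Matrix.add_apply]
  rw [← Finset.sum_add_distrib]
  exact HasDerivAt.fun_sum fun i _ => (hF r i).mul (hG i s)

/-- The derivative of the evaluation of a noncommutative polynomial along a curve. -/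
theorem hasDerivAt_lift {Z : ℝ → Y → Matrix (Fin N) (Fin N) A}
    {Z' : Y → Matrix (Fin N) (Fin N) A} {u : ℝ}
    (h : ∀ v r s, HasDerivAt (fun t => Z t v r s) (Z' v r s) u) (Q : FreeAlgebra ℂ Y)
    (r s : Fin N) :
    HasDerivAt (fun t => FreeAlgebra.lift ℂ (Z t) Q r s)
      ((∑ v, sandwich (Z' v) (Z u) (ncDeriv v Q)) r s) u := by
  induction Q using FreeAlgebra.induction generalizing r s with
  | grade0 c =>
    simp only [AlgHom.commutes, ncDeriv_algebraMap, map_zero, Finset.sum_const_zero]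
    exact hasDerivAt_const _ _
  | grade1 w =>
    simp only [FreeAlgebra.lift_ι_apply]
    refine (h w r s).congr_deriv ?_
    rw [Finset.sum_eq_single w (fun v _ hv => by rw [ncDeriv_ι, if_neg hv, map_zero]) (by simp),
      ncDeriv_ι, if_pos rfl, Algebra.TensorProduct.one_def]
    simp
  | mul a b ha hb =>
    simp only [map_mul]
    refine (hasDerivAt_mul_entry ha hb r s).congr_deriv ?_
    simp only [ncDeriv_mul, map_add, sandwich_mul_right, sandwich_mul_left,
      Finset.sum_add_distrib, Finset.sum_mul, Finset.mul_sum]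
  | add a b ha hb =>
    simp only [map_add]
    refine ((ha r s).add (hb r s)).congr_deriv ?_
    rw [Finset.sum_add_distrib]
    rfl

theorem hasDerivAt_traceN (τ : A →L[ℂ] ℂ) {F : ℝ → Matrix (Fin N) (Fin N) A}
    {F' : Matrix (Fin N) (Fin N) A} {u : ℝ}
    (hF : ∀ r s, HasDerivAt (fun t => F t r s) (F' r s) u) :
    HasDerivAt (fun t => traceN N τ (F t)) (traceN N τ F') u := by
  simp only [traceN_eq, ntr_apply, Matrix.trace, Matrix.diag, entryMean_apply]
  refine (HasDerivAt.fun_sum fun i _ => ?_).const_mul _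
  exact (τ.restrictScalars ℝ).hasFDerivAt.comp_hasDerivAt u (hF i i)

theorem hasDerivAt_trace {F : ℝ → Matrix (Fin N) (Fin N) ℂ}
    {F' : Matrix (Fin N) (Fin N) ℂ} {u : ℝ}
    (hF : ∀ r s, HasDerivAt (fun t => F t r s) (F' r s) u) :
    HasDerivAt (fun t => (F t).trace) F'.trace u :=
  HasDerivAt.fun_sum fun i _ => hF i i

end LiftDeriv

/-! ## Functions of polynomial growth -/

section Poly

variable {α : Type*} [TopologicalSpace α] {N d : ℕ}

/-- Continuous functions of a parameter and of a tuple of matrices that grow at most polynomially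
in the matrices, uniformly for the parameters in `S`. -/
def IsPoly {E : Type*} [NormedAddCommGroup E] (S : Set α)
    (F : α → (Fin d → Matrix (Fin N) (Fin N) ℂ) → E) : Prop :=
  (Continuous fun p : α × (Fin d → Matrix (Fin N) (Fin N) ℂ) => F p.1 p.2) ∧
    ∃ (K : ℝ) (k : ℕ), 0 ≤ K ∧ ∀ a ∈ S, ∀ M, ‖F a M‖ ≤ K * gnorm M ^ k

variable {S : Set α}

theorem IsPoly.const {E : Type*} [NormedAddCommGroup E] (e : E) :
    IsPoly S (fun (_ : α) (_ : Fin d → Matrix (Fin N) (Fin N) ℂ) => e) :=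
  ⟨continuous_const, ‖e‖, 0, norm_nonneg _, by simp⟩

theorem IsPoly.add {E : Type*} [NormedAddCommGroup E]
    {F G : α → (Fin d → Matrix (Fin N) (Fin N) ℂ) → E} (hF : IsPoly S F) (hG : IsPoly S G) :
    IsPoly S (fun a M => F a M + G a M) := by
  obtain ⟨cF, K, k, hK, hF⟩ := hF
  obtain ⟨cG, L, l, hL, hG⟩ := hG
  refine ⟨cF.add cG, K + L, k + l, by positivity, fun a ha M => ?_⟩
  have hg := one_le_gnorm M
  rw [add_mul]
  refine (norm_add_le _ _).trans (add_le_add ((hF a ha M).trans ?_) ((hG a ha M).trans ?_))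
  · gcongr
    omega
  · gcongr
    omega

theorem IsPoly.mul {E : Type*} [NormedRing E]
    {F G : α → (Fin d → Matrix (Fin N) (Fin N) ℂ) → E} (hF : IsPoly S F) (hG : IsPoly S G) :
    IsPoly S (fun a M => F a M * G a M) := by
  obtain ⟨cF, K, k, hK, hF⟩ := hF
  obtain ⟨cG, L, l, hL, hG⟩ := hG
  refine ⟨cF.mul cG, K * L, k + l, by positivity, fun a ha M => ?_⟩
  have hg := zero_le_one.trans (one_le_gnorm M)
  calc ‖F a M * G a M‖ ≤ ‖F a M‖ * ‖G a M‖ := norm_mul_le _ _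
    _ ≤ (K * gnorm M ^ k) * (L * gnorm M ^ l) :=
        mul_le_mul (hF a ha M) (hG a ha M) (norm_nonneg _) (by positivity)
    _ = _ := by ring

theorem IsPoly.sum {E ι : Type*} [NormedAddCommGroup E] (s : Finset ι)
    {F : ι → α → (Fin d → Matrix (Fin N) (Fin N) ℂ) → E} (hF : ∀ i ∈ s, IsPoly S (F i)) :
    IsPoly S (fun a M => ∑ i ∈ s, F i a M) := by
  classical
  induction s using Finset.induction_on with
  | empty => simpa using IsPoly.const (S := S) (N := N) (d := d) (0 : E)
  | insert i s hi ih =>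
    simp only [Finset.sum_insert hi]
    exact (hF i (Finset.mem_insert_self _ _)).add
      (ih fun j hj => hF j (Finset.mem_insert_of_mem hj))

theorem IsPoly.clm {E E' : Type*} [NormedAddCommGroup E] [NormedSpace ℂ E]
    [NormedAddCommGroup E'] [NormedSpace ℂ E'] (f : E →L[ℂ] E')
    {F : α → (Fin d → Matrix (Fin N) (Fin N) ℂ) → E} (hF : IsPoly S F) :
    IsPoly S (fun a M => f (F a M)) := by
  obtain ⟨cF, K, k, hK, hF⟩ := hF
  refine ⟨f.continuous.comp cF, ‖f‖ * K, k, by positivity, fun a ha M => ?_⟩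
  refine (f.le_opNorm _).trans ?_
  rw [mul_assoc]
  gcongr
  exact hF a ha M

theorem IsPoly.of_param {E : Type*} [NormedAddCommGroup E] {c : α → E} (hc : Continuous c)
    {K : ℝ} (hK : ∀ a ∈ S, ‖c a‖ ≤ K) :
    IsPoly S (fun a (_ : Fin d → Matrix (Fin N) (Fin N) ℂ) => c a) :=
  ⟨hc.comp continuous_fst, |K|, 0, abs_nonneg _, fun a ha _ => by
    simpa using (hK a ha).trans (le_abs_self K)⟩

theorem IsPoly.entry (i : Fin d) (r s : Fin N) :
    IsPoly S (fun (_ : α) (M : Fin d → Matrix (Fin N) (Fin N) ℂ) => M i r s) := by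
  refine ⟨?_, 1, 1, zero_le_one, fun a _ M => by simpa using norm_entry_le_gnorm M i r s⟩
  exact ((continuous_apply i).comp continuous_snd).matrix_elem r s

theorem IsPoly.comp_param {β E : Type*} [TopologicalSpace β] [NormedAddCommGroup E] {S' : Set β}
    {F : α → (Fin d → Matrix (Fin N) (Fin N) ℂ) → E} (hF : IsPoly S F) {f : β → α}
    (hf : Continuous f) (hS : ∀ b ∈ S', f b ∈ S) : IsPoly S' (fun b M => F (f b) M) := by
  obtain ⟨cF, K, k, hK, hF⟩ := hF
  exact ⟨cF.comp ((hf.comp continuous_fst).prodMk continuous_snd), K, k, hK,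
    fun b hb M => hF _ (hS b hb) M⟩

/-- Matrix-valued functions of polynomial growth. -/
def IsPolyMat {E : Type*} [NormedAddCommGroup E] (S : Set α)
    (F : α → (Fin d → Matrix (Fin N) (Fin N) ℂ) → Matrix (Fin N) (Fin N) E) : Prop :=
  ∀ r s, IsPoly S fun a M => F a M r s

variable {A : Type*} [CStarAlgebra A]

theorem IsPolyMat.mul {F G : α → (Fin d → Matrix (Fin N) (Fin N) ℂ) → Matrix (Fin N) (Fin N) A}
    (hF : IsPolyMat S F) (hG : IsPolyMat S G) : IsPolyMat S (fun a M => F a M * G a M) := by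
  intro r s
  simp only [Matrix.mul_apply]
  exact IsPoly.sum _ fun i _ => (hF r i).mul (hG i s)

theorem IsPolyMat.add {F G : α → (Fin d → Matrix (Fin N) (Fin N) ℂ) → Matrix (Fin N) (Fin N) A}
    (hF : IsPolyMat S F) (hG : IsPolyMat S G) : IsPolyMat S (fun a M => F a M + G a M) :=
  fun r s => (hF r s).add (hG r s)

theorem IsPolyMat.const (m : Matrix (Fin N) (Fin N) A) :
    IsPolyMat S (fun (_ : α) (_ : Fin d → Matrix (Fin N) (Fin N) ℂ) => m) :=
  fun _ _ => IsPoly.const _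

theorem IsPolyMat.smul {c : α → ℂ} (hc : Continuous c) {K : ℝ} (hK : ∀ a ∈ S, ‖c a‖ ≤ K)
    {F : α → (Fin d → Matrix (Fin N) (Fin N) ℂ) → Matrix (Fin N) (Fin N) A}
    (hF : IsPolyMat S F) : IsPolyMat S (fun a M => c a • F a M) := by
  intro r s
  obtain ⟨cF, L, k, hL, hF⟩ := hF r s
  refine ⟨(hc.comp continuous_fst).smul cF, |K| * L, k, by positivity, fun a ha M => ?_⟩
  change ‖c a • F a M r s‖ ≤ _
  rw [norm_smul, mul_assoc]
  gcongr
  · exact (hK a ha).trans (le_abs_self K)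
  · exact hF a ha M

theorem IsPolyMat.lift {Y : Type*}
    {Z : α → (Fin d → Matrix (Fin N) (Fin N) ℂ) → Y → Matrix (Fin N) (Fin N) A}
    (hZ : ∀ v, IsPolyMat S fun a M => Z a M v) (Q : FreeAlgebra ℂ Y) :
    IsPolyMat S (fun a M => FreeAlgebra.lift ℂ (Z a M) Q) := by
  induction Q using FreeAlgebra.induction with
  | grade0 c => simp only [AlgHom.commutes]; exact IsPolyMat.const _
  | grade1 v => simpa only [FreeAlgebra.lift_ι_apply] using hZ v
  | mul a b ha hb => simp only [map_mul]; exact ha.mul hb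
  | add a b ha hb => simp only [map_add]; exact ha.add hb

theorem IsPolyMat.matEmb {F : α → (Fin d → Matrix (Fin N) (Fin N) ℂ) → Matrix (Fin N) (Fin N) ℂ}
    (hF : IsPolyMat S F) : IsPolyMat S (fun a M => matEmb A N (F a M)) := fun r s => by
  have := (hF r s).clm (Algebra.linearMap ℂ A).toContinuousLinearMap
  exact this

theorem IsPolyMat.tuple (i : Fin d) :
    IsPolyMat S (fun (_ : α) (M : Fin d → Matrix (Fin N) (Fin N) ℂ) => M i) :=
  fun r s => IsPoly.entry i r s

theorem IsPolyMat.traceN (τ : A →L[ℂ] ℂ)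
    {F : α → (Fin d → Matrix (Fin N) (Fin N) ℂ) → Matrix (Fin N) (Fin N) A}
    (hF : IsPolyMat S F) : IsPoly S (fun a M => traceN N τ (F a M)) := by
  simp only [traceN_eq, ntr_apply, Matrix.trace, Matrix.diag, entryMean_apply]
  exact (IsPoly.const _).mul (IsPoly.sum _ fun i _ => (hF i i).clm τ)

theorem IsPolyMat.trace {F : α → (Fin d → Matrix (Fin N) (Fin N) ℂ) → Matrix (Fin N) (Fin N) ℂ}
    (hF : IsPolyMat S F) : IsPoly S (fun a M => (F a M).trace) :=
  IsPoly.sum _ fun i _ => hF i i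

theorem IsPolyMat.sandwich {Y : Type*}
    {h : α → (Fin d → Matrix (Fin N) (Fin N) ℂ) → Matrix (Fin N) (Fin N) A}
    {Z : α → (Fin d → Matrix (Fin N) (Fin N) ℂ) → Y → Matrix (Fin N) (Fin N) A}
    (hh : IsPolyMat S h) (hZ : ∀ v, IsPolyMat S fun a M => Z a M v)
    (T : FreeAlgebra ℂ Y ⊗[ℂ] FreeAlgebra ℂ Y) :
    IsPolyMat S (fun a M => sandwich (h a M) (Z a M) T) := by
  induction T using TensorProduct.induction_on with
  | zero => simp only [map_zero]; exact IsPolyMat.const 0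
  | tmul a b =>
    simp only [sandwich_tmul]
    exact ((IsPolyMat.lift hZ a).mul hh).mul (IsPolyMat.lift hZ b)
  | add a b ha hb => simp only [map_add]; exact ha.add hb

variable {Ω : Type*} [MeasurableSpace Ω] {μ : Measure Ω}
  {X : Fin d → Ω → Matrix (Fin N) (Fin N) ℂ} {V : FreeAlgebra ℂ (Fin d)}

/-- The integrability hypothesis on `V`. -/
def WeightIntegrable (μ : Measure Ω) (X : Fin d → Ω → Matrix (Fin N) (Fin N) ℂ)
    (V : FreeAlgebra ℂ (Fin d)) : Prop :=
  ∀ k : ℕ, Integrable (fun ω => gnorm (fun i => X i ω) ^ k * ‖weight V fun i => X i ω‖) μ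

/-- Integrability of a family of functions of polynomial growth against the weight. -/
theorem IsPoly.integrable_prod [SFinite μ] [SecondCountableTopology α] [MeasurableSpace α]
    [BorelSpace α] (hX : IsGUETuple μ X) (hV : WeightIntegrable μ X V) {ν : Measure α} [SFinite ν]
    (hS : MeasurableSet S) {c : α → ℂ} (hc : IntegrableOn c S ν)
    {F : α → (Fin d → Matrix (Fin N) (Fin N) ℂ) → ℂ} (hF : IsPoly S F) :
    Integrable (fun p : α × Ω => c p.1 * (F p.1 (fun i => X i p.2) *
      weight V fun i => X i p.2)) ((ν.restrict S).prod μ) := by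
  obtain ⟨cF, K, k, hK, hF⟩ := hF
  have hb := (hc.norm.mul_prod (hV k)).const_mul K
  refine hb.mono' ?_ ?_
  · refine (hc.aestronglyMeasurable.comp_fst).mul (Measurable.aestronglyMeasurable ?_)
    exact (measurable_comp_tuple₂ hX cF).mul
      ((measurable_comp_tuple hX (continuous_weight V)).comp measurable_snd)
  · have : ∀ᵐ p ∂(ν.restrict S).prod μ, p.1 ∈ S :=
      Measure.quasiMeasurePreserving_fst.ae (ae_restrict_mem hS)
    filter_upwards [this] with p hp
    rw [norm_mul, norm_mul]
    calc ‖c p.1‖ * (‖F p.1 fun i => X i p.2‖ * ‖weight V fun i => X i p.2‖)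
        ≤ ‖c p.1‖ * (K * gnorm (fun i => X i p.2) ^ k * ‖weight V fun i => X i p.2‖) := by
          gcongr
          exact hF p.1 hp _
      _ = _ := by ring

theorem IsPoly.integrable (hX : IsGUETuple μ X) (hV : WeightIntegrable μ X V)
    {F : α → (Fin d → Matrix (Fin N) (Fin N) ℂ) → ℂ} (hF : IsPoly S F) {a : α} (ha : a ∈ S) :
    Integrable (fun ω => F a (fun i => X i ω) * weight V fun i => X i ω) μ := by
  obtain ⟨cF, K, k, hK, hF⟩ := hF
  refine ((hV k).const_mul K).mono' (Measurable.aestronglyMeasurable ?_)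
    (ae_of_all _ fun ω => ?_)
  · exact (measurable_comp_tuple hX (cF.comp (Continuous.prodMk_right a))).mul
      (measurable_comp_tuple hX (continuous_weight V))
  · rw [norm_mul, ← mul_assoc]
    gcongr
    exact hF a ha _

end Poly

end

end MasterEquation

open MeasureTheory ProbabilityTheory
open scoped TensorProduct

namespace MasterEquation

noncomputable section

/-! ## Integration by parts for GUE matrices -/

section GUE

variable {A : Type*} [CStarAlgebra A] {N d : ℕ}

/-- The tuple of Hermitian matrices with given coordinates. -/
def gueTuple (y : Fin d × (Fin N × Fin N) → ℝ) (i : Fin d) : Matrix (Fin N) (Fin N) ℂ :=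
  ∑ p, (y (i, p) : ℂ) • gueBasis N p

theorem hasDerivAt_gueTuple (y : Fin d × (Fin N × Fin N) → ℝ) (q : Fin d × (Fin N × Fin N))
    (i : Fin d) (r s : Fin N) :
    HasDerivAt (fun g => gueTuple (Function.update y q g) i r s)
      ((if i = q.1 then gueBasis N q.2 else 0) r s) (y q) := by
  have h : ∀ p, HasDerivAt (fun g : ℝ => (((Function.update y q g (i, p) : ℝ) : ℂ) •
      gueBasis N p) r s) (if (i, p) = q then gueBasis N p r s else 0) (y q) := by
    intro p
    by_cases hp : (i, p) = q
    · subst hp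
      simp only [Function.update_self, if_true, Matrix.smul_apply, smul_eq_mul]
      simpa using (Complex.ofRealCLM.hasDerivAt (x := y (i, p))).mul_const (gueBasis N p r s)
    · simp only [Function.update_of_ne hp, if_neg hp]
      exact hasDerivAt_const _ _
  have := HasDerivAt.fun_sum fun p (_ : p ∈ (Finset.univ : Finset (Fin N × Fin N))) => h p
  simp only [gueTuple, Matrix.sum_apply]
  refine this.congr_deriv ?_
  obtain ⟨j, p'⟩ := q
  by_cases hj : i = j
  · subst hj
    simp
  · simp [hj]

/-- The contraction `A ⊗ B ↦ (1/N) ∑ τ_N(E_{rs} A(Z) E_{sr} B(Z))`. -/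
def contraction (τ : A →L[ℂ] ℂ) {Y : Type*} (Z : Y → Matrix (Fin N) (Fin N) A) :
    FreeAlgebra ℂ Y ⊗[ℂ] FreeAlgebra ℂ Y →ₗ[ℂ] ℂ :=
  (1 / (N : ℂ)) • ∑ p : Fin N × Fin N, traceN N τ ∘ₗ
    LinearMap.mulLeft ℂ (matEmb A N (Matrix.single p.1 p.2 1)) ∘ₗ
      sandwich (matEmb A N (Matrix.single p.2 p.1 1)) Z

theorem contraction_apply (τ : A →L[ℂ] ℂ) {Y : Type*} (Z : Y → Matrix (Fin N) (Fin N) A)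
    (T : FreeAlgebra ℂ Y ⊗[ℂ] FreeAlgebra ℂ Y) :
    contraction τ Z T = (1 / (N : ℂ)) * ∑ p : Fin N × Fin N,
      traceN N τ (matEmb A N (Matrix.single p.1 p.2 1) *
        sandwich (matEmb A N (Matrix.single p.2 p.1 1)) Z T) := by
  simp [contraction]

theorem sum_gueBasis_sandwich (hN : 1 ≤ N) (τ : A →L[ℂ] ℂ) {Y : Type*}
    (Z : Y → Matrix (Fin N) (Fin N) A) (T : FreeAlgebra ℂ Y ⊗[ℂ] FreeAlgebra ℂ Y) :
    ∑ p, traceN N τ (matEmb A N (gueBasis N p) * sandwich (matEmb A N (gueBasis N p)) Z T) =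
      contraction τ Z T := by
  rw [contraction_apply]
  refine sum_gueBasis hN (LinearMap.mk₂ ℂ (fun k k' => traceN N τ (matEmb A N k *
    sandwich (matEmb A N k') Z T)) ?_ ?_ ?_ ?_)
  · intro k k' l; rw [map_add, add_mul, map_add]
  · intro c k l; rw [map_smul, smul_mul_assoc, map_smul]
  · intro k l l'; rw [map_add, sandwich_add, mul_add, map_add]
  · intro c k l; rw [map_smul, sandwich_smul, mul_smul_comm, map_smul]

/-- Here tr(E_{sr} W) = W_{rs}, so the sum over the units reassembles W. The factor 1/N later
cancels the N in the exponent of the weight. -/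
theorem sum_gueBasis_trace (hN : 1 ≤ N) (τ : A →L[ℂ] ℂ) (D : Matrix (Fin N) (Fin N) A)
    (W : Matrix (Fin N) (Fin N) ℂ) :
    ∑ p, traceN N τ (matEmb A N (gueBasis N p) * D) * (gueBasis N p * W).trace =
      (1 / (N : ℂ)) * traceN N τ (matEmb A N W * D) := by
  have h := sum_gueBasis hN (LinearMap.mk₂ ℂ (fun k k' => traceN N τ (matEmb A N k * D) *
    (k' * W).trace)
    (fun k k' l => by rw [map_add, add_mul, map_add, add_mul])
    (fun c k l => by rw [map_smul, smul_mul_assoc, map_smul, smul_mul_assoc])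
    (fun k l l' => by rw [add_mul, Matrix.trace_add, mul_add])
    (fun c k l => by rw [smul_mul_assoc, Matrix.trace_smul, mul_smul_comm]))
  simp only [LinearMap.mk₂_apply] at h
  rw [h, smul_eq_mul]
  congr 1
  conv_rhs => rw [← sum_single W, map_sum, Finset.sum_mul, map_sum]
  refine Finset.sum_congr rfl fun p _ => ?_
  rw [Matrix.trace_single_mul, one_smul, map_smul, smul_mul_assoc, map_smul, smul_eq_mul, mul_comm]

variable {Y : Type*} [Fintype Y] [DecidableEq Y] {Ω : Type*} [MeasurableSpace Ω] {μ : Measure Ω}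
  {X : Fin d → Ω → Matrix (Fin N) (Fin N) ℂ} {V : FreeAlgebra ℂ (Fin d)}

/-- Under the trace all cyclic rotations agree, so ∂_i V enters only through 𝒟_i V; the coordinate q
moves the single matrix of index `q.1`. -/
theorem hasDerivAt_weight (y : Fin d × (Fin N × Fin N) → ℝ) (q : Fin d × (Fin N × Fin N)) :
    HasDerivAt (fun g => weight V (gueTuple (Function.update y q g)))
      (-(N : ℂ) * (gueBasis N q.2 * FreeAlgebra.lift ℂ (gueTuple y)
        (mulOp (ncDeriv q.1 V))).trace * weight V (gueTuple y)) (y q) := by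
  have h := hasDerivAt_trace (hasDerivAt_lift (A := ℂ)
    (fun v r s => hasDerivAt_gueTuple y q v r s) V)
  have h2 := (h.const_mul (-(N : ℂ))).cexp
  refine h2.congr_deriv ?_
  rw [Function.update_eq_self, mul_comm]
  unfold weight
  congr 2
  rw [Matrix.trace_sum, Finset.sum_eq_single q.1, if_pos rfl]
  · exact trace_sandwich (Matrix.traceLinearMap (Fin N) ℂ ℂ) Matrix.trace_mul_comm _ _ _
  · intro i _ hi
    rw [if_neg hi, show (0 : Matrix (Fin N) (Fin N) ℂ) = (0 : ℂ) • 0 by simp, sandwich_smul]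
    simp
  · simp

theorem isPoly_gueCoord {α : Type*} [TopologicalSpace α] {S : Set α} (i : Fin d)
    (p : Fin N × Fin N) : IsPoly S (fun (_ : α) (M : Fin d → Matrix (Fin N) (Fin N) ℂ) =>
      (gueCoord (M i) p : ℂ)) := by
  have key : ∀ (c : ℝ) (f : ℂ →L[ℝ] ℝ) (hf : ∀ z, |f z| ≤ ‖z‖) (r s : Fin N),
      IsPoly S (fun (_ : α) (M : Fin d → Matrix (Fin N) (Fin N) ℂ) => ((c * f (M i r s) : ℝ) : ℂ)) :=
    fun c f hf r s => by
    refine ⟨Complex.continuous_ofReal.comp (continuous_const.mul (f.continuous.comp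
      (IsPoly.entry (S := S) i r s).1)), |c|, 1, abs_nonneg _, fun a _ M => ?_⟩
    rw [Complex.norm_real, norm_mul, pow_one, Real.norm_eq_abs, Real.norm_eq_abs]
    gcongr
    exact (hf _).trans (norm_entry_le_gnorm M i r s)
  unfold gueCoord
  split_ifs
  · exact key _ Complex.reCLM Complex.abs_re_le_norm _ _
  · exact key _ Complex.reCLM Complex.abs_re_le_norm _ _
  · exact key _ Complex.imCLM Complex.abs_im_le_norm _ _

/-- Integration by parts for the expectation of `τ_N(X_i D(Z)) e^{-N tr_N(V)}`, where the `Z_v`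
are affine functions of the matrices. -/
theorem integral_traceN_mul_lift [IsProbabilityMeasure μ] (hN : 1 ≤ N) (hX : IsGUETuple μ X)
    (hV : WeightIntegrable μ X V) {τ : A →L[ℂ] ℂ}
    (W : Y → Matrix (Fin N) (Fin N) A) (b : Y → ℂ) (idx : Y → Fin d) (i : Fin d)
    (D : FreeAlgebra ℂ Y) :
    ∫ ω, traceN N τ (matEmb A N (X i ω) * FreeAlgebra.lift ℂ
        (fun v => W v + b v • matEmb A N (X (idx v) ω)) D) * weight V (fun i => X i ω) ∂μ =
      ∑ v, (if idx v = i then b v else 0) * (∫ ω, contraction τ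
        (fun v => W v + b v • matEmb A N (X (idx v) ω)) (ncDeriv v D) *
          weight V (fun i => X i ω) ∂μ) -
      ∫ ω, traceN N τ (matEmb A N (FreeAlgebra.lift ℂ (fun i => X i ω) (mulOp (ncDeriv i V))) *
        FreeAlgebra.lift ℂ (fun v => W v + b v • matEmb A N (X (idx v) ω)) D) *
          weight V (fun i => X i ω) ∂μ := by
  set Z : (Fin d → Matrix (Fin N) (Fin N) ℂ) → Y → Matrix (Fin N) (Fin N) A :=
    fun M v => W v + b v • matEmb A N (M (idx v)) with hZ
  have hZp : ∀ v, IsPolyMat (Set.univ : Set Unit) fun _ M => Z M v := fun v =>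
    (IsPolyMat.const (W v)).add (IsPolyMat.smul (c := fun _ => b v) continuous_const
      (fun _ _ => le_rfl) (IsPolyMat.matEmb (IsPolyMat.tuple (idx v))))
  have hLp := IsPolyMat.lift hZp D
  set G : Ω → Fin d × (Fin N × Fin N) → ℝ := fun ω q => gueCoord (X q.1 ω) q.2 with hG
  -- A Hermitian matrix is rebuilt from its coordinates, so every function of the matrices is a
  -- function of a Gaussian vector.
  have hGX : ∀ ω, gueTuple (G ω) = fun i => X i ω := fun ω => funext fun i =>
    sum_gueCoord hN (hX.isHermitian i ω)
  have hGm : ∀ q, Measurable fun ω => G ω q := by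
    intro q
    simp only [hG, gueCoord]
    split_ifs
    · exact (Complex.measurable_re.comp (hX.measurable_entry _ _ _)).const_mul _
    · exact (Complex.measurable_re.comp (hX.measurable_entry _ _ _)).const_mul _
    · exact (Complex.measurable_im.comp (hX.measurable_entry _ _ _)).const_mul _
  have hct : Continuous (gueTuple : (Fin d × (Fin N × Fin N) → ℝ) → _) := by
    refine continuous_pi fun i => ?_
    unfold gueTuple
    exact continuous_finsetSum _ fun p _ =>
      (Complex.continuous_ofReal.comp (continuous_apply _)).smul continuous_const
  -- the functions to which the scalar formula is applied
  let Fp : Fin N × Fin N → (Fin d → Matrix (Fin N) (Fin N) ℂ) → ℂ := fun p M =>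
    traceN N τ (matEmb A N (gueBasis N p) * FreeAlgebra.lift ℂ (Z M) D)
  let Gp : Fin N × Fin N → (Fin d → Matrix (Fin N) (Fin N) ℂ) → ℂ := fun p M =>
    ∑ v, (if idx v = i then b v else 0) * traceN N τ (matEmb A N (gueBasis N p) *
      sandwich (matEmb A N (gueBasis N p)) (Z M) (ncDeriv v D)) +
    (-(N : ℂ)) * (Fp p M * (gueBasis N p * FreeAlgebra.lift ℂ M (mulOp (ncDeriv i V))).trace)
  have hFp : ∀ p, IsPoly (Set.univ : Set Unit) fun _ M => Fp p M := fun p =>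
    ((IsPolyMat.const _).mul hLp).traceN τ
  have hGp : ∀ p, IsPoly (Set.univ : Set Unit) fun _ M => Gp p M := fun p =>
    (IsPoly.sum _ fun v _ => (IsPoly.const _).mul
      (((IsPolyMat.const _).mul (IsPolyMat.sandwich (IsPolyMat.const _) hZp _)).traceN τ)).add
    ((IsPoly.const _).mul ((hFp p).mul (((IsPolyMat.const _).mul
      (IsPolyMat.lift (A := ℂ) (fun v => IsPolyMat.tuple v) _)).trace)))
  have hGF : ∀ p, Integrable (fun ω => (G ω (i, p) : ℂ) *
      (Fp p (fun i => X i ω) * weight V fun i => X i ω)) μ := fun p => by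
    have h := ((isPoly_gueCoord (S := (Set.univ : Set Unit)) i p).mul (hFp p)).integrable hX hV
      (a := ()) trivial
    simpa only [mul_assoc] using h
  -- Scalar integration by parts in the coordinate (i, p). The derivative falls on the polynomial
  -- and on the weight; `Gp` collects both contributions.
  have step : ∀ p, ∫ ω, (G ω (i, p) : ℂ) * (Fp p (fun i => X i ω) * weight V fun i => X i ω) ∂μ =
      ∫ ω, Gp p (fun i => X i ω) * weight V (fun i => X i ω) ∂μ := by
    intro p
    have hcw := continuous_weight (N := N) V
    have hI := integral_mul_gaussian_vector (μ := μ) (G := G) hGm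
      (fun q => hX.law q.1 q.2) hX.indep (i, p)
      (Ψ := fun y => Fp p (gueTuple y) * weight V (gueTuple y))
      (Ψ' := fun y => Gp p (gueTuple y) * weight V (gueTuple y))
      (((hFp p).1.comp (continuous_const.prodMk hct : Continuous fun y => ((), gueTuple y))).mul (hcw.comp hct)).measurable
      (((hGp p).1.comp (continuous_const.prodMk hct : Continuous fun y => ((), gueTuple y))).mul (hcw.comp hct)).measurable
      (fun y => ?_) ?_ ?_ ?_
    · simpa only [hGX] using hI
    · have hZd : ∀ v r s, HasDerivAt (fun g => Z (gueTuple (Function.update y (i, p) g)) v r s)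
          ((b v • matEmb A N (if idx v = i then gueBasis N p else 0)) r s) (y (i, p)) := by
        intro v r s
        have h := (((Algebra.linearMap ℂ A).toContinuousLinearMap).restrictScalars
          ℝ).hasFDerivAt.comp_hasDerivAt _ (hasDerivAt_gueTuple y (i, p) (idx v) r s)
        exact (h.const_smul (b v)).const_add (W v r s)
      have h1 := hasDerivAt_traceN τ (hasDerivAt_mul_entry
        (F := fun _ => matEmb A N (gueBasis N p)) (F' := 0) (fun r s => hasDerivAt_const _ _)
        (hasDerivAt_lift hZd D))
      have h2 := h1.mul (hasDerivAt_weight (V := V) y (i, p))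
      refine h2.congr_deriv ?_
      simp only [Function.update_eq_self, zero_mul, zero_add, Fp, Gp]
      have e : traceN N τ (matEmb A N (gueBasis N p) * ∑ v, sandwich
          (b v • matEmb A N (if idx v = i then gueBasis N p else 0)) (Z (gueTuple y))
            (ncDeriv v D)) = ∑ v, (if idx v = i then b v else 0) * traceN N τ
          (matEmb A N (gueBasis N p) * sandwich (matEmb A N (gueBasis N p)) (Z (gueTuple y))
            (ncDeriv v D)) := by
        rw [Finset.mul_sum, map_sum]
        refine Finset.sum_congr rfl fun v _ => ?_
        rw [sandwich_smul, mul_smul_comm, map_smul, smul_eq_mul]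
        split_ifs
        · rfl
        · rw [map_zero, show (0 : Matrix (Fin N) (Fin N) A) = (0 : ℂ) • 0 by simp, sandwich_smul]
          simp
      rw [e]
      ring
    · simpa only [hGX] using (hFp p).integrable hX hV (a := ()) trivial
    · simpa only [hGX] using hGF p
    · simpa only [hGX] using (hGp p).integrable hX hV (a := ()) trivial
  have hsum : ∀ ω, traceN N τ (matEmb A N (X i ω) * FreeAlgebra.lift ℂ (Z fun i => X i ω) D) =
      ∑ p, (G ω (i, p) : ℂ) * Fp p fun i => X i ω := by
    intro ω
    have h : gueTuple (G ω) i = X i ω := congrFun (hGX ω) i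
    conv_lhs => rw [← h, gueTuple, map_sum, Finset.sum_mul, map_sum]
    refine Finset.sum_congr rfl fun p _ => ?_
    rw [map_smul, smul_mul_assoc, map_smul, smul_eq_mul]
  -- Summed over the coordinates, the second-order terms form the contraction, and in the potential
  -- term -N · (1/N) = -1.
  have hGsum : ∀ M, ∑ p, Gp p M = ∑ v, (if idx v = i then b v else 0) *
      contraction τ (Z M) (ncDeriv v D) - traceN N τ (matEmb A N
        (FreeAlgebra.lift ℂ M (mulOp (ncDeriv i V))) * FreeAlgebra.lift ℂ (Z M) D) := by
    intro M
    have hN0 : (N : ℂ) ≠ 0 := by exact_mod_cast (by omega : N ≠ 0)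
    simp only [Gp, Fp]
    rw [Finset.sum_add_distrib, Finset.sum_comm, ← Finset.mul_sum, sum_gueBasis_trace hN,
      sub_eq_add_neg]
    congr 1
    · refine Finset.sum_congr rfl fun v _ => ?_
      rw [← Finset.mul_sum, sum_gueBasis_sandwich hN]
    · field_simp
  have hcp : ∀ v, IsPoly (Set.univ : Set Unit) fun _ M => contraction τ (Z M) (ncDeriv v D) := by
    intro v
    simp only [contraction_apply]
    exact (IsPoly.const _).mul (IsPoly.sum _ fun p _ =>
      ((IsPolyMat.const _).mul (IsPolyMat.sandwich (IsPolyMat.const _) hZp _)).traceN τ)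
  have hvp : IsPoly (Set.univ : Set Unit) fun _ M => traceN N τ (matEmb A N
      (FreeAlgebra.lift ℂ M (mulOp (ncDeriv i V))) * FreeAlgebra.lift ℂ (Z M) D) :=
    ((IsPolyMat.matEmb (IsPolyMat.lift (A := ℂ) (fun v => IsPolyMat.tuple v) _)).mul
      hLp).traceN τ
  have hci := fun v => (hcp v).integrable hX hV (a := ()) trivial
  calc _ = ∫ ω, ∑ p, (G ω (i, p) : ℂ) *
        (Fp p (fun i => X i ω) * weight V fun i => X i ω) ∂μ := by
        refine integral_congr_ae (ae_of_all _ fun ω => ?_)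
        change traceN N τ (matEmb A N (X i ω) * FreeAlgebra.lift ℂ (Z fun i => X i ω) D) * _ = _
        rw [hsum, Finset.sum_mul]
        simp only [mul_assoc]
    _ = ∫ ω, (∑ p, Gp p fun i => X i ω) * weight V (fun i => X i ω) ∂μ := by
        rw [integral_finsetSum _ fun p _ => hGF p]
        simp only [step, Finset.sum_mul]
        rw [integral_finsetSum _ fun p _ => (hGp p).integrable hX hV (a := ()) trivial]
    _ = ∫ ω, (∑ v, (if idx v = i then b v else 0) * (contraction τ (Z fun i => X i ω)
          (ncDeriv v D) * weight V fun i => X i ω)) - traceN N τ (matEmb A N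
        (FreeAlgebra.lift ℂ (fun i => X i ω) (mulOp (ncDeriv i V))) *
          FreeAlgebra.lift ℂ (Z fun i => X i ω) D) * weight V (fun i => X i ω) ∂μ := by
        refine integral_congr_ae (ae_of_all _ fun ω => ?_)
        have h := hGsum fun i => X i ω
        dsimp only at h ⊢
        rw [h, sub_mul, Finset.sum_mul]
        simp only [mul_assoc]
    _ = _ := by
        rw [integral_sub (integrable_finsetSum _ fun v _ => (hci v).const_mul _)
          (hvp.integrable hX hV (a := ()) trivial),
          integral_finsetSum _ fun v _ => (hci v).const_mul _]
        simp only [integral_const_mul]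
        rfl

end GUE

end

end MasterEquation

open MeasureTheory ProbabilityTheory
open scoped TensorProduct

namespace MasterEquation

noncomputable section

/-! ## Ordered times -/

section Times

theorem ordTime_zero (T : List ℝ) : ordTime T 0 = 0 := rfl

theorem ordTime_eq_getElem (T : List ℝ) {l : ℕ} (hl : l ≤ T.length) :
    ordTime T l = (0 :: T.insertionSort (· ≤ ·))[l]'(by simp; omega) :=
  List.getD_eq_getElem _ _ _

theorem pairwise_zero_cons_insertionSort {T : List ℝ} (hT : ∀ t ∈ T, 0 ≤ t) :
    (0 :: T.insertionSort (· ≤ ·)).Pairwise (· ≤ ·) :=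
  List.pairwise_cons.2 ⟨fun a ha => hT a ((List.perm_insertionSort _ T).subset ha),
    List.pairwise_insertionSort _ T⟩

theorem ordTime_mono {T : List ℝ} (hT : ∀ t ∈ T, 0 ≤ t) {l k : ℕ} (hlk : l ≤ k)
    (hk : k ≤ T.length) : ordTime T l ≤ ordTime T k := by
  rcases hlk.eq_or_lt with rfl | h
  · rfl
  rw [ordTime_eq_getElem T (by omega), ordTime_eq_getElem T hk]
  exact List.pairwise_iff_getElem.1 (pairwise_zero_cons_insertionSort hT) _ _ _ _ h

theorem ordTime_nonneg {T : List ℝ} (hT : ∀ t ∈ T, 0 ≤ t) {l : ℕ} (hl : l ≤ T.length) :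
    0 ≤ ordTime T l := by
  exact ordTime_mono hT (Nat.zero_le l) hl

/-- Both lists are sorted and are permutations of each other. The upper bound on u is required only
if place s exists, since `ordTime` has default value 0 beyond the end of T. -/
theorem zero_cons_insertionSort_cons {T : List ℝ} (hT : ∀ t ∈ T, 0 ≤ t) {u : ℝ} {s : ℕ}
    (hs : 1 ≤ s) (hsT : s ≤ T.length + 1) (h1 : ordTime T (s - 1) ≤ u)
    (h2 : s ≤ T.length → u ≤ ordTime T s) :
    0 :: (u :: T).insertionSort (· ≤ ·) = (0 :: T.insertionSort (· ≤ ·)).take s ++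
      u :: (0 :: T.insertionSort (· ≤ ·)).drop s := by
  have hu : 0 ≤ u := (ordTime_nonneg hT (by omega)).trans h1
  have hp := pairwise_zero_cons_insertionSort hT
  refine List.Perm.eq_of_pairwise (le := (· ≤ ·)) (fun a b _ _ h h' => le_antisymm h h') (pairwise_zero_cons_insertionSort
    (fun t ht => ?_)) ?_ ?_
  · rcases List.mem_cons.1 ht with rfl | h
    exacts [hu, hT t h]
  · rw [List.pairwise_append]
    refine ⟨hp.take, List.pairwise_cons.2 ⟨?_, hp.drop⟩, ?_⟩
    · intro a ha
      obtain ⟨k, hk, rfl⟩ := List.getElem_of_mem ha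
      simp only [List.length_drop, List.length_cons, List.length_insertionSort] at hk
      rw [List.getElem_drop, ← ordTime_eq_getElem T (by omega)]
      exact (h2 (by omega)).trans (ordTime_mono hT (by omega) (by omega))
    · intro a ha b hb
      obtain ⟨k, hk, rfl⟩ := List.getElem_of_mem ha
      simp only [List.length_take, List.length_cons, List.length_insertionSort] at hk
      rw [List.getElem_take, ← ordTime_eq_getElem T (by omega)]
      have hku : ordTime T k ≤ u := (ordTime_mono hT (by omega) (by omega)).trans h1
      rcases List.mem_cons.1 hb with rfl | hb
      · exact hku
      · obtain ⟨k', hk', rfl⟩ := List.getElem_of_mem hb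
        simp only [List.length_drop, List.length_cons, List.length_insertionSort] at hk'
        rw [List.getElem_drop, ← ordTime_eq_getElem T (by omega)]
        exact ordTime_mono hT (by omega) (by omega)
  · refine List.Perm.trans ?_ List.perm_middle.symm
    rw [List.take_append_drop]
    exact ((List.perm_insertionSort _ (u :: T)).trans
      ((List.perm_insertionSort _ T).symm.cons u)).cons 0 |>.trans (List.Perm.swap _ _ _)

/-- The ordered times after the insertion of `u` at its place `s`. -/
theorem ordTime_cons {T : List ℝ} (hT : ∀ t ∈ T, 0 ≤ t) {u : ℝ} {s : ℕ}
    (hs : 1 ≤ s) (hsT : s ≤ T.length + 1) (h1 : ordTime T (s - 1) ≤ u)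
    (h2 : s ≤ T.length → u ≤ ordTime T s) {l : ℕ} :
    ordTime (u :: T) l = if l < s then ordTime T l else if l = s then u else
      ordTime T (l - 1) := by
  have h := zero_cons_insertionSort_cons hT hs hsT h1 h2
  have hlen : ((0 : ℝ) :: T.insertionSort (· ≤ ·)).length = T.length + 1 := by simp
  rw [ordTime, h]
  rw [List.getD_eq_getElem?_getD, List.getElem?_append, List.length_take, hlen,
    min_eq_left hsT]
  split_ifs with h1 h2
  · rw [List.getElem?_take_of_lt h1, ordTime, List.getD_eq_getElem?_getD]
  · subst h2; simp
  · obtain ⟨k, rfl⟩ : ∃ k, l = s + 1 + k := ⟨l - s - 1, by omega⟩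
    rw [show s + 1 + k - s = k + 1 by omega, List.getElem?_cons_succ, List.getElem?_drop, ordTime,
      List.getD_eq_getElem?_getD, show s + 1 + k - 1 = s + k by omega]

theorem ordTime_cons_top {T : List ℝ} (hT : ∀ t ∈ T, 0 ≤ t) {t : ℝ}
    (ht : ordTime T T.length ≤ t) {l : ℕ} (hl : l ≤ T.length) :
    ordTime (t :: T) l = ordTime T l := by
  rw [ordTime_cons hT (s := T.length + 1) (by omega) le_rfl ht (by omega), if_pos (by omega)]

theorem ordTime_cons_last {T : List ℝ} (hT : ∀ t ∈ T, 0 ≤ t) {t : ℝ}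
    (ht : ordTime T T.length ≤ t) :
    ordTime (t :: T) (T.length + 1) = t := by
  rw [ordTime_cons hT (s := T.length + 1) (by omega) le_rfl ht (by omega), if_neg (by omega),
    if_pos rfl]

end Times

/-! ## Index sets -/

section IndexSets

/-- The integers that occur in the elements of `S` are positive, and each of them determines the
number of integers which follow it. -/
def Slotted (S : Finset (List ℕ)) (slot : ℕ → ℕ) : Prop :=
  ∀ I ∈ S, (∀ L ∈ I, 0 < L) ∧ I.map slot = (List.range I.length).reverse

theorem le_maxLabel {S : Finset (List ℕ)} {I : List ℕ} (hI : I ∈ S) {L : ℕ} (hL : L ∈ I) :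
    L ≤ maxLabel S := by
  refine le_trans ?_ (Finset.le_sup (f := fun I : List ℕ => I.foldr max 0) hI)
  clear hI
  induction I with
  | nil => simp at hL
  | cons a I ih =>
    rcases List.mem_cons.1 hL with rfl | h
    · exact le_max_left _ _
    · exact (ih h).trans (le_max_right _ _)

theorem length_le_depth {S : Finset (List ℕ)} {I : List ℕ} (hI : I ∈ S) :
    I.length ≤ depth S := Finset.le_sup (f := List.length) hI

theorem getElem_slot {S : Finset (List ℕ)} {slot : ℕ → ℕ} (h : Slotted S slot) {I : List ℕ}
    (hI : I ∈ S) {k : ℕ} (hk : k < I.length) : slot I[k] = I.length - 1 - k := by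
  have h1 : (I.map slot)[k]'(by simpa) = I.length - 1 - k := by
    simp only [(h I hI).2, List.getElem_reverse, List.getElem_range, List.length_range]
  simpa using h1

/-- The label c+1 exceeds every label in S, so it can receive slot 0 without conflict, while every
other label gains one follower. -/
theorem Slotted.setG {S : Finset (List ℕ)} {slot : ℕ → ℕ} (h : Slotted S slot) :
    Slotted (setG S) fun L => if L = maxLabel S + 1 then 0 else slot L + 1 := by
  intro I hI
  simp only [MasterEquation.setG, Finset.mem_union, Finset.mem_image, Finset.mem_singleton] at hI
  rcases hI with ⟨J, hJ, rfl⟩ | rfl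
  · refine ⟨fun L hL => ?_, ?_⟩
    · rcases List.mem_append.1 hL with h' | h'
      · exact (h J hJ).1 L h'
      · simp at h'; omega
    · refine List.ext_getElem (by simp [gPlus]) fun k hk _ => ?_
      simp only [gPlus, List.length_map, List.length_append, List.length_singleton] at hk
      simp only [gPlus, List.getElem_map, List.getElem_append, List.getElem_reverse,
        List.getElem_range, List.length_range, List.length_append, List.length_singleton]
      split_ifs with h1 h2 h3
      · have := le_maxLabel hJ (List.getElem_mem h1); omega
      · rw [getElem_slot h hJ h1]; omega
      · omega
      · simp at h3
  · simp

/-- The slots of the integers that occur in `F(S)`. -/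
def slotF (c : ℕ) (slot : ℕ → ℕ) (L : ℕ) : ℕ :=
  let K := if 3 * c + 3 < L then L - (3 * c + 3) else L
  if K = 3 * c + 1 then 0 else if 3 * c + 2 ≤ K then 1 else if K ≤ c then slot K + 1
  else if K ≤ 2 * c then slot (K - c) + 2 else slot (K - 2 * c) + 2

/-- The common shape of the maps `F_j^1`, `F_j^2` (for `k = 1, 2`) and of their shifted versions
(for `o = 1`). -/
def fCopy (S : Finset (List ℕ)) (j k o : ℕ) (I : List ℕ) : List ℕ :=
  (fBase S j (k * maxLabel S) (3 * maxLabel S + 1 + k) I).map (· + o * (3 * maxLabel S + 3))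

theorem f1_eq (S : Finset (List ℕ)) (j : ℕ) (I : List ℕ) : f1 S j I = fCopy S j 1 0 I := by
  simp [f1, fCopy]

theorem f2_eq (S : Finset (List ℕ)) (j : ℕ) (I : List ℕ) : f2 S j I = fCopy S j 2 0 I := by
  simp [f2, fCopy]

theorem f1t_eq (S : Finset (List ℕ)) (j : ℕ) (I : List ℕ) : f1t S j I = fCopy S j 1 1 I := by
  simp [f1t, f1, fCopy]

theorem f2t_eq (S : Finset (List ℕ)) (j : ℕ) (I : List ℕ) : f2t S j I = fCopy S j 2 1 I := by
  simp [f2t, f2, fCopy]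

/-- The integer replacing `L ∈ {1, …, c + 1}` in the copy `k` (the unshifted one for `k = 0`). -/
def lab (c k o L : ℕ) : ℕ :=
  (if L = c + 1 then 3 * c + 1 + k else L + k * c) + o * (3 * c + 3)

/-- The copies occupy disjoint blocks: 1..c, c+1..2c, 2c+1..3c, the three singletons 3c+1, 3c+2,
3c+3, and all of these again shifted by 3c+3. -/
theorem lab_inj {c k o L k' o' L' : ℕ} (hk : k ≤ 2) (hk' : k' ≤ 2) (ho : o ≤ 1) (ho' : o' ≤ 1)
    (hL : 1 ≤ L) (hLc : L ≤ c + 1) (hL' : 1 ≤ L') (hLc' : L' ≤ c + 1) :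
    lab c k o L = lab c k' o' L' ↔ k = k' ∧ o = o' ∧ L = L' := by
  refine ⟨fun h => ?_, fun ⟨h1, h2, h3⟩ => by rw [h1, h2, h3]⟩
  unfold lab at h
  interval_cases k <;> interval_cases k' <;> interval_cases o <;> interval_cases o' <;>
    split_ifs at h <;> omega

/-- An unshifted label gains one follower, the appended 3c+1. A label of the copies k = 1, 2 stands
before the repeated entry and therefore has one more. -/
theorem slotF_lab {c k o L : ℕ} (slot : ℕ → ℕ) (hk : k ≤ 2) (ho : o ≤ 1)
    (hL : 1 ≤ L) (hLc : L ≤ c + 1) : slotF c slot (lab c k o L) =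
      (if L = c + 1 then 0 else slot L + 1) + (if k = 0 then 0 else 1) := by
  have e : (if 3 * c + 3 < lab c k o L then lab c k o L - (3 * c + 3) else lab c k o L) =
      lab c k 0 L := by
    unfold lab
    interval_cases k <;> interval_cases o <;> split_ifs <;> omega
  unfold slotF
  simp only [e]
  by_cases h : L = c + 1
  · simp only [lab, h, if_true]
    interval_cases k
    · rw [if_pos (by omega), if_pos rfl]
    · rw [if_neg (by omega), if_pos (by omega), if_neg (by omega)]
    · rw [if_neg (by omega), if_pos (by omega), if_neg (by omega)]
  · simp only [lab, h, if_false]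
    interval_cases k
    · rw [if_neg (by omega), if_neg (by omega), if_pos (by omega), if_pos rfl]
      simp
    · rw [if_neg (by omega), if_neg (by omega), if_neg (by omega), if_pos (by omega),
        if_neg (by omega)]
      simp
    · rw [if_neg (by omega), if_neg (by omega), if_neg (by omega), if_neg (by omega),
        if_neg (by omega)]
      simp

/-- `fCopy` in terms of the extended list `gPlus S I`. -/
theorem fCopy_eq (S : Finset (List ℕ)) (j k o : ℕ) {I : List ℕ} (hI : I ∈ S) :
    fCopy S j k o I =
      if startIdx (depth S) I ≤ j then
        ((gPlus S I).take (j + 1 - startIdx (depth S) I)).map (lab (maxLabel S) k o) ++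
          ((gPlus S I).drop (min j (depth S + 1) - startIdx (depth S) I)).map
            (lab (maxLabel S) 0 o)
      else (gPlus S I).map (lab (maxLabel S) 0 o) := by
  have hl := length_le_depth hI
  have hc : ∀ L ∈ I, ¬ L = maxLabel S + 1 := fun L hL => by have := le_maxLabel hI hL; omega
  have key : ∀ (k : ℕ) (J : List ℕ), (∀ L ∈ J, L ∈ I) → J.map (lab (maxLabel S) k o) =
      (J.map (· + k * maxLabel S)).map (· + o * (3 * maxLabel S + 3)) := by
    intro k J hJ
    rw [List.map_map]
    refine List.map_congr_left fun L hL => ?_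
    simp [lab, hc L (hJ L hL)]
  have key1 : ∀ k, [maxLabel S + 1].map (lab (maxLabel S) k o) =
      [3 * maxLabel S + 1 + k].map (· + o * (3 * maxLabel S + 3)) := by
    intro k; simp [lab]
  have h0 : ∀ J : List ℕ, J.map (· + 0 * maxLabel S) = J := fun J => by simp
  have hm : startIdx (depth S) I = depth S + 1 - I.length := rfl
  unfold fCopy fBase
  dsimp only
  split_ifs with h1 h2 h3
  · rw [gPlus, List.take_append_of_le_length (by omega), List.drop_append_of_le_length (by omega),
      List.map_append, List.map_append, List.map_append, key k _ fun L hL => List.mem_of_mem_take hL,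
      key 0 _ fun L hL => List.mem_of_mem_drop hL, key1, h0, min_eq_left (by omega),
      List.append_assoc]
  · rw [gPlus, List.map_append, List.map_append, key 0 _ fun L hL => hL, key1, h0]
  -- For j > n the whole extended list is copied. Its last label c+1 becomes 3c+1+k in the front
  -- part and is repeated as the final 3c+1, which is why the drop index is truncated at n+1.
  · rw [List.take_of_length_le (by simp [gPlus]; omega), gPlus, List.map_append,
      List.map_append, key k _ fun L hL => hL,
      key1, min_eq_right (by omega), List.drop_append, List.drop_of_length_le (by omega),
      show depth S + 1 - startIdx (depth S) I - I.length = 0 by omega]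
    simp [lab]
  · omega

theorem Slotted.setFj {S : Finset (List ℕ)} {slot : ℕ → ℕ} (h : Slotted S slot) (j : ℕ) :
    Slotted (setFj S j) (slotF (maxLabel S) slot) := by
  have key : ∀ k o, k ≤ 2 → 1 ≤ k → o ≤ 1 → ∀ I ∈ S, (∀ L ∈ fCopy S j k o I, 0 < L) ∧
      (fCopy S j k o I).map (slotF (maxLabel S) slot) =
        (List.range (fCopy S j k o I).length).reverse := by
    intro k o hk hk1 ho I hI
    have hG := h.setG (gPlus S I) (gPlus_mem S I hI)
    have hle : ∀ L ∈ gPlus S I, L ≤ maxLabel S + 1 := by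
      intro L hL
      rcases List.mem_append.1 hL with h' | h'
      · exact (le_maxLabel hI h').trans (by omega)
      · simp at h'; omega
    have hpos : ∀ L k o, 0 < L → 0 < lab (maxLabel S) k o L := by
      intro L k o hL; unfold lab; split_ifs <;> omega
    have hslot : ∀ i (hi : i < (gPlus S I).length) (k o : ℕ), k ≤ 2 → o ≤ 1 →
        slotF (maxLabel S) slot (lab (maxLabel S) k o (gPlus S I)[i]) =
          (gPlus S I).length - 1 - i + (if k = 0 then 0 else 1) := by
      intro i hi k o hk ho
      rw [slotF_lab slot hk ho (hG.1 _ (List.getElem_mem _)) (hle _ (List.getElem_mem _))]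
      congr 1
      exact getElem_slot h.setG (gPlus_mem S I hI) hi
    have hlG : (gPlus S I).length = I.length + 1 := by simp [gPlus]
    have hl := length_le_depth hI
    have hplain : (∀ L ∈ (gPlus S I).map (lab (maxLabel S) 0 o), 0 < L) ∧
        ((gPlus S I).map (lab (maxLabel S) 0 o)).map (slotF (maxLabel S) slot) =
          (List.range ((gPlus S I).map (lab (maxLabel S) 0 o)).length).reverse := by
      refine ⟨fun L hL => ?_, List.ext_getElem (by simp) fun i hi _ => ?_⟩
      · obtain ⟨L', hL', rfl⟩ := List.mem_map.1 hL
        exact hpos _ _ _ (hG.1 _ hL')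
      · simp only [List.length_map] at hi
        simp only [List.getElem_map, List.getElem_reverse, List.getElem_range, List.length_range,
          List.length_map]
        rw [hslot i hi 0 o (by omega) ho, if_pos rfl]; omega
    rw [fCopy_eq S j k o hI]
    have hm : startIdx (depth S) I = depth S + 1 - I.length := rfl
    split_ifs with hmj
    · refine ⟨fun L hL => ?_, List.ext_getElem (by simp) fun i hi _ => ?_⟩
      · rcases List.mem_append.1 hL with hL | hL
        · obtain ⟨L', hL', rfl⟩ := List.mem_map.1 hL
          exact hpos _ _ _ (hG.1 _ (List.mem_of_mem_take hL'))
        · obtain ⟨L', hL', rfl⟩ := List.mem_map.1 hL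
          exact hpos _ _ _ (hG.1 _ (List.mem_of_mem_drop hL'))
      · simp only [List.length_map, List.length_append, List.length_take, List.length_drop] at hi
        simp only [List.map_append, List.map_map, List.getElem_append, List.length_map,
          List.length_take, List.length_drop, List.length_append, List.getElem_reverse,
          List.getElem_range, List.length_range, List.getElem_map, List.getElem_take,
          List.getElem_drop, Function.comp_apply]
        split_ifs with hi'
        · rw [hslot _ _ k o hk ho, if_neg (by omega)]; omega
        · rw [hslot _ _ 0 o (by omega) ho, if_pos rfl]; omega
    · exact hplain
  intro I hI
  simp only [MasterEquation.setFj, Finset.mem_union, Finset.mem_image] at hI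
  rcases hI with ((⟨J, hJ, rfl⟩ | ⟨J, hJ, rfl⟩) | ⟨J, hJ, rfl⟩) | ⟨J, hJ, rfl⟩
  · rw [f1_eq]; exact key 1 0 (by omega) le_rfl (by omega) J hJ
  · rw [f2_eq]; exact key 2 0 le_rfl (by omega) (by omega) J hJ
  · rw [f1t_eq]; exact key 1 1 (by omega) le_rfl (by omega) J hJ
  · rw [f2t_eq]; exact key 2 1 le_rfl (by omega) (by omega) J hJ

theorem exists_slotted_indexSet (H : List Step) : ∃ slot, Slotted (indexSet H) slot := by
  induction H using List.reverseRecOn with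
  | nil => exact ⟨id, by intro I hI; simp [indexSet] at hI; simp [hI]⟩
  | append_singleton H h ih =>
    obtain ⟨slot, hs⟩ := ih
    rw [indexSet_concat]
    cases h with
    | F =>
      -- The slot function of F_j(S) does not depend on j, so one function serves the whole union.
      refine ⟨slotF (maxLabel (indexSet H)) slot, fun I hI => ?_⟩
      · obtain ⟨j, _, hj⟩ := Finset.mem_biUnion.1 hI
        exact hs.setFj j I hj
    | G => exact ⟨_, hs.setG⟩
    | Fj j => exact ⟨_, hs.setFj j⟩

end IndexSets

end

end MasterEquation

open MeasureTheory ProbabilityTheory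
open scoped TensorProduct

namespace MasterEquation

noncomputable section

/-! ## Covariances -/

section Covariances

variable {d : ℕ}

/-- The entries of `I` completed by the new integer `c + 1`. -/
def plusEntry (S : Finset (List ℕ)) (I : List ℕ) (l : ℕ) : ℕ := entry (depth S + 1) (gPlus S I) l

theorem startIdx_gPlus (S : Finset (List ℕ)) (I : List ℕ) :
    startIdx (depth S + 1) (gPlus S I) = startIdx (depth S) I := by
  simp [startIdx, gPlus]

theorem one_le_startIdx {S : Finset (List ℕ)} {I : List ℕ} (hI : I ∈ S) :
    1 ≤ startIdx (depth S) I := by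
  have := length_le_depth hI
  simp only [startIdx]; omega

theorem startIdx_le (n : ℕ) (I : List ℕ) : startIdx n I ≤ n + 1 := by
  simp only [startIdx]; omega

theorem plusEntry_eq_getElem {S : Finset (List ℕ)} {I : List ℕ} (hI : I ∈ S) {l : ℕ}
    (hml : startIdx (depth S) I ≤ l) (hl : l ≤ depth S + 1) :
    ∃ h : l - startIdx (depth S) I < (gPlus S I).length,
      plusEntry S I l = (gPlus S I)[l - startIdx (depth S) I] := by
  have hd := length_le_depth hI
  have hlen : (gPlus S I).length = I.length + 1 := by simp [gPlus]
  have hm : startIdx (depth S) I = depth S + 1 - I.length := rfl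
  refine ⟨by omega, ?_⟩
  rw [plusEntry, entry, startIdx_gPlus, List.getD_eq_getElem _ _ (by omega)]

theorem plusEntry_bounds {S : Finset (List ℕ)} {slot : ℕ → ℕ} (h : Slotted S slot) {I : List ℕ}
    (hI : I ∈ S) {l : ℕ} (hml : startIdx (depth S) I ≤ l) (hl : l ≤ depth S + 1) :
    1 ≤ plusEntry S I l ∧ plusEntry S I l ≤ maxLabel S + 1 := by
  obtain ⟨hk, e⟩ := plusEntry_eq_getElem hI hml hl
  rw [e]
  refine ⟨(h.setG _ (gPlus_mem S I hI)).1 _ (List.getElem_mem _), ?_⟩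
  rcases List.mem_append.1 (List.getElem_mem hk) with h' | h'
  · exact (le_maxLabel hI h').trans (by omega)
  · simp at h'; omega

/-- A label knows how many labels follow it, and both extended lists end at position n+1; hence
equal labels stand at equal positions. This makes the covariance sums diagonal in l. -/
theorem plusEntry_inj {S : Finset (List ℕ)} {slot : ℕ → ℕ} (h : Slotted S slot) {I J : List ℕ}
    (hI : I ∈ S) (hJ : J ∈ S) {l l' : ℕ} (hml : startIdx (depth S) I ≤ l) (hl : l ≤ depth S + 1)
    (hml' : startIdx (depth S) J ≤ l') (hl' : l' ≤ depth S + 1)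
    (hE : plusEntry S I l = plusEntry S J l') : l = l' := by
  obtain ⟨hk, e⟩ := plusEntry_eq_getElem hI hml hl
  obtain ⟨hk', e'⟩ := plusEntry_eq_getElem hJ hml' hl'
  have h1 := getElem_slot h.setG (gPlus_mem S I hI) hk
  have h2 := getElem_slot h.setG (gPlus_mem S J hJ) hk'
  rw [← e, hE, e', h2] at h1
  have hd := length_le_depth hI
  have hlen : (gPlus S I).length = I.length + 1 := by simp [gPlus]
  have hm : startIdx (depth S) I = depth S + 1 - I.length := rfl
  have hd' := length_le_depth hJ
  have hlen' : (gPlus S J).length = J.length + 1 := by simp [gPlus]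
  have hm' : startIdx (depth S) J = depth S + 1 - J.length := rfl
  omega

theorem plusEntry_of_le {S : Finset (List ℕ)} {I : List ℕ} (hI : I ∈ S) {l : ℕ}
    (hml : startIdx (depth S) I ≤ l) (hl : l ≤ depth S) :
    plusEntry S I l = entry (depth S) I l ∧ plusEntry S I l ≤ maxLabel S := by
  have hd := length_le_depth hI
  have hm : startIdx (depth S) I = depth S + 1 - I.length := rfl
  have hlt : l - startIdx (depth S) I < I.length := by omega
  have : plusEntry S I l = entry (depth S) I l := by
    rw [plusEntry, entry, startIdx_gPlus, gPlus, List.getD_append _ _ _ _ hlt, entry]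
  refine ⟨this, ?_⟩
  rw [this, entry, List.getD_eq_getElem _ _ hlt]
  exact le_maxLabel hI (List.getElem_mem _)

theorem plusEntry_last {S : Finset (List ℕ)} {I : List ℕ} (hI : I ∈ S) :
    plusEntry S I (depth S + 1) = maxLabel S + 1 := by
  have hd := length_le_depth hI
  rw [plusEntry, entry, startIdx_gPlus, startIdx,
    show depth S + 1 - (depth S + 1 - I.length) = I.length by omega, gPlus]
  simp

/-- The coefficient `(e^{-a} - e^{-b})^{1/2}`. -/
def gap (a b : ℝ) : ℝ := Real.sqrt (Real.exp (-a) - Real.exp (-b))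

theorem gap_self (a : ℝ) : gap a a = 0 := by simp [gap]

theorem gap_mul_gap {a b : ℝ} (h : a ≤ b) : gap a b * gap a b = Real.exp (-a) - Real.exp (-b) :=
  Real.mul_self_sqrt (sub_nonneg.2 (Real.exp_le_exp.2 (neg_le_neg h)))

theorem continuous_gap : Continuous fun p : ℝ × ℝ => gap p.1 p.2 := by
  unfold gap; fun_prop

theorem abs_gap_le {a : ℝ} (ha : 0 ≤ a) (b : ℝ) : |gap a b| ≤ 1 := by
  rw [gap, abs_of_nonneg (Real.sqrt_nonneg _), ← Real.sqrt_one]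
  refine Real.sqrt_le_sqrt ?_
  have h1 : Real.exp (-a) ≤ 1 := Real.exp_le_one_iff.2 (by linarith)
  have h2 := Real.exp_pos (-b)
  linarith

/-- The coefficients of the semicircular elements in the interpolation with the times `ϑ`. -/
def coef (ϑ : ℕ → ℝ) (n : ℕ) (i : Fin d) (I : List ℕ) : ℕ × Fin d →₀ ℂ :=
  ((Real.exp (ϑ (startIdx n I - 1) / 2) : ℝ) : ℂ) • ∑ l ∈ Finset.Icc (startIdx n I) n,
    ((gap (ϑ (l - 1)) (ϑ l) : ℝ) : ℂ) • Finsupp.single (entry n I l, i) 1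

/-- The coefficient of the matrices in the interpolation with the times `ϑ`. -/
def meanCoef (ϑ : ℕ → ℝ) (n : ℕ) (I : List ℕ) : ℂ :=
  ((Real.exp (ϑ (startIdx n I - 1) / 2) : ℝ) : ℂ) * ((Real.exp (-ϑ n / 2) : ℝ) : ℂ)

/-- Separates the semicircular coefficients, which carry the covariance, from the matrix
coefficient, which carries the mean. -/
theorem interp_eq {A : Type*} [CStarAlgebra A] {N : ℕ} (S : Finset (List ℕ)) (T : List ℝ)
    (x : ℕ → Fin d → Matrix (Fin N) (Fin N) A) (b : Fin d → Matrix (Fin N) (Fin N) A)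
    (p : Fin d × S) : interp S T x b p =
      Finsupp.linearCombination ℂ (fun q : ℕ × Fin d => x q.1 q.2)
        (coef (ordTime T) T.length p.1 p.2.1) + meanCoef (ordTime T) T.length p.2.1 • b p.1 := by
  simp only [interp, coef, meanCoef, map_smul, map_sum, Finsupp.linearCombination_single, one_smul,
    smul_add, smul_smul, gap]

theorem coef_congr {ϑ ϑ' : ℕ → ℝ} {n : ℕ} (h : ∀ l ≤ n, ϑ l = ϑ' l) (i : Fin d) (I : List ℕ) :
    coef ϑ n i I = coef ϑ' n i I := by
  have := startIdx_le n I
  unfold coef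
  rw [h (startIdx n I - 1) (by omega)]
  congr 1
  refine Finset.sum_congr rfl fun l hl => ?_
  rw [Finset.mem_Icc] at hl
  rw [h l hl.2, h (l - 1) (by omega)]

theorem meanCoef_congr {ϑ ϑ' : ℕ → ℝ} {n : ℕ} (h : ∀ l ≤ n, ϑ l = ϑ' l) (I : List ℕ) :
    meanCoef ϑ n I = meanCoef ϑ' n I := by
  have := startIdx_le n I
  unfold meanCoef
  rw [h (startIdx n I - 1) (by omega), h n le_rfl]

/-- The coefficients of the copy `(k, o)` of the interpolation: a part, which depends on `u`, of
each semicircular element is replaced by a fresh one. -/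
def coefCopy (S : Finset (List ℕ)) (θ : ℕ → ℝ) (u : ℝ) (k o : ℕ) (i : Fin d) (I : List ℕ) :
    ℕ × Fin d →₀ ℂ :=
  ((Real.exp (θ (startIdx (depth S) I - 1) / 2) : ℝ) : ℂ) •
    ∑ l ∈ Finset.Icc (startIdx (depth S) I) (depth S + 1),
      (((gap (min u (θ (l - 1))) (min u (θ l)) : ℝ) : ℂ) •
          Finsupp.single (lab (maxLabel S) k o (plusEntry S I l), i) 1 +
        ((gap (max u (θ (l - 1))) (max u (θ l)) : ℝ) : ℂ) •
          Finsupp.single (lab (maxLabel S) 0 o (plusEntry S I l), i) 1)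

/-- The times `θ` after the insertion of `u` at the place `s`. -/
def insertTime (θ : ℕ → ℝ) (u : ℝ) (s l : ℕ) : ℝ :=
  if l < s then θ l else if l = s then u else θ (l - 1)

theorem Icc_eq_Ico_succ (a b : ℕ) : Finset.Icc a b = Finset.Ico a (b + 1) := by
  ext; simp

/-- Each interval [θ_{l-1}, θ_l] is cut at u. Below place s the whole interval lies before u and
carries the label of copy k; above s it lies after u and keeps the common label 0; only interval s
is really cut, which is the repetition of the entry I_s in F_s. If the list starts after s, nothing
is cut and the positions merely move by one. -/
theorem coef_fCopy {S : Finset (List ℕ)} {θ : ℕ → ℝ} (hθ : Monotone θ) {u : ℝ} {s : ℕ}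
    (hs : 1 ≤ s) (hsn : s ≤ depth S + 1) (h1 : θ (s - 1) ≤ u) (h2 : u ≤ θ s) (k o : ℕ)
    {I : List ℕ} (hI : I ∈ S) (i : Fin d) :
    coef (insertTime θ u s) (depth S + 2) i (fCopy S s k o I) = coefCopy S θ u k o i I ∧
      meanCoef (insertTime θ u s) (depth S + 2) (fCopy S s k o I) =
        meanCoef θ (depth S + 1) (gPlus S I) := by
  have hd := length_le_depth hI
  have hm1 := one_le_startIdx hI
  have hmn := startIdx_le (depth S) I
  have hlG : (gPlus S I).length = depth S + 2 - startIdx (depth S) I := by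
    simp [gPlus, startIdx]; omega
  have hG : ∀ l (hml : startIdx (depth S) I ≤ l) (hl : l ≤ depth S + 1),
      (gPlus S I)[l - startIdx (depth S) I]'(by omega) = plusEntry S I l := by
    intro l hml hl
    exact (plusEntry_eq_getElem hI hml hl).2.symm
  have hlow : ∀ l, l < s → insertTime θ u s l = θ l := fun l hl => by simp [insertTime, hl]
  have hhigh : ∀ l, s < l → insertTime θ u s l = θ (l - 1) := fun l hl => by
    rw [insertTime, if_neg (by omega), if_neg (by omega)]
  have hmid : insertTime θ u s s = u := by simp [insertTime]
  have hlast : insertTime θ u s (depth S + 2) = θ (depth S + 1) := hhigh _ (by omega)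
  have hle : ∀ l, l < s → θ l ≤ u := fun l hl => (hθ (by omega)).trans h1
  have hge : ∀ l, s ≤ l → u ≤ θ l := fun l hl => h2.trans (hθ hl)
  set m := startIdx (depth S) I with hm
  by_cases hms : m ≤ s
  · have hf := fCopy_eq S s k o hI
    rw [if_pos hms, min_eq_left hsn] at hf
    have hlen : (fCopy S s k o I).length = depth S + 3 - m := by
      rw [hf]
      simp only [List.length_append, List.length_map, List.length_take, List.length_drop, hlG]
      omega
    have hst : startIdx (depth S + 2) (fCopy S s k o I) = m := by
      simp only [startIdx, hlen]; omega
    have hent1 : ∀ l, m ≤ l → l ≤ s → entry (depth S + 2) (fCopy S s k o I) l =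
        lab (maxLabel S) k o (plusEntry S I l) := by
      intro l hml hl
      rw [entry, hst, List.getD_eq_getElem _ _ (by omega)]
      simp only [hf]
      rw [List.getElem_append_left (by simp [hlG]; omega)]
      simp only [List.getElem_map, List.getElem_take]
      rw [hG l hml (by omega)]
    have hent2 : ∀ l, s ≤ l → l ≤ depth S + 1 → entry (depth S + 2) (fCopy S s k o I) (l + 1) =
        lab (maxLabel S) 0 o (plusEntry S I l) := by
      intro l hsl hl
      rw [entry, hst, List.getD_eq_getElem _ _ (by omega)]
      simp only [hf]
      rw [List.getElem_append_right (by simp [hlG]; omega)]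
      simp only [List.getElem_map, List.getElem_drop, List.length_map, List.length_take, hlG]
      rw [← hG l (by omega) hl]
      congr 2
      omega
    constructor
    · simp only [coef, coefCopy, hst, ← hm]
      rw [hlow (m - 1) (by omega)]
      congr 1
      rw [Finset.sum_add_distrib, Icc_eq_Ico_succ, Icc_eq_Ico_succ,
        ← Finset.sum_Ico_consecutive _ (show m ≤ s + 1 by omega)
          (show s + 1 ≤ depth S + 2 + 1 by omega), ← Finset.sum_Ico_add' _ s (depth S + 2) 1,
        ← Finset.sum_Ico_consecutive (fun l => ((gap (min u (θ (l - 1))) (min u (θ l)) : ℝ) : ℂ) •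
          Finsupp.single (lab (maxLabel S) k o (plusEntry S I l), i) (1 : ℂ))
          (show m ≤ s + 1 by omega) (show s + 1 ≤ depth S + 1 + 1 by omega),
        ← Finset.sum_Ico_consecutive (fun l => ((gap (max u (θ (l - 1))) (max u (θ l)) : ℝ) : ℂ) •
          Finsupp.single (lab (maxLabel S) 0 o (plusEntry S I l), i) (1 : ℂ))
          hms (show s ≤ depth S + 1 + 1 by omega)]
      -- Beyond s both endpoints are truncated to u, so the early part has length zero; `z2` is the
      -- same for the late part below s.
      have z1 : ∑ l ∈ Finset.Ico (s + 1) (depth S + 1 + 1),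
          ((gap (min u (θ (l - 1))) (min u (θ l)) : ℝ) : ℂ) •
            Finsupp.single (lab (maxLabel S) k o (plusEntry S I l), i) (1 : ℂ) = 0 := by
        refine Finset.sum_eq_zero fun l hl => ?_
        rw [Finset.mem_Ico] at hl
        rw [min_eq_left (hge _ (by omega)), min_eq_left (hge _ (by omega)), gap_self]
        simp
      have z2 : ∑ l ∈ Finset.Ico m s, ((gap (max u (θ (l - 1))) (max u (θ l)) : ℝ) : ℂ) •
            Finsupp.single (lab (maxLabel S) 0 o (plusEntry S I l), i) (1 : ℂ) = 0 := by
        refine Finset.sum_eq_zero fun l hl => ?_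
        rw [Finset.mem_Ico] at hl
        rw [max_eq_left (hle _ (by omega)), max_eq_left (hle _ (by omega)), gap_self]
        simp
      rw [z1, z2, add_zero, zero_add]
      congr 1
      · refine Finset.sum_congr rfl fun l hl => ?_
        rw [Finset.mem_Ico] at hl
        rw [hent1 l hl.1 (by omega), hlow (l - 1) (by omega), min_eq_right (hle (l - 1) (by omega))]
        rcases eq_or_lt_of_le (show l ≤ s by omega) with rfl | hls
        · rw [hmid, min_eq_left h2]
        · rw [hlow l hls, min_eq_right (hle l hls)]
      · refine Finset.sum_congr rfl fun l hl => ?_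
        rw [Finset.mem_Ico] at hl
        rw [hent2 l hl.1 (by omega), hhigh (l + 1) (by omega), max_eq_right (hge l hl.1),
          Nat.add_sub_cancel]
        rcases eq_or_lt_of_le hl.1 with rfl | hls
        · rw [hmid, max_eq_left h1]
        · rw [hhigh l hls, max_eq_right (hge _ (by omega))]
    · rw [meanCoef, meanCoef, hst, startIdx_gPlus, ← hm, hlow _ (by omega), hlast]
  · have hf := fCopy_eq S s k o hI
    rw [if_neg hms] at hf
    have hlen : (fCopy S s k o I).length = depth S + 2 - m := by
      rw [hf, List.length_map, hlG]
    have hst : startIdx (depth S + 2) (fCopy S s k o I) = m + 1 := by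
      simp only [startIdx, hlen]; omega
    have hent : ∀ l, m ≤ l → l ≤ depth S + 1 → entry (depth S + 2) (fCopy S s k o I) (l + 1) =
        lab (maxLabel S) 0 o (plusEntry S I l) := by
      intro l hsl hl
      rw [entry, hst, List.getD_eq_getElem _ _ (by omega)]
      simp only [hf, List.getElem_map, Nat.add_sub_add_right]
      rw [hG l hsl hl]
    -- The list now starts at m+1, but the time before it is again θ (m-1), because u was inserted
    -- earlier; the normalizing factor is unchanged.
    have e0 : insertTime θ u s (m + 1 - 1) = θ (m - 1) := by
      rw [Nat.add_sub_cancel, hhigh _ (by omega)]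
    constructor
    · simp only [coef, coefCopy, hst, ← hm]
      rw [e0]
      congr 1
      rw [Icc_eq_Ico_succ, Icc_eq_Ico_succ, ← Finset.sum_Ico_add' _ m (depth S + 2) 1]
      refine Finset.sum_congr rfl fun l hl => ?_
      rw [Finset.mem_Ico] at hl
      rw [hent l hl.1 (by omega), hhigh (l + 1) (by omega), Nat.add_sub_cancel, hhigh l (by omega),
        min_eq_left (hge _ (by omega)), min_eq_left (hge _ (by omega)), gap_self,
        max_eq_right (hge _ (by omega)), max_eq_right (hge _ (by omega))]
      simp
    · rw [meanCoef, meanCoef, hst, startIdx_gPlus, ← hm, e0, hlast]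

end Covariances

end

end MasterEquation

open MeasureTheory ProbabilityTheory
open scoped TensorProduct

namespace MasterEquation

noncomputable section

/-! ### Covariances of the copies, and their dependence on the splitting time u -/

section CovarianceOfCopies

variable {d : ℕ}

theorem dot_smul_left {ι : Type*} (c : ℂ) (a b : ι →₀ ℂ) : dot (c • a) b = c * dot a b := by
  simp [dot]

theorem dot_add_left {ι : Type*} (a a' b : ι →₀ ℂ) : dot (a + a') b = dot a b + dot a' b := by
  simp [dot]

theorem dot_sum_left {ι κ : Type*} (s : Finset κ) (a : κ → ι →₀ ℂ) (b : ι →₀ ℂ) :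
    dot (∑ z ∈ s, a z) b = ∑ z ∈ s, dot (a z) b := by
  simp [dot]

theorem dot_single_left {ι : Type*} (p : ι) (b : ι →₀ ℂ) :
    dot (Finsupp.single p 1) b = b p := by
  simp [dot]

theorem sum_double_ite {m m' n : ℕ} (f : ℕ → ℕ → ℂ) (g : ℕ → ℂ)
    (h : ∀ l l', m ≤ l → l ≤ n → m' ≤ l' → l' ≤ n → f l l' = if l = l' then g l else 0) :
    ∑ l ∈ Finset.Icc m n, ∑ l' ∈ Finset.Icc m' n, f l l' =
      ∑ l ∈ Finset.Icc (max m m') n, g l := by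
  have h1 : ∀ l ∈ Finset.Icc m n, ∑ l' ∈ Finset.Icc m' n, f l l' =
      if m' ≤ l then g l else 0 := by
    intro l hl
    rw [Finset.mem_Icc] at hl
    rw [Finset.sum_congr rfl fun l' hl' => h l l' hl.1 hl.2 (Finset.mem_Icc.1 hl').1
      (Finset.mem_Icc.1 hl').2, Finset.sum_ite_eq]
    simp [hl.2]
  rw [Finset.sum_congr rfl h1, ← Finset.sum_filter]
  refine Finset.sum_congr ?_ fun _ _ => rfl
  ext l; simp; omega

/-- The covariance of the copies `(1, o)` and `(2, o)` of the interpolation. -/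
def crossCov (S : Finset (List ℕ)) (θ : ℕ → ℝ) (u : ℝ) (v w : Fin d × List ℕ) : ℂ :=
  if v.1 = w.1 then
    ((Real.exp (θ (startIdx (depth S) v.2 - 1) / 2) *
        Real.exp (θ (startIdx (depth S) w.2 - 1) / 2) : ℝ) : ℂ) *
      ∑ l ∈ Finset.Icc (max (startIdx (depth S) v.2) (startIdx (depth S) w.2)) (depth S + 1),
        if plusEntry S v.2 l = plusEntry S w.2 l then
          ((Real.exp (-max u (θ (l - 1))) - Real.exp (-max u (θ l)) : ℝ) : ℂ) else 0
  else 0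

/-- By `lab_inj` and `plusEntry_inj`, only increments with the same interval, original label and
shift o can agree. For k = k' the early and late parts add up to the full covariance (that is, u =
0); for k ≠ k' only the late part, after u, is shared; different o share nothing. -/
theorem dot_coefCopy {S : Finset (List ℕ)} {slot : ℕ → ℕ} (hS : Slotted S slot) {θ : ℕ → ℝ}
    (hθ : Monotone θ) (h0 : θ 0 = 0) (u : ℝ) {k o k' o' : ℕ} (hk : k ≤ 2) (hk1 : 1 ≤ k)
    (hk' : k' ≤ 2) (hk1' : 1 ≤ k') (ho : o ≤ 1) (ho' : o' ≤ 1) {I J : List ℕ} (hI : I ∈ S)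
    (hJ : J ∈ S) (i j : Fin d) :
    dot (coefCopy S θ u k o i I) (coefCopy S θ u k' o' j J) =
      if o = o' then if k = k' then crossCov S θ 0 (i, I) (j, J)
        else crossCov S θ u (i, I) (j, J) else 0 := by
  have hθ0 : ∀ l, 0 ≤ θ l := fun l => h0 ▸ hθ (Nat.zero_le l)
  have key : dot (coefCopy S θ u k o i I) (coefCopy S θ u k' o' j J) =
      ((Real.exp (θ (startIdx (depth S) I - 1) / 2) : ℝ) : ℂ) *
        ((Real.exp (θ (startIdx (depth S) J - 1) / 2) : ℝ) : ℂ) *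
      ∑ l ∈ Finset.Icc (startIdx (depth S) I) (depth S + 1),
        ∑ l' ∈ Finset.Icc (startIdx (depth S) J) (depth S + 1),
        (((gap (min u (θ (l - 1))) (min u (θ l)) : ℝ) : ℂ) *
          ((gap (min u (θ (l' - 1))) (min u (θ l')) : ℝ) : ℂ) *
            (if (lab (maxLabel S) k' o' (plusEntry S J l'), j) =
              (lab (maxLabel S) k o (plusEntry S I l), i) then 1 else 0) +
        ((gap (min u (θ (l - 1))) (min u (θ l)) : ℝ) : ℂ) *
          ((gap (max u (θ (l' - 1))) (max u (θ l')) : ℝ) : ℂ) *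
            (if (lab (maxLabel S) 0 o' (plusEntry S J l'), j) =
              (lab (maxLabel S) k o (plusEntry S I l), i) then 1 else 0) +
        ((gap (max u (θ (l - 1))) (max u (θ l)) : ℝ) : ℂ) *
          ((gap (min u (θ (l' - 1))) (min u (θ l')) : ℝ) : ℂ) *
            (if (lab (maxLabel S) k' o' (plusEntry S J l'), j) =
              (lab (maxLabel S) 0 o (plusEntry S I l), i) then 1 else 0) +
        ((gap (max u (θ (l - 1))) (max u (θ l)) : ℝ) : ℂ) *
          ((gap (max u (θ (l' - 1))) (max u (θ l')) : ℝ) : ℂ) *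
            (if (lab (maxLabel S) 0 o' (plusEntry S J l'), j) =
              (lab (maxLabel S) 0 o (plusEntry S I l), i) then 1 else 0)) := by
    rw [coefCopy, dot_smul_left, dot_sum_left, mul_assoc]
    congr 1
    rw [Finset.mul_sum]
    refine Finset.sum_congr rfl fun l _ => ?_
    rw [dot_add_left, dot_smul_left, dot_smul_left, dot_single_left, dot_single_left, coefCopy]
    simp only [Finsupp.smul_apply, Finsupp.finsetSum_apply, Finsupp.add_apply, smul_eq_mul,
      Finsupp.single_apply, Finset.mul_sum, ← Finset.sum_add_distrib]
    refine Finset.sum_congr rfl fun l' _ => ?_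
    ring
  rw [key, sum_double_ite _ (fun l => if i = j ∧ o = o' ∧ plusEntry S I l = plusEntry S J l then
    ((if k = k' then (((gap (min u (θ (l - 1))) (min u (θ l)) : ℝ) : ℂ) *
      ((gap (min u (θ (l - 1))) (min u (θ l)) : ℝ) : ℂ)) else 0) +
      ((gap (max u (θ (l - 1))) (max u (θ l)) : ℝ) : ℂ) *
      ((gap (max u (θ (l - 1))) (max u (θ l)) : ℝ) : ℂ)) else 0)]
  · have hsq : ∀ l, ((gap (max u (θ (l - 1))) (max u (θ l)) : ℝ) : ℂ) *
        ((gap (max u (θ (l - 1))) (max u (θ l)) : ℝ) : ℂ) =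
        ((Real.exp (-max u (θ (l - 1))) - Real.exp (-max u (θ l)) : ℝ) : ℂ) := fun l => by
      rw [← Complex.ofReal_mul, gap_mul_gap (max_le_max le_rfl (hθ (by omega)))]
    have hsq' : ∀ l, ((gap (min u (θ (l - 1))) (min u (θ l)) : ℝ) : ℂ) *
        ((gap (min u (θ (l - 1))) (min u (θ l)) : ℝ) : ℂ) =
        ((Real.exp (-min u (θ (l - 1))) - Real.exp (-min u (θ l)) : ℝ) : ℂ) := fun l => by
      rw [← Complex.ofReal_mul, gap_mul_gap (min_le_min le_rfl (hθ (by omega)))]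
    -- Since min and max exhaust the two arguments, the early and late lengths add up to the length
    -- of the uncut interval.
    have hmm : ∀ a b : ℝ, Real.exp (-min a b) + Real.exp (-max a b) =
        Real.exp (-a) + Real.exp (-b) := by
      intro a b
      rcases le_total a b with h | h
      · rw [min_eq_left h, max_eq_right h]
      · rw [min_eq_right h, max_eq_left h, add_comm]
    simp only [hsq, hsq', crossCov]
    by_cases hij : i = j
    swap
    · simp [hij]
    by_cases hoo : o = o'
    swap
    · simp [hoo]
    simp only [hij, hoo, true_and, if_true, Complex.ofReal_mul]
    split_ifs with hkk
    · congr 1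
      refine Finset.sum_congr rfl fun l _ => ?_
      congr 1
      rw [max_eq_right (hθ0 _), max_eq_right (hθ0 _), ← Complex.ofReal_add]
      congr 1
      linarith [hmm u (θ l), hmm u (θ (l - 1))]
    · simp only [zero_add]
  · intro l l' hl hln hl' hln'
    obtain ⟨b1, b2⟩ := plusEntry_bounds hS hI hl hln
    obtain ⟨b1', b2'⟩ := plusEntry_bounds hS hJ hl' hln'
    simp only [Prod.mk.injEq, lab_inj hk' hk ho' ho b1' b2' b1 b2,
      lab_inj hk' (Nat.zero_le 2) ho' ho b1' b2' b1 b2,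
      lab_inj (Nat.zero_le 2) hk ho' ho b1' b2' b1 b2,
      lab_inj (Nat.zero_le 2) (Nat.zero_le 2) ho' ho b1' b2' b1 b2]
    have n1 : ¬ k' = 0 := by omega
    have n2 : ¬ 0 = k := by omega
    simp only [n1, n2, false_and, if_false, mul_zero, add_zero, true_and]
    by_cases hll : l = l'
    · subst hll
      simp only [if_true]
      by_cases hc : i = j ∧ o = o' ∧ plusEntry S I l = plusEntry S J l
      · obtain ⟨rfl, rfl, hE⟩ := hc
        by_cases hkk : k = k'
        · subst hkk
          simp [hE]
        · simp [hE, hkk, Ne.symm hkk]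
      · rw [if_neg hc, if_neg (fun h => hc ⟨h.2.symm, h.1.2.1.symm, h.1.2.2.symm⟩),
          if_neg (fun h => hc ⟨h.2.symm, h.1.1.symm, h.1.2.symm⟩)]
        simp
    · rw [if_neg hll, if_neg, if_neg]
      · simp
      · exact fun h => hll (plusEntry_inj hS hI hJ hl hln hl' hln' h.1.2.symm)
      · exact fun h => hll (plusEntry_inj hS hI hJ hl hln hl' hln' h.1.2.2.symm)

/-- The once-extended interpolation has the covariance of a single copy, hence the same moments as
each of the copies. -/
theorem dot_coef_gPlus {S : Finset (List ℕ)} {slot : ℕ → ℕ} (hS : Slotted S slot) {θ : ℕ → ℝ}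
    (hθ : Monotone θ) (h0 : θ 0 = 0) {I J : List ℕ} (hI : I ∈ S) (hJ : J ∈ S) (i j : Fin d) :
    dot (coef θ (depth S + 1) i (gPlus S I)) (coef θ (depth S + 1) j (gPlus S J)) =
      crossCov S θ 0 (i, I) (j, J) := by
  have hθ0 : ∀ l, 0 ≤ θ l := fun l => h0 ▸ hθ (Nat.zero_le l)
  have key : dot (coef θ (depth S + 1) i (gPlus S I)) (coef θ (depth S + 1) j (gPlus S J)) =
      ((Real.exp (θ (startIdx (depth S) I - 1) / 2) : ℝ) : ℂ) *
        ((Real.exp (θ (startIdx (depth S) J - 1) / 2) : ℝ) : ℂ) *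
      ∑ l ∈ Finset.Icc (startIdx (depth S) I) (depth S + 1),
        ∑ l' ∈ Finset.Icc (startIdx (depth S) J) (depth S + 1),
        (((gap (θ (l - 1)) (θ l) : ℝ) : ℂ) * ((gap (θ (l' - 1)) (θ l') : ℝ) : ℂ) *
            (if (plusEntry S J l', j) = (plusEntry S I l, i) then 1 else 0)) := by
    rw [coef, dot_smul_left, dot_sum_left, mul_assoc, startIdx_gPlus]
    congr 1
    rw [Finset.mul_sum]
    refine Finset.sum_congr rfl fun l _ => ?_
    rw [dot_smul_left, dot_single_left, coef, startIdx_gPlus]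
    simp only [Finsupp.smul_apply, Finsupp.finsetSum_apply, smul_eq_mul,
      Finsupp.single_apply, Finset.mul_sum, plusEntry]
    refine Finset.sum_congr rfl fun l' _ => ?_
    ring_nf
  rw [key, sum_double_ite _ (fun l => if i = j ∧ plusEntry S I l = plusEntry S J l then
    (((gap (θ (l - 1)) (θ l) : ℝ) : ℂ) * ((gap (θ (l - 1)) (θ l) : ℝ) : ℂ)) else 0)]
  · simp only [crossCov]
    by_cases hij : i = j
    · simp only [hij, true_and, if_true, Complex.ofReal_mul]
      congr 1
      refine Finset.sum_congr rfl fun l _ => ?_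
      congr 1
      rw [max_eq_right (hθ0 _), max_eq_right (hθ0 _), ← Complex.ofReal_mul,
        gap_mul_gap (hθ (by omega))]
    · simp [hij]
  · intro l l' hl hln hl' hln'
    simp only [Prod.mk.injEq]
    by_cases hll : l = l'
    · subst hll
      simp only [if_true, mul_ite, mul_one, mul_zero]
      refine if_congr ?_ rfl rfl
      tauto
    · rw [if_neg hll, if_neg]
      · simp
      · exact fun h => hll (plusEntry_inj hS hI hJ hl hln hl' hln' h.1.symm)

/-- Once u is beyond all the times, no increment after u is left to share. -/
theorem crossCov_eq_zero {S : Finset (List ℕ)} {θ : ℕ → ℝ} {u : ℝ}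
    (hu : ∀ l ≤ depth S + 1, θ l ≤ u) (v w : Fin d × List ℕ) : crossCov S θ u v w = 0 := by
  unfold crossCov
  rw [Finset.sum_eq_zero]
  · simp
  · intro l hl
    rw [Finset.mem_Icc] at hl
    rw [max_eq_left (hu _ (by omega)), max_eq_left (hu _ (by omega))]
    simp

/-- The derivative of the covariance for `θ (s - 1) < u < θ s`. -/
theorem hasDerivAt_crossCov {S : Finset (List ℕ)} {θ : ℕ → ℝ} (hθ : Monotone θ) {u : ℝ} {s : ℕ}
    (hs : 1 ≤ s) (hsn : s ≤ depth S + 1) (h1 : θ (s - 1) < u) (h2 : u < θ s)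
    (v w : Fin d × List ℕ) : HasDerivAt (fun u => crossCov S θ u v w)
      (if v.1 = w.1 ∧ startIdx (depth S) v.2 ≤ s ∧ startIdx (depth S) w.2 ≤ s ∧
          plusEntry S v.2 s = plusEntry S w.2 s then
        -((Real.exp ((θ (startIdx (depth S) v.2 - 1) + θ (startIdx (depth S) w.2 - 1)) / 2 - u) :
          ℝ) : ℂ) else 0) u := by
  unfold crossCov
  by_cases hvw : v.1 = w.1
  swap
  · simp only [hvw, if_false, false_and]
    exact hasDerivAt_const _ _
  simp only [hvw, if_true, true_and]
  have hlow : ∀ l, l < s → (fun u' => max u' (θ l)) =ᶠ[nhds u] id := fun l hl => by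
    have : θ l < u := (hθ (by omega)).trans_lt h1
    filter_upwards [lt_mem_nhds this] with u' hu'
    exact max_eq_left hu'.le
  have hhigh : ∀ l, s ≤ l → (fun u' => max u' (θ l)) =ᶠ[nhds u] fun _ => θ l := fun l hl => by
    have : u < θ l := h2.trans_le (hθ hl)
    filter_upwards [gt_mem_nhds this] with u' hu'
    exact max_eq_right hu'.le
  have hexp : HasDerivAt (fun u' : ℝ => ((Real.exp (-u') : ℝ) : ℂ)) (-(Real.exp (-u) : ℝ) : ℂ) u := by
    have := ((hasDerivAt_neg u).exp).ofReal_comp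
    simpa using this
  -- Only interval s contains u. Intervals before it contribute zero near u, and later ones
  -- contribute their full length, which is constant.
  have hterm : ∀ l ∈ Finset.Icc (max (startIdx (depth S) v.2) (startIdx (depth S) w.2))
      (depth S + 1), HasDerivAt (fun u' => if plusEntry S v.2 l = plusEntry S w.2 l then
          ((Real.exp (-max u' (θ (l - 1))) - Real.exp (-max u' (θ l)) : ℝ) : ℂ) else 0)
        (if l = s then (if plusEntry S v.2 s = plusEntry S w.2 s then
          (-(Real.exp (-u) : ℝ) : ℂ) else 0) else 0) u := by
    intro l hl
    by_cases hE : plusEntry S v.2 l = plusEntry S w.2 l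
    swap
    · simp only [if_neg hE]
      rcases eq_or_ne l s with rfl | hls
      · simp only [hE, if_false, if_true]; exact hasDerivAt_const _ _
      · simp only [hls, if_false]; exact hasDerivAt_const _ _
    simp only [hE, if_true]
    rcases lt_trichotomy l s with hls | rfl | hls
    · rw [if_neg hls.ne]
      refine (hasDerivAt_const u (0 : ℂ)).congr_of_eventuallyEq ?_
      filter_upwards [hlow l hls, hlow (l - 1) (by omega)] with u' a b
      simp only [a, b]; simp
    · simp only [if_true, hE]
      have := hexp.sub_const ((Real.exp (-θ l) : ℝ) : ℂ)
      refine this.congr_of_eventuallyEq ?_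
      filter_upwards [hhigh l le_rfl, hlow (l - 1) (by omega)] with u' a b
      simp only [a, b]; simp
    · rw [if_neg hls.ne']
      refine (hasDerivAt_const u ((Real.exp (-θ (l - 1)) - Real.exp (-θ l) : ℝ) : ℂ)).congr_of_eventuallyEq ?_
      filter_upwards [hhigh l hls.le, hhigh (l - 1) (by omega)] with u' a b
      simp only [a, b]
  refine ((HasDerivAt.fun_sum hterm).const_mul _).congr_deriv ?_
  rw [Finset.sum_ite_eq']
  simp only [Finset.mem_Icc, max_le_iff]
  by_cases hc : startIdx (depth S) v.2 ≤ s ∧ startIdx (depth S) w.2 ≤ s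
  · rw [if_pos ⟨hc, hsn⟩]
    simp only [hc, true_and]
    split_ifs
    · rw [sub_eq_add_neg, Real.exp_add, add_div, Real.exp_add]
      push_cast
      ring_nf
    · simp
  · rw [if_neg (fun h => hc h.1), if_neg (fun h => hc ⟨h.1, h.2.1⟩)]
    simp

end CovarianceOfCopies

end

end MasterEquation

open MeasureTheory ProbabilityTheory
open scoped TensorProduct

namespace MasterEquation

noncomputable section

/-! ## Four copies of a family of affine combinations of semicircular elements -/

section Copies

variable {A : Type*} [CStarAlgebra A] {N d : ℕ} {τ : A →L[ℂ] ℂ} {Y : Type*}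
  {x : ℕ → Fin d → Matrix (Fin N) (Fin N) A}

/-- The covariance of the copies: two copies are either equal, or partially correlated, or
independent. -/
def copyCov (N : ℕ) (K₀ K : Y → Y → ℂ) :
    (Y × Bool × Bool) ⊕ (Fin N × Fin N) → (Y × Bool × Bool) ⊕ (Fin N × Fin N) → ℂ
  | .inl a, .inl b => if a.2.2 = b.2.2 then if a.2.1 = b.2.1 then K₀ a.1 b.1 else K a.1 b.1 else 0
  | _, _ => 0

/-- The means of the copies; the remaining letters are the matrix units. -/
def copyMean (m : Y → Matrix (Fin N) (Fin N) ℂ) :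
    (Y × Bool × Bool) ⊕ (Fin N × Fin N) → Matrix (Fin N) (Fin N) ℂ
  | .inl a => m a.1
  | .inr p => Matrix.single p.1 p.2 1

/-- A copy of a word. -/
def copyWord (N : ℕ) (k o : Bool) (w : List Y) : List ((Y × Bool × Bool) ⊕ (Fin N × Fin N)) :=
  w.map fun v => Sum.inl (v, k, o)

/-- The moments `(1/N) ∑ τ_N(E_{rs} w₁ E_{sr} w₂)` for partially correlated copies. -/
def mixedMom (K₀ K : Y → Y → ℂ) (m : Y → Matrix (Fin N) (Fin N) ℂ) (w₁ w₂ : List Y) : ℂ :=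
  (1 / (N : ℂ)) * ∑ p : Fin N × Fin N, ntr N (mom (copyCov N K₀ K) (copyMean m)
    (Sum.inr p :: (copyWord N false false w₁ ++ Sum.inr p.swap :: copyWord N true false w₂)))

/-- The coefficients of the letters. -/
def letterVal (N : ℕ) (f : Bool → Bool → Y → ℕ × Fin d →₀ ℂ)
    (m : Y → Matrix (Fin N) (Fin N) ℂ) :
    (Y × Bool × Bool) ⊕ (Fin N × Fin N) → (ℕ × Fin d →₀ ℂ) × Matrix (Fin N) (Fin N) ℂ
  | .inl a => (f a.2.1 a.2.2 a.1, m a.1)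
  | .inr p => (0, Matrix.single p.1 p.2 1)

/-- `f` consists of four copies with covariances `K₀` and `K`. -/
def IsCopies (K₀ K : Y → Y → ℂ) (f : Bool → Bool → Y → ℕ × Fin d →₀ ℂ) : Prop :=
  ∀ k o v k' o' w, dot (f k o v) (f k' o' w) =
    if o = o' then if k = k' then K₀ v w else K v w else 0

/-- Moments depend only on covariances and means, so the actual labels may be replaced by the
abstract table `copyCov`; the matrix units are letters with zero covariance. -/
theorem entryMean_copies (hτ : IsTrace τ) (hN : 1 ≤ N) (hx : IsFreeSemicircularSequence N τ x)
    {K₀ K : Y → Y → ℂ} {f : Bool → Bool → Y → ℕ × Fin d →₀ ℂ} (hf : IsCopies K₀ K f)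
    (m : Y → Matrix (Fin N) (Fin N) ℂ) (W : List ((Y × Bool × Bool) ⊕ (Fin N × Fin N))) :
    entryMean N τ (W.map fun a => affVal x (letterVal N f m a)).prod =
      mom (copyCov N K₀ K) (copyMean m) W := by
  have h := entryMean_prod_affVal hτ hN hx (W.map (letterVal N f m))
  rw [List.map_map, mom_map] at h
  refine h.trans (mom_congr (fun a _ b _ => ?_) fun a _ => ?_)
  · rcases a with a | p <;> rcases b with b | q <;>
      simp only [letterVal, copyCov, dot_zero_left, dot_zero_right]
    exact hf _ _ _ _ _ _
  · rcases a with a | p <;> rfl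

/-- Cyclic invariance is not visible in the recursion of `mom`, which treats the first letter
specially; it is inherited from the trace τ_N through a realization of the copies. -/
theorem ntr_mom_comm (hτ : IsTrace τ) (hN : 1 ≤ N) (hx : IsFreeSemicircularSequence N τ x)
    {K₀ K : Y → Y → ℂ} {f : Bool → Bool → Y → ℕ × Fin d →₀ ℂ} (hf : IsCopies K₀ K f)
    (m : Y → Matrix (Fin N) (Fin N) ℂ) (W W' : List ((Y × Bool × Bool) ⊕ (Fin N × Fin N))) :
    ntr N (mom (copyCov N K₀ K) (copyMean m) (W ++ W')) =
      ntr N (mom (copyCov N K₀ K) (copyMean m) (W' ++ W)) := by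
  rw [← entryMean_copies hτ hN hx hf m, ← entryMean_copies hτ hN hx hf m, ← traceN_eq,
    ← traceN_eq, List.map_append, List.map_append, List.prod_append, List.prod_append,
    traceN_mul_comm hτ]

/-- `A ⊗ B ↦ (1/N) ∑ τ_N(E_{rs} A(Z) E_{sr} B(Z'))`. -/
def mixedContraction (τ : A →L[ℂ] ℂ) (Z Z' : Y → Matrix (Fin N) (Fin N) A) :
    FreeAlgebra ℂ Y ⊗[ℂ] FreeAlgebra ℂ Y →ₗ[ℂ] ℂ :=
  (1 / (N : ℂ)) • ∑ p : Fin N × Fin N, traceN N τ ∘ₗ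
    LinearMap.mulLeft ℂ (matEmb A N (Matrix.single p.1 p.2 1)) ∘ₗ
      LinearMap.mul' ℂ (Matrix (Fin N) (Fin N) A) ∘ₗ TensorProduct.map
        (LinearMap.mulRight ℂ (matEmb A N (Matrix.single p.2 p.1 1)) ∘ₗ
          (FreeAlgebra.lift ℂ Z).toLinearMap)
        (FreeAlgebra.lift ℂ Z').toLinearMap

theorem mixedContraction_self (τ : A →L[ℂ] ℂ) (Z : Y → Matrix (Fin N) (Fin N) A) :
    mixedContraction τ Z Z = contraction τ Z := rfl

theorem mixedContraction_word (hτ : IsTrace τ) (hN : 1 ≤ N)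
    (hx : IsFreeSemicircularSequence N τ x) {K₀ K : Y → Y → ℂ}
    {f : Bool → Y → ℕ × Fin d →₀ ℂ}
    (hf : ∀ k k' v w, dot (f k v) (f k' w) = if k = k' then K₀ v w else K v w)
    (m : Y → Matrix (Fin N) (Fin N) ℂ) (w₁ w₂ : List Y) :
    mixedContraction τ (fun v => affVal x (f false v, m v)) (fun v => affVal x (f true v, m v))
      (word w₁ ⊗ₜ word w₂) = mixedMom K₀ K m w₁ w₂ := by
  simp only [mixedContraction, mixedMom, LinearMap.smul_apply, LinearMap.sum_apply,
    LinearMap.comp_apply, TensorProduct.map_tmul, LinearMap.mul'_apply, LinearMap.mulLeft_apply,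
    LinearMap.mulRight_apply, AlgHom.toLinearMap_apply, lift_word, smul_eq_mul]
  congr 1
  refine Finset.sum_congr rfl fun p _ => ?_
  have h := entryMean_prod_affVal hτ hN hx ((Sum.inr p :: (copyWord N false false w₁ ++
    Sum.inr p.swap :: copyWord N true false w₂)).map (letterVal N (fun k _ => f k) m))
  rw [mom_map] at h
  rw [traceN_eq]
  congr 1
  refine Eq.trans ?_ (h.trans (mom_congr (fun a ha b hb => ?_) fun a _ => ?_))
  · simp only [copyWord, List.map_cons, List.map_append, List.map_map, List.prod_cons,
      List.prod_append, letterVal, affVal_const, mul_assoc]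
    rfl
  · have key : ∀ a ∈ (Sum.inr p :: (copyWord N false false w₁ ++
        Sum.inr p.swap :: copyWord N true false w₂) : List ((Y × Bool × Bool) ⊕ (Fin N × Fin N))),
        ∀ v, a = Sum.inl v → v.2.2 = false := by
      rintro a ha v rfl
      simp only [copyWord, List.mem_cons, List.mem_append, List.mem_map, reduceCtorEq,
        false_or, Sum.inl.injEq] at ha
      rcases ha with ⟨_, _, rfl⟩ | ⟨_, _, rfl⟩ <;> rfl
    rcases a with a | p <;> rcases b with b | q <;>
      simp only [letterVal, copyCov, dot_zero_left, dot_zero_right, hf]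
    rw [key _ ha a rfl, key _ hb b rfl, if_pos rfl]
  · rcases a with a | p <;> rfl

theorem mom_copyWord (K₀ K : Y → Y → ℂ) (m : Y → Matrix (Fin N) (Fin N) ℂ) (k o : Bool)
    (w : List Y) : mom (copyCov N K₀ K) (copyMean m) (copyWord N k o w) = mom K₀ m w := by
  rw [copyWord, mom_map]
  simp [copyCov, copyMean]

theorem ntr_single_mul (r s : Fin N) (k : Matrix (Fin N) (Fin N) ℂ) :
    ntr N (Matrix.single r s 1 * k) = (1 / (N : ℂ)) * k s r := by
  rw [ntr_apply, Matrix.trace_single_mul, one_smul]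

theorem mom_unit_cons (K₀ K : Y → Y → ℂ) (m : Y → Matrix (Fin N) (Fin N) ℂ) (p : Fin N × Fin N)
    (W : List ((Y × Bool × Bool) ⊕ (Fin N × Fin N))) :
    mom (copyCov N K₀ K) (copyMean m) (Sum.inr p :: W) =
      Matrix.single p.1 p.2 1 * mom (copyCov N K₀ K) (copyMean m) W :=
  mom_const_cons (fun a => by cases a <;> rfl) W

/-- For independent copies the moments factorize. -/
theorem mixedMom_zero (K₀ : Y → Y → ℂ) (m : Y → Matrix (Fin N) (Fin N) ℂ)
    (w₁ w₂ : List Y) : mixedMom K₀ 0 m w₁ w₂ = ntr N (mom K₀ m w₁) * ntr N (mom K₀ m w₂) := by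
  have h : ∀ p : Fin N × Fin N, ntr N (mom (copyCov N K₀ 0) (copyMean m)
      (Sum.inr p :: (copyWord N false false w₁ ++ Sum.inr p.swap :: copyWord N true false w₂))) =
      (1 / (N : ℂ)) * (mom K₀ m w₁ p.2 p.2 * mom K₀ m w₂ p.1 p.1) := by
    intro p
    rw [mom_unit_cons, ntr_single_mul, mom_append, mom_unit_cons, mom_copyWord, mom_copyWord]
    · congr 1
      simp [Matrix.mul_apply, Matrix.single_apply, ite_and]
    · intro a ha b hb
      obtain ⟨v, _, rfl⟩ := List.mem_map.1 ha
      rcases List.mem_cons.1 hb with rfl | hb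
      · rfl
      · obtain ⟨v', _, rfl⟩ := List.mem_map.1 hb
        simp [copyCov]
  simp only [mixedMom, h]
  rw [Fintype.sum_prod_type, ntr_apply, ntr_apply, Matrix.trace, Matrix.trace]
  simp only [Matrix.diag, ← Finset.mul_sum]
  rw [Finset.sum_congr rfl fun r _ => by rw [← Finset.sum_mul]]
  rw [← Finset.mul_sum]
  ring

/-- `(A ⊗ B) ⊗ (C ⊗ D) ↦ τ_N(B A D C)` for the copies `Z`. -/
def fourfold (τ : A →L[ℂ] ℂ) (Z : Bool → Bool → Y → Matrix (Fin N) (Fin N) A) :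
    (FreeAlgebra ℂ Y ⊗[ℂ] FreeAlgebra ℂ Y) ⊗[ℂ] (FreeAlgebra ℂ Y ⊗[ℂ] FreeAlgebra ℂ Y) →ₗ[ℂ] ℂ :=
  traceN N τ ∘ₗ LinearMap.mul' ℂ (Matrix (Fin N) (Fin N) A) ∘ₗ TensorProduct.map
    (mulOp ∘ₗ TensorProduct.map (FreeAlgebra.lift ℂ (Z false true)).toLinearMap
      (FreeAlgebra.lift ℂ (Z false false)).toLinearMap)
    (mulOp ∘ₗ TensorProduct.map (FreeAlgebra.lift ℂ (Z true false)).toLinearMap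
      (FreeAlgebra.lift ℂ (Z true true)).toLinearMap)

theorem fourfold_tmul (τ : A →L[ℂ] ℂ) (Z : Bool → Bool → Y → Matrix (Fin N) (Fin N) A)
    (P Q R T : FreeAlgebra ℂ Y) : fourfold τ Z ((P ⊗ₜ Q) ⊗ₜ (R ⊗ₜ T)) =
      traceN N τ (FreeAlgebra.lift ℂ (Z false false) Q * FreeAlgebra.lift ℂ (Z false true) P *
        (FreeAlgebra.lift ℂ (Z true true) T * FreeAlgebra.lift ℂ (Z true false) R)) := rfl

/-- Each of the two traces contains one matrix unit and so is 1/N times an entry of a moment.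
Summation over r, s multiplies the two moment matrices under a trace, contributing a factor N, which
with the prefactor 1/N leaves 1/N². To merge the product into one moment, one factor is read in an
independent pair of copies, and the trace is rotated to the order V, U, Q, P of Θ. -/
theorem sum_ntr_mom (hτ : IsTrace τ) (hN : 1 ≤ N) (hx : IsFreeSemicircularSequence N τ x)
    {K₀ K : Y → Y → ℂ} {f : Bool → Bool → Y → ℕ × Fin d →₀ ℂ} (hf : IsCopies K₀ K f)
    (m : Y → Matrix (Fin N) (Fin N) ℂ) (U V P Q : List Y) :
    (1 / (N : ℂ)) * ∑ p : Fin N × Fin N,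
      ntr N (mom (copyCov N K₀ K) (copyMean m) (copyWord N false false V ++
        Sum.inr p.swap :: copyWord N true false P)) *
      ntr N (mom (copyCov N K₀ K) (copyMean m) (Sum.inr p :: (copyWord N false false U ++
        copyWord N true false Q))) =
    (1 / (N : ℂ) ^ 2) * fourfold τ (fun k o v => affVal x (f k o v, m v))
      ((word U ⊗ₜ word V) ⊗ₜ (word P ⊗ₜ word Q)) := by
  set C := copyCov N K₀ K with hC
  set μ := copyMean m with hμ
  have h1 : ∀ p : Fin N × Fin N,
      ntr N (mom C μ (copyWord N false false V ++ Sum.inr p.swap :: copyWord N true false P)) *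
      ntr N (mom C μ (Sum.inr p :: (copyWord N false false U ++ copyWord N true false Q))) =
      (1 / (N : ℂ)) ^ 2 * (mom C μ (copyWord N true false P ++ copyWord N false false V) p.1 p.2 *
        mom C μ (copyWord N false false U ++ copyWord N true false Q) p.2 p.1) := by
    intro p
    rw [ntr_mom_comm hτ hN hx hf, List.cons_append, mom_unit_cons, mom_unit_cons, ntr_single_mul,
      ntr_single_mul]
    simp only [Prod.fst_swap, Prod.snd_swap, hC, hμ]
    ring
  -- The pair of copies with the other shift has the same covariances, hence the same moments.
  have h2 : mom C μ (copyWord N false false U ++ copyWord N true false Q) =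
      mom C μ (copyWord N false true U ++ copyWord N true true Q) := by
    have e : ∀ o, mom C μ (copyWord N false o U ++ copyWord N true o Q) =
        mom (fun a b : Y × Bool => if a.2 = b.2 then K₀ a.1 b.1 else K a.1 b.1) (fun a => m a.1)
          (U.map (fun v => (v, false)) ++ Q.map fun v => (v, true)) := by
      intro o
      have : copyWord N false o U ++ copyWord N true o Q =
          (U.map (fun v => (v, false)) ++ Q.map fun v => (v, true)).map
            (fun a => (Sum.inl (a.1, a.2, o) : (Y × Bool × Bool) ⊕ (Fin N × Fin N))) := by
        simp only [copyWord, List.map_append, List.map_map]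
        rfl
      rw [this, mom_map]
      simp [hC, hμ, copyCov, copyMean]
    rw [e, e]
  -- Different shifts are uncorrelated, so the product of the moments is the moment of the
  -- concatenated word.
  have h3 : mom C μ (copyWord N true false P ++ copyWord N false false V) *
      mom C μ (copyWord N false true U ++ copyWord N true true Q) =
      mom C μ ((copyWord N true false P ++ copyWord N false false V) ++
        (copyWord N false true U ++ copyWord N true true Q)) := by
    refine (mom_append fun a ha b hb => ?_).symm
    have ha' : ∃ v, a = Sum.inl v ∧ v.2.2 = false := by
      rcases List.mem_append.1 ha with h | h <;> obtain ⟨v, _, rfl⟩ := List.mem_map.1 h <;>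
        exact ⟨_, rfl, rfl⟩
    have hb' : ∃ v, b = Sum.inl v ∧ v.2.2 = true := by
      rcases List.mem_append.1 hb with h | h <;> obtain ⟨v, _, rfl⟩ := List.mem_map.1 h <;>
        exact ⟨_, rfl, rfl⟩
    obtain ⟨v, rfl, hv⟩ := ha'
    obtain ⟨w, rfl, hw⟩ := hb'
    simp [hC, copyCov, hv, hw]
  simp only [h1, ← Finset.mul_sum]
  rw [h2, Fintype.sum_prod_type]
  have h4 : ∑ r, ∑ s, mom C μ (copyWord N true false P ++ copyWord N false false V) r s *
      mom C μ (copyWord N false true U ++ copyWord N true true Q) s r =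
      (N : ℂ) * ntr N (mom C μ (copyWord N true false P ++ copyWord N false false V) *
        mom C μ (copyWord N false true U ++ copyWord N true true Q)) := by
    have hN0 : (N : ℂ) ≠ 0 := by exact_mod_cast (by omega : N ≠ 0)
    rw [ntr_apply, ← mul_assoc, mul_one_div_cancel hN0, one_mul]
    simp [Matrix.trace, Matrix.mul_apply]
  have h5 : fourfold τ (fun k o v => affVal x (f k o v, m v))
      ((word U ⊗ₜ word V) ⊗ₜ (word P ⊗ₜ word Q)) =
      ntr N (mom C μ ((copyWord N false false V ++ copyWord N false true U ++
        copyWord N true true Q) ++ copyWord N true false P)) := by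
    rw [← entryMean_copies hτ hN hx hf m, ← traceN_eq, fourfold_tmul]
    simp only [lift_word, copyWord, List.map_append, List.map_map, List.prod_append, mul_assoc]
    rfl
  rw [h4, h3, h5, ntr_mom_comm hτ hN hx hf m _ (copyWord N true false P)]
  simp only [List.append_assoc]
  have hN0 : (N : ℂ) ≠ 0 := by exact_mod_cast (by omega : N ≠ 0)
  field_simp
  rfl

/-- The evolution of the moments of partially correlated copies. -/
theorem hasDerivAt_mixedMom [Fintype Y] [DecidableEq Y] (hτ : IsTrace τ) (hN : 1 ≤ N)
    (hx : IsFreeSemicircularSequence N τ x) {K₀ : Y → Y → ℂ} {K : ℝ → Y → Y → ℂ}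
    {K' : Y → Y → ℂ} {u : ℝ} (hK : ∀ v w, HasDerivAt (fun u => K u v w) (K' v w) u)
    {f : Bool → Bool → Y → ℕ × Fin d →₀ ℂ} (hf : IsCopies K₀ (K u) f)
    (m : Y → Matrix (Fin N) (Fin N) ℂ) (w₁ w₂ : List Y) :
    HasDerivAt (fun u => mixedMom K₀ (K u) m w₁ w₂)
      ((1 / (N : ℂ) ^ 2) * ∑ v, ∑ w, K' v w *
        fourfold τ (fun k o v => affVal x (f k o v, m v))
          (TensorProduct.map (ncDeriv v) (ncDeriv w) (word w₁ ⊗ₜ word w₂))) u := by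
  -- The covariance within one copy stays K₀; only that between the two copies with the same shift
  -- moves, so the derivative table is `copyCov` with 0 and K'.
  have hC : ∀ a b, HasDerivAt (fun u => copyCov N K₀ (K u) a b) (copyCov N 0 K' a b) u := by
    rintro (a | p) (b | q)
    · simp only [copyCov]
      split_ifs
      · exact hasDerivAt_const _ _
      · exact hK _ _
      · exact hasDerivAt_const _ _
    all_goals exact hasDerivAt_const _ _
  -- The differentiated pair must have one letter in each word. The word between the two letters
  -- contains E_{sr}, and the remaining one contains E_{rs}.
  have hp : ∀ p : Fin N × Fin N, momDeriv (copyCov N K₀ (K u)) (copyCov N 0 K') (copyMean m)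
      (Sum.inr p :: (copyWord N false false w₁ ++ Sum.inr p.swap :: copyWord N true false w₂)) =
      splitSum (fun U a V => splitSum (fun P b Q => (K' a b *
        ntr N (mom (copyCov N K₀ (K u)) (copyMean m) (copyWord N false false V ++
          Sum.inr p.swap :: copyWord N true false P))) •
        mom (copyCov N K₀ (K u)) (copyMean m) (Sum.inr p :: (copyWord N false false U ++
          copyWord N true false Q))) w₂) w₁ := by
    intro p
    simp only [momDeriv, copyWord, splitSum_cons, splitSum_append, splitSum_map]
    simp [copyCov, splitSum_zero]
  have hD : HasDerivAt (fun u => mixedMom K₀ (K u) m w₁ w₂) ((1 / (N : ℂ)) *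
      ∑ p : Fin N × Fin N, ntr N (momDeriv (copyCov N K₀ (K u)) (copyCov N 0 K') (copyMean m)
      (Sum.inr p :: (copyWord N false false w₁ ++ Sum.inr p.swap :: copyWord N true false w₂)))) u := by
    refine (HasDerivAt.fun_sum fun p _ => ?_).const_mul _
    simp only [ntr_apply, Matrix.trace, Matrix.diag]
    exact (HasDerivAt.fun_sum fun r _ => hasDerivAt_mom hC _ r r).const_mul _
  refine hD.congr_deriv ?_
  simp only [hp, map_splitSum, map_smul, smul_eq_mul]
  have e1 : ∀ v w, fourfold τ (fun k o v => affVal x (f k o v, m v))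
      (TensorProduct.map (ncDeriv v) (ncDeriv w) (word w₁ ⊗ₜ word w₂)) =
      splitSum (fun U a V => splitSum (fun P b Q =>
        (if v = a then 1 else 0) * ((if w = b then 1 else 0) *
          fourfold τ (fun k o v => affVal x (f k o v, m v))
            ((word U ⊗ₜ word V) ⊗ₜ (word P ⊗ₜ word Q)))) w₂) w₁ := by
    intro v w
    rw [TensorProduct.map_tmul, ncDeriv_word, ncDeriv_word]
    have : ∀ T T' : FreeAlgebra ℂ Y ⊗[ℂ] FreeAlgebra ℂ Y,
        fourfold τ (fun k o v => affVal x (f k o v, m v)) (T ⊗ₜ T') =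
        (fourfold τ (fun k o v => affVal x (f k o v, m v)) ∘ₗ (TensorProduct.mk ℂ _ _).flip T') T :=
      fun _ _ => rfl
    rw [this, map_splitSum]
    refine splitSum_congr fun U a V _ => ?_
    rw [map_smul, smul_eq_mul, ← this]
    have h2 : ∀ T T' : FreeAlgebra ℂ Y ⊗[ℂ] FreeAlgebra ℂ Y,
        fourfold τ (fun k o v => affVal x (f k o v, m v)) (T ⊗ₜ T') =
        (fourfold τ (fun k o v => affVal x (f k o v, m v)) ∘ₗ TensorProduct.mk ℂ _ _ T) T' :=
      fun _ _ => rfl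
    rw [h2, map_splitSum, ← smul_eq_mul, ← splitSum_smul]
    refine splitSum_congr fun P b Q _ => ?_
    rw [map_smul, smul_eq_mul, smul_eq_mul, ← h2]
  simp only [e1, ← smul_eq_mul, ← splitSum_smul, ← splitSum_sum]
  refine splitSum_congr fun U a V _ => splitSum_congr fun P b Q _ => ?_
  simp only [smul_eq_mul]
  have e2 : ∑ v, ∑ w, K' v w * ((if v = a then 1 else 0) * ((if w = b then 1 else 0) *
      fourfold τ (fun k o v => affVal x (f k o v, m v))
        ((word U ⊗ₜ word V) ⊗ₜ (word P ⊗ₜ word Q)))) = K' a b *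
      fourfold τ (fun k o v => affVal x (f k o v, m v))
        ((word U ⊗ₜ word V) ⊗ₜ (word P ⊗ₜ word Q)) := by
    rw [Finset.sum_eq_single a (fun v _ hv => by simp [hv]) (by simp),
      Finset.sum_eq_single b (fun w _ hw => by simp [hw]) (by simp)]
    simp
  rw [e2]
  have h := sum_ntr_mom hτ hN hx hf m U V P Q
  calc _ = K' a b * ((1 / (N : ℂ)) * ∑ p : Fin N × Fin N,
      ntr N (mom (copyCov N K₀ (K u)) (copyMean m) (copyWord N false false V ++
        Sum.inr p.swap :: copyWord N true false P)) *
      ntr N (mom (copyCov N K₀ (K u)) (copyMean m) (Sum.inr p :: (copyWord N false false U ++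
        copyWord N true false Q)))) := by
        simp only [mul_assoc, ← Finset.mul_sum]
        ring
    _ = _ := by rw [h]; ring

end Copies

end

end MasterEquation

open MeasureTheory ProbabilityTheory
open scoped TensorProduct

namespace MasterEquation

noncomputable section

/-! ## The operators in terms of the copies -/

section Operators

variable {A : Type*} [CStarAlgebra A] {N d : ℕ} {τ : A →L[ℂ] ℂ}
  {x : ℕ → Fin d → Matrix (Fin N) (Fin N) A} {S : Finset (List ℕ)} {T : List ℝ}

/-- The ordered times of `T`, followed by `t`. -/
def topTime (T : List ℝ) (t : ℝ) (l : ℕ) : ℝ := if l ≤ T.length then ordTime T l else t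

theorem topTime_of_le {l : ℕ} (hl : l ≤ T.length) (t : ℝ) : topTime T t l = ordTime T l := if_pos hl

theorem topTime_of_lt {l : ℕ} (hl : T.length < l) (t : ℝ) : topTime T t l = t :=
  if_neg (by omega)

theorem topTime_zero (T : List ℝ) (t : ℝ) : topTime T t 0 = 0 := by
  rw [topTime_of_le (Nat.zero_le _), ordTime_zero]

theorem monotone_topTime (hT : ∀ t ∈ T, 0 ≤ t) {t : ℝ} (ht : ordTime T T.length ≤ t) :
    Monotone (topTime T t) := by
  intro l k hlk
  unfold topTime
  split_ifs with h1 h2 h2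
  · exact ordTime_mono hT hlk h2
  · exact (ordTime_mono hT h1 le_rfl).trans ht
  · omega
  · rfl

theorem ordTime_cons_eq_topTime (hT : ∀ t ∈ T, 0 ≤ t) {t : ℝ} (ht : ordTime T T.length ≤ t)
    {l : ℕ} (hl : l ≤ T.length + 1) : ordTime (t :: T) l = topTime T t l := by
  rcases Nat.lt_or_ge T.length l with h | h
  · obtain rfl : l = T.length + 1 := by omega
    rw [ordTime_cons_last hT ht, topTime_of_lt h]
  · rw [ordTime_cons_top hT ht h, topTime_of_le h]

theorem continuous_topTime (T : List ℝ) (l : ℕ) : Continuous fun t => topTime T t l := by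
  unfold topTime
  split_ifs
  · exact continuous_const
  · exact continuous_id

/-- The copies of the interpolation. -/
def copies (S : Finset (List ℕ)) (T : List ℝ) (t u : ℝ) (k o : Bool) (v : Fin d × S) :
    ℕ × Fin d →₀ ℂ :=
  coefCopy S (topTime T t) u (if k then 2 else 1) (if o then 1 else 0) v.1 v.2

/-- The means of the interpolation. -/
def means (T : List ℝ) (t : ℝ) (M : Fin d → Matrix (Fin N) (Fin N) ℂ) (v : Fin d × S) :
    Matrix (Fin N) (Fin N) ℂ :=
  meanCoef (topTime T t) (depth S + 1) (gPlus S v.2) • M v.1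

/-- The evaluation of the copies. -/
def copyVal (x : ℕ → Fin d → Matrix (Fin N) (Fin N) A) (S : Finset (List ℕ)) (T : List ℝ)
    (t u : ℝ) (M : Fin d → Matrix (Fin N) (Fin N) ℂ) (k o : Bool) (v : Fin d × S) :
    Matrix (Fin N) (Fin N) A :=
  affVal x (copies S T t u k o v, means T t M v)

theorem isCopies_copies {slot : ℕ → ℕ} (hS : Slotted S slot) (hT : ∀ t ∈ T, 0 ≤ t) {t : ℝ}
    (ht : ordTime T T.length ≤ t) (u : ℝ) :
    IsCopies (fun v w : Fin d × S => crossCov S (topTime T t) 0 (v.1, v.2.1) (w.1, w.2.1))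
      (fun v w : Fin d × S => crossCov S (topTime T t) u (v.1, v.2.1) (w.1, w.2.1))
      (copies S T t u) := by
  intro k o v k' o' w
  unfold copies
  rw [dot_coefCopy hS (monotone_topTime hT ht) (topTime_zero T t) u (by split_ifs <;> omega)
    (by split_ifs <;> omega) (by split_ifs <;> omega) (by split_ifs <;> omega)
    (by split_ifs <;> omega) (by split_ifs <;> omega) v.2.2 w.2.2]
  cases k <;> cases k' <;> cases o <;> cases o' <;> rfl

theorem lift_interp_subst {S' : Finset (List ℕ)} {T' : List ℝ}
    {b : Fin d → Matrix (Fin N) (Fin N) A} {f : List ℕ → List ℕ} (hf : ∀ I ∈ S, f I ∈ S')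
    {Z : Fin d × S → Matrix (Fin N) (Fin N) A}
    (h : ∀ v, interp S' T' x b (v.1, ⟨f v.2.1, hf _ v.2.2⟩) = Z v) (Q : Poly d S) :
    FreeAlgebra.lift ℂ (interp S' T' x b) (subst f hf Q) = FreeAlgebra.lift ℂ Z Q := by
  have : (FreeAlgebra.lift ℂ (interp S' T' x b)).comp (subst f hf) = FreeAlgebra.lift ℂ Z := by
    ext v
    simp [subst, ← h]
  exact DFunLike.congr_fun this Q

theorem affVal_eq (v : ℕ × Fin d →₀ ℂ) (c : ℂ) (M : Matrix (Fin N) (Fin N) ℂ) :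
    affVal x (v, c • M) = Finsupp.linearCombination ℂ (fun q : ℕ × Fin d => x q.1 q.2) v +
      c • matEmb A N M := by
  simp [affVal]

theorem interp_gPlus (hTS : T.length = depth S) (hT : ∀ t ∈ T, 0 ≤ t) {t : ℝ}
    (ht : ordTime T T.length ≤ t) (M : Fin d → Matrix (Fin N) (Fin N) ℂ) (v : Fin d × S) :
    interp (setG S) (t :: T) x (fun i => matEmb A N (M i))
      (v.1, ⟨gPlus S v.2.1, gPlus_mem S _ v.2.2⟩) =
      affVal x (coef (topTime T t) (depth S + 1) v.1 (gPlus S v.2), means T t M v) := by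
  have h : ∀ l ≤ depth S + 1, ordTime (t :: T) l = topTime T t l := fun l hl =>
    ordTime_cons_eq_topTime hT ht (by omega)
  rw [interp_eq, means, affVal_eq, List.length_cons, hTS, coef_congr h, meanCoef_congr h]

/-- For the empty index the prefactor is e^{t/2}, with t now the last time, and cancels e^{-t/2}; no
semicircular term occurs, so the potential in ∇_V is evaluated at the matrices themselves. -/
theorem interp_nil (hT : ∀ t ∈ T, 0 ≤ t) {t : ℝ}
    (ht : ordTime T T.length ≤ t) (b : Fin d → Matrix (Fin N) (Fin N) A) (i : Fin d) :
    interp (setG S) (t :: T) x b (i, ⟨[], nil_mem_setG S⟩) = b i := by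
  have h : ordTime (t :: T) (T.length + 1) = t := ordTime_cons_last hT ht
  simp only [interp, startIdx, List.length_cons, List.length_nil, Nat.sub_zero,
    Nat.add_sub_cancel, h]
  rw [Finset.Icc_eq_empty (by omega), Finset.sum_empty, zero_add, smul_smul, ← Complex.ofReal_mul,
    ← Real.exp_add]
  simp [neg_div]

theorem interp_fCopy (hTS : T.length = depth S) (hT : ∀ t ∈ T, 0 ≤ t) {t u : ℝ}
    (ht : ordTime T T.length ≤ t) {s : ℕ} (hs : 1 ≤ s) (hsn : s ≤ depth S + 1)
    (h1 : topTime T t (s - 1) ≤ u) (h2 : u ≤ topTime T t s)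
    (M : Fin d → Matrix (Fin N) (Fin N) ℂ) (k o : Bool) (v : Fin d × S) {S' : Finset (List ℕ)}
    {I' : List ℕ} (hI' : I' ∈ S')
    (e : I' = fCopy S s (if k then 2 else 1) (if o then 1 else 0) v.2) :
    interp S' (u :: t :: T) x (fun i => matEmb A N (M i)) (v.1, ⟨I', hI'⟩) =
      copyVal x S T t u M k o v := by
  subst e
  have hT' : ∀ r ∈ t :: T, 0 ≤ r := by
    intro r hr
    rcases List.mem_cons.1 hr with rfl | hr
    · exact (ordTime_nonneg hT le_rfl).trans ht
    · exact hT r hr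
  have hle : ∀ l ≤ depth S + 1, ordTime (t :: T) l = topTime T t l := fun l hl =>
    ordTime_cons_eq_topTime hT ht (by omega)
  have hl : ∀ l ≤ depth S + 2, ordTime (u :: t :: T) l = insertTime (topTime T t) u s l := by
    intro l hl
    rw [ordTime_cons hT' hs (by simp; omega) (by rw [hle _ (by omega)]; exact h1)
      (fun _ => by rw [hle _ hsn]; exact h2), insertTime]
    split_ifs
    · exact hle _ (by omega)
    · rfl
    · exact hle _ (by omega)
  obtain ⟨c1, c2⟩ := coef_fCopy (monotone_topTime hT ht) hs hsn h1 h2 (if k then 2 else 1)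
    (if o then 1 else 0) v.2.2 v.1
  rw [interp_eq, copyVal, means, affVal_eq, List.length_cons, List.length_cons, hTS,
    coef_congr hl, meanCoef_congr hl, c1, c2]
  rfl

/-- For u in the s-th interval the four substitutions F_s^1, F_s^2 and their shifted versions
evaluate to the four copies (`interp_fCopy`), so both sides agree on pure tensors and hence by
linearity. -/
theorem traceAt_theta (hTS : T.length = depth S) (hT : ∀ t ∈ T, 0 ≤ t) {t u : ℝ}
    (ht : ordTime T T.length ≤ t) {s : ℕ} (hs : 1 ≤ s) (hsn : s ≤ depth S + 1)
    (h1 : topTime T t (s - 1) ≤ u) (h2 : u ≤ topTime T t s)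
    (M : Fin d → Matrix (Fin N) (Fin N) ℂ) (h : setFj S s ⊆ setF S)
    (Q : (Poly d S ⊗[ℂ] Poly d S) ⊗[ℂ] (Poly d S ⊗[ℂ] Poly d S)) :
    traceAt τ x (u :: t :: T) (incl h (theta S s Q)) M = fourfold τ (copyVal x S T t u M) Q := by
  have key : ∀ (f : List ℕ → List ℕ) (hf : ∀ I ∈ S, f I ∈ setFj S s) (k o : Bool)
      (_ : ∀ I, f I = fCopy S s (if k then 2 else 1) (if o then 1 else 0) I) (P : Poly d S),
      FreeAlgebra.lift ℂ (interp (setF S) (u :: t :: T) x fun i => matEmb A N (M i))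
        (incl h (subst f hf P)) = FreeAlgebra.lift ℂ (copyVal x S T t u M k o) P := by
    intro f hf k o hfk P
    rw [incl, lift_interp_subst (f := id) (fun _ hI => h hI) (Z := fun v : Fin d × setFj S s =>
      interp (setF S) (u :: t :: T) x (fun i => matEmb A N (M i)) (v.1, ⟨id v.2.1, h v.2.2⟩))
      (fun v => rfl)]
    have : (FreeAlgebra.lift ℂ fun v : Fin d × setFj S s => interp (setF S) (u :: t :: T) x
        (fun i => matEmb A N (M i)) (v.1, ⟨id v.2.1, h v.2.2⟩)).comp (subst f hf) =
        FreeAlgebra.lift ℂ (copyVal x S T t u M k o) := by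
      ext v
      simp only [subst, Function.comp_apply, AlgHom.coe_comp, FreeAlgebra.lift_ι_apply]
      rw [← interp_fCopy hTS hT ht hs hsn h1 h2 M k o v (h (hf _ v.2.2)) (hfk _)]
      rfl
    exact DFunLike.congr_fun this P
  have hlin : ∀ Q, traceAt τ x (u :: t :: T) (incl h (theta S s Q)) M =
      (traceN N τ ∘ₗ (FreeAlgebra.lift ℂ (interp (setF S) (u :: t :: T) x fun i =>
        matEmb A N (M i))).toLinearMap ∘ₗ (incl h).toLinearMap ∘ₗ theta S s) Q := fun _ => rfl
  rw [hlin]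
  refine LinearMap.congr_fun (TensorProduct.ext_fourfold' fun P Q R W => ?_) Q
  rw [← hlin, theta_tmul, fourfold_tmul, traceAt]
  simp only [map_mul]
  rw [key _ _ false false (by intro I; rw [f1_eq]; rfl), key _ _ false true (by intro I; rw [f1t_eq]; rfl),
    key _ _ true true (by intro I; rw [f2t_eq]; rfl), key _ _ true false (by intro I; rw [f2_eq]; rfl)]
  simp only [mul_assoc]

/-- An index on level h has starting position h+1. Thus a sum over levels h < s is a sum over the
indices starting at or before s, and the weight can be read off the index. -/
theorem sum_level {E : Type*} [AddCommGroup E] [Module ℂ E] (S : Finset (List ℕ)) (g : ℕ → ℂ)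
    (F : S → E) (s : ℕ) :
    ∑ h ∈ Finset.range s, g h • ∑ I ∈ level S h, F I =
      ∑ I : S, if startIdx (depth S) I.1 ≤ s then g (startIdx (depth S) I.1 - 1) • F I else 0 := by
  simp only [Finset.smul_sum, level, Finset.sum_filter]
  rw [Finset.sum_comm]
  refine Finset.sum_congr rfl fun I _ => ?_
  have hI := length_le_depth I.2
  have hm : startIdx (depth S) I.1 = depth S + 1 - I.1.length := rfl
  split_ifs with h
  · rw [Finset.sum_eq_single (startIdx (depth S) I.1 - 1)]
    · rw [if_pos (by omega)]
    · intro b _ hb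
      rw [if_neg (by omega), smul_zero]
    · intro hb
      rw [Finset.mem_range] at hb
      omega
  · refine Finset.sum_eq_zero fun b hb => ?_
    rw [Finset.mem_range] at hb
    rw [if_neg (by omega), smul_zero]

theorem sum_level_all {E : Type*} [AddCommGroup E] [Module ℂ E] (S : Finset (List ℕ)) (g : ℕ → ℂ)
    (F : S → E) :
    ∑ h ∈ Finset.range (depth S + 1), g h • ∑ I ∈ level S h, F I =
      ∑ I : S, g (startIdx (depth S) I.1 - 1) • F I := by
  rw [sum_level S g F]
  exact Finset.sum_congr rfl fun I _ => if_pos (startIdx_le _ _)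

/-- In the extended lists the last entry is always c+1, which absorbs the exceptional case s = n+1
of the condition I_s = J_s. -/
theorem plusEntry_eq_iff {I J : List ℕ} (hI : I ∈ S) (hJ : J ∈ S) {s : ℕ} (hsn : s ≤ depth S + 1)
    (hIs : startIdx (depth S) I ≤ s) (hJs : startIdx (depth S) J ≤ s) :
    plusEntry S I s = plusEntry S J s ↔ s = depth S + 1 ∨ entry (depth S) I s = entry (depth S) J s := by
  rcases Nat.lt_or_ge (depth S) s with h | h
  · obtain rfl : s = depth S + 1 := by omega
    simp [plusEntry_last hI, plusEntry_last hJ]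
  · rw [(plusEntry_of_le hI hIs h).1, (plusEntry_of_le hJ hJs h).1]
    have : ¬ s = depth S + 1 := by omega
    simp [this]

/-- The weights of the pairs of variables in the operators `L_s`. -/
def pairCoef (S : Finset (List ℕ)) (T : List ℝ) (s : ℕ) (v w : Fin d × S) : ℂ :=
  if v.1 = w.1 ∧ startIdx (depth S) v.2.1 ≤ s ∧ startIdx (depth S) w.2.1 ≤ s ∧
      plusEntry S v.2 s = plusEntry S w.2 s then
    ((Real.exp ((ordTime T (startIdx (depth S) v.2.1 - 1) +
      ordTime T (startIdx (depth S) w.2.1 - 1)) / 2) : ℝ) : ℂ) else 0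

/-- The weighted sum of the `∂_v ⊗ ∂_w`. -/
def pairDeriv (S : Finset (List ℕ)) (T : List ℝ) (s : ℕ) :
    Poly d S ⊗[ℂ] Poly d S →ₗ[ℂ] (Poly d S ⊗[ℂ] Poly d S) ⊗[ℂ] (Poly d S ⊗[ℂ] Poly d S) :=
  ∑ v, ∑ w, pairCoef S T s v w • TensorProduct.map (ncDeriv v) (ncDeriv w)

/-- The level sums and the condition I_s = J_s are gathered in `pairDeriv`, whose weights are those
appearing in the u-derivative of the cross covariance; the dependence on t and u is only in the
scalar prefactor and the copies. -/
theorem opLs_eq (t u : ℝ) {s : ℕ} (hsn : s ≤ depth S + 1)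
    (P : Poly d S) :
    opLs S T t u s P = (1 / 2 : ℂ) • ∑ i : Fin d, ∑ h ∈ Finset.range (depth S + 1),
      ∑ k ∈ Finset.range (depth S + 1),
        ((Real.exp ((ordTime T h + ordTime T k) / 2 - t) * Real.exp (-u) : ℝ) : ℂ) •
          theta S s (pairDeriv S T s (ncDerivLevel S i k (cycDerivLevel S i h P))) := by
  simp only [opLs]
  congr 1
  refine Finset.sum_congr rfl fun i _ => ?_
  rw [Finset.sum_comm]
  refine Finset.sum_congr rfl fun h _ => ?_
  rw [Finset.sum_comm]
  refine Finset.sum_congr rfl fun k _ => ?_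
  set R := ncDerivLevel S i k (cycDerivLevel S i h P)
  have e : theta S s (pairDeriv S T s R) = ∑ j : Fin d, ∑ I : S, ∑ J : S,
      pairCoef S T s (j, I) (j, J) •
        theta S s (TensorProduct.map (ncDeriv (j, I)) (ncDeriv (j, J)) R) := by
    simp only [pairDeriv, LinearMap.sum_apply, LinearMap.smul_apply, map_sum, map_smul]
    rw [Fintype.sum_prod_type]
    refine Finset.sum_congr rfl fun j _ => Finset.sum_congr rfl fun I _ => ?_
    rw [Fintype.sum_prod_type, Finset.sum_eq_single j]
    · intro j' _ hj
      refine Finset.sum_eq_zero fun J _ => ?_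
      rw [pairCoef, if_neg (fun hh => hj hh.1.symm), zero_smul]
    · simp
  rw [e, Finset.smul_sum]
  refine Finset.sum_congr rfl fun j _ => ?_
  have e2 : ∀ a ∈ Finset.range s, ∀ b ∈ Finset.range s,
      ((Real.exp ((ordTime T h + ordTime T k + ordTime T b + ordTime T a) / 2 - t - u) : ℝ) : ℂ) •
        (∑ I ∈ level S a, ∑ J ∈ level S b,
          if s = depth S + 1 ∨ entry (depth S) I.1 s = entry (depth S) J.1 s then
            theta S s (TensorProduct.map (ncDeriv (j, I)) (ncDeriv (j, J)) R) else 0) =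
      ((Real.exp ((ordTime T h + ordTime T k) / 2 - t) * Real.exp (-u) : ℝ) : ℂ) •
        ((Real.exp (ordTime T a / 2) : ℝ) : ℂ) • ∑ I ∈ level S a,
          ((Real.exp (ordTime T b / 2) : ℝ) : ℂ) • ∑ J ∈ level S b,
          if s = depth S + 1 ∨ entry (depth S) I.1 s = entry (depth S) J.1 s then
            theta S s (TensorProduct.map (ncDeriv (j, I)) (ncDeriv (j, J)) R) else 0 := by
    intro a _ b _
    rw [← Finset.smul_sum, smul_smul, smul_smul, ← Complex.ofReal_mul, ← Complex.ofReal_mul,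
      ← Real.exp_add, ← Real.exp_add, ← Real.exp_add]
    congr 4
    ring
  have e3 : ∀ a ∈ Finset.range s, (∑ b ∈ Finset.range s,
      ((Real.exp ((ordTime T h + ordTime T k + ordTime T b + ordTime T a) / 2 - t - u) : ℝ) : ℂ) •
        (∑ I ∈ level S a, ∑ J ∈ level S b,
          if s = depth S + 1 ∨ entry (depth S) I.1 s = entry (depth S) J.1 s then
            theta S s (TensorProduct.map (ncDeriv (j, I)) (ncDeriv (j, J)) R) else 0)) =
      ((Real.exp ((ordTime T h + ordTime T k) / 2 - t) * Real.exp (-u) : ℝ) : ℂ) •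
        ((Real.exp (ordTime T a / 2) : ℝ) : ℂ) • ∑ I ∈ level S a, ∑ b ∈ Finset.range s,
          ((Real.exp (ordTime T b / 2) : ℝ) : ℂ) • ∑ J ∈ level S b,
          if s = depth S + 1 ∨ entry (depth S) I.1 s = entry (depth S) J.1 s then
            theta S s (TensorProduct.map (ncDeriv (j, I)) (ncDeriv (j, J)) R) else 0 := by
    intro a ha
    rw [Finset.sum_congr rfl fun b hb => e2 a ha b hb, ← Finset.smul_sum, ← Finset.smul_sum,
      Finset.sum_comm]
  rw [Finset.sum_congr rfl e3, ← Finset.smul_sum]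
  congr 1
  rw [sum_level S (fun a => ((Real.exp (ordTime T a / 2) : ℝ) : ℂ))]
  refine Finset.sum_congr rfl fun I _ => ?_
  split_ifs with hI
  · rw [sum_level S (fun a => ((Real.exp (ordTime T a / 2) : ℝ) : ℂ)), Finset.smul_sum]
    refine Finset.sum_congr rfl fun J _ => ?_
    split_ifs with hJ hc
    · rw [pairCoef, if_pos ⟨rfl, hI, hJ, (plusEntry_eq_iff I.2 J.2 hsn hI hJ).2 hc⟩, smul_smul,
        ← Complex.ofReal_mul, ← Real.exp_add, add_div]
    · rw [pairCoef, if_neg (fun hh => hc ((plusEntry_eq_iff I.2 J.2 hsn hI hJ).1 hh.2.2.2))]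
      simp
    · rw [pairCoef, if_neg (fun hh => hJ hh.2.2.1)]
      simp
  · refine (Finset.sum_eq_zero fun J _ => ?_).symm
    rw [pairCoef, if_neg (fun hh => hI hh.2.1), zero_smul]

/-- The function of which `τ_N(L(P)(X))` consists. -/
def copyL (τ : A →L[ℂ] ℂ) (x : ℕ → Fin d → Matrix (Fin N) (Fin N) A) (S : Finset (List ℕ))
    (T : List ℝ) (t u : ℝ) (M : Fin d → Matrix (Fin N) (Fin N) ℂ) (R : Poly d S ⊗[ℂ] Poly d S) : ℂ :=
  ∑ s : Fin (depth S + 1), (Set.Icc (topTime T t s) (topTime T t (s + 1))).indicator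
    (fun _ => ((Real.exp (-u) : ℝ) : ℂ) *
      fourfold τ (copyVal x S T t u M) (pairDeriv S T (s + 1) R)) u

theorem traceAt_opL (hTS : T.length = depth S) (hT : ∀ t ∈ T, 0 ≤ t) {t : ℝ}
    (ht : ordTime T T.length ≤ t) (u : ℝ) (M : Fin d → Matrix (Fin N) (Fin N) ℂ) (P : Poly d S) :
    traceAt τ x (u :: t :: T) (opL S T t u P) M = (1 / 2 : ℂ) * ∑ i : Fin d,
      ∑ h ∈ Finset.range (depth S + 1), ∑ k ∈ Finset.range (depth S + 1),
        ((Real.exp ((ordTime T h + ordTime T k) / 2 - t) : ℝ) : ℂ) *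
          copyL τ x S T t u M (ncDerivLevel S i k (cycDerivLevel S i h P)) := by
  have hle : ∀ l ≤ depth S + 1, ordTime (t :: T) l = topTime T t l := fun l hl =>
    ordTime_cons_eq_topTime hT ht (by omega)
  have hlin : ∀ Q : Poly d (setF S), traceAt τ x (u :: t :: T) Q M =
      (traceN N τ ∘ₗ (FreeAlgebra.lift ℂ (interp (setF S) (u :: t :: T) x fun i =>
        matEmb A N (M i))).toLinearMap) Q := fun _ => rfl
  rw [opL, hlin, map_sum]
  simp only [copyL, Finset.mul_sum]
  have e1 : ∀ s : Fin (depth S + 1), (traceN N τ ∘ₗ (FreeAlgebra.lift ℂ (interp (setF S)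
      (u :: t :: T) x fun i => matEmb A N (M i))).toLinearMap)
      ((Set.Icc (ordTime (t :: T) s) (ordTime (t :: T) (s + 1))).indicator
        (fun _ => incl (setFj_subset S s) (opLs S T t u (s + 1) P)) u) =
      ∑ i : Fin d, ∑ h ∈ Finset.range (depth S + 1), ∑ k ∈ Finset.range (depth S + 1),
        (1 / 2 : ℂ) * (((Real.exp ((ordTime T h + ordTime T k) / 2 - t) : ℝ) : ℂ) *
        (Set.Icc (topTime T t s) (topTime T t (s + 1))).indicator
    (fun _ => ((Real.exp (-u) : ℝ) : ℂ) * fourfold τ (copyVal x S T t u M) (pairDeriv S T (s + 1)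
      (ncDerivLevel S i k (cycDerivLevel S i h P)))) u) := by
    intro s
    have hs := s.2
    rw [hle _ (by omega), hle _ (by omega)]
    by_cases hu : u ∈ Set.Icc (topTime T t s) (topTime T t (s + 1))
    · simp only [Set.indicator_of_mem hu]
      rw [opLs_eq t u (by omega)]
      simp only [map_smul, map_sum, smul_eq_mul, Finset.mul_sum]
      refine Finset.sum_congr rfl fun i _ => Finset.sum_congr rfl fun h _ =>
        Finset.sum_congr rfl fun k _ => ?_
      rw [← hlin, traceAt_theta hTS hT ht (by omega) (by omega) hu.1 hu.2 M (setFj_subset S s)]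
      push_cast
      ring
    · simp only [Set.indicator_of_notMem hu]
      simp
  rw [Finset.sum_congr rfl fun s _ => e1 s, Finset.sum_comm]
  refine Finset.sum_congr rfl fun i _ => ?_
  rw [Finset.sum_comm]
  refine Finset.sum_congr rfl fun h _ => ?_
  rw [Finset.sum_comm]

end Operators

end

end MasterEquation

open MeasureTheory ProbabilityTheory
open scoped TensorProduct

namespace MasterEquation

noncomputable section

/-! ## The evolution of partially correlated copies -/

section Evolution

variable {A : Type*} [CStarAlgebra A] {N d : ℕ} {τ : A →L[ℂ] ℂ}
  {x : ℕ → Fin d → Matrix (Fin N) (Fin N) A} {S : Finset (List ℕ)} {T : List ℝ}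

theorem tensor_word_induction {Y : Type*}
    {p : FreeAlgebra ℂ Y ⊗[ℂ] FreeAlgebra ℂ Y → Prop}
    (hw : ∀ w₁ w₂, p (word w₁ ⊗ₜ word w₂)) (hadd : ∀ a b, p a → p b → p (a + b))
    (hsmul : ∀ (c : ℂ) a, p a → p (c • a)) (R : FreeAlgebra ℂ Y ⊗[ℂ] FreeAlgebra ℂ Y) : p R := by
  induction R using TensorProduct.induction_on with
  | zero => simpa using hsmul 0 _ (hw [] [])
  | add a b ha hb => exact hadd a b ha hb
  | tmul P Q =>
    induction P using freeAlgebra_induction with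
    | hadd a b ha hb => rw [TensorProduct.add_tmul]; exact hadd _ _ ha hb
    | hsmul c a ha => rw [← TensorProduct.smul_tmul']; exact hsmul _ _ ha
    | hw w₁ =>
      induction Q using freeAlgebra_induction with
      | hadd a b ha hb => rw [TensorProduct.tmul_add]; exact hadd _ _ ha hb
      | hsmul c a ha => rw [TensorProduct.tmul_smul]; exact hsmul _ _ ha
      | hw w₂ => exact hw w₁ w₂

/-- The evaluation of the interpolation with one more time. -/
def plusVal (x : ℕ → Fin d → Matrix (Fin N) (Fin N) A) (S : Finset (List ℕ)) (T : List ℝ) (t : ℝ)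
    (M : Fin d → Matrix (Fin N) (Fin N) ℂ) (v : Fin d × S) : Matrix (Fin N) (Fin N) A :=
  affVal x (coef (topTime T t) (depth S + 1) v.1 (gPlus S v.2), means T t M v)

theorem mixedContraction_copyVal {slot : ℕ → ℕ} (hS : Slotted S slot) (hτ : IsTrace τ) (hN : 1 ≤ N)
    (hx : IsFreeSemicircularSequence N τ x) (hT : ∀ t ∈ T, 0 ≤ t) {t : ℝ}
    (ht : ordTime T T.length ≤ t) (u : ℝ) (M : Fin d → Matrix (Fin N) (Fin N) ℂ)
    (w₁ w₂ : List (Fin d × S)) :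
    mixedContraction τ (copyVal x S T t u M false false) (copyVal x S T t u M true false)
      (word w₁ ⊗ₜ word w₂) =
      mixedMom (fun v w => crossCov S (topTime T t) 0 (v.1, v.2.1) (w.1, w.2.1))
        (fun v w => crossCov S (topTime T t) u (v.1, v.2.1) (w.1, w.2.1)) (means T t M) w₁ w₂ :=
  mixedContraction_word hτ hN hx (f := fun k => copies S T t u k false)
    (fun k k' v w => by simpa using isCopies_copies hS hT ht u k false v k' false w) _ _ _

/-- At u = 0 the cross covariance equals the covariance within a copy, so the two copies may be
replaced by one and the same family. -/
theorem mixedContraction_copyVal_zero {slot : ℕ → ℕ} (hS : Slotted S slot) (hτ : IsTrace τ)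
    (hN : 1 ≤ N) (hx : IsFreeSemicircularSequence N τ x) (hT : ∀ t ∈ T, 0 ≤ t) {t : ℝ}
    (ht : ordTime T T.length ≤ t) (M : Fin d → Matrix (Fin N) (Fin N) ℂ)
    (R : Poly d S ⊗[ℂ] Poly d S) :
    mixedContraction τ (copyVal x S T t 0 M false false) (copyVal x S T t 0 M true false) R =
      contraction τ (plusVal x S T t M) R := by
  induction R using tensor_word_induction with
  | hadd a b ha hb => rw [map_add, map_add, ha, hb]
  | hsmul c a ha => rw [map_smul, map_smul, ha]
  | hw w₁ w₂ =>
    rw [mixedContraction_copyVal hS hτ hN hx hT ht, ← mixedContraction_self]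
    have h := mixedContraction_word hτ hN hx
      (K₀ := fun v w : Fin d × S => crossCov S (topTime T t) 0 (v.1, v.2.1) (w.1, w.2.1))
      (K := fun v w : Fin d × S => crossCov S (topTime T t) 0 (v.1, v.2.1) (w.1, w.2.1))
      (f := fun _ v => coef (topTime T t) (depth S + 1) v.1 (gPlus S v.2))
      (fun k k' v w => by
        rw [ite_self]
        exact dot_coef_gPlus hS (monotone_topTime hT ht) (topTime_zero T t) v.2.2 w.2.2 v.1 w.1)
      (means T t M) w₁ w₂
    exact h.symm

/-- At u = t the copies share no semicircular increment, so the expression factorizes by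
`mixedMom_zero`. -/
theorem mixedContraction_copyVal_top {slot : ℕ → ℕ} (hS : Slotted S slot) (hτ : IsTrace τ)
    (hN : 1 ≤ N) (hx : IsFreeSemicircularSequence N τ x) (hTS : T.length = depth S)
    (hT : ∀ t ∈ T, 0 ≤ t) {t : ℝ}
    (ht : ordTime T T.length ≤ t) (M : Fin d → Matrix (Fin N) (Fin N) ℂ)
    (R : Poly d S ⊗[ℂ] Poly d S) :
    mixedContraction τ (copyVal x S T t t M false false) (copyVal x S T t t M true false) R =
      tensorSq (traceN N τ ∘ₗ (FreeAlgebra.lift ℂ (plusVal x S T t M)).toLinearMap) R := by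
  induction R using tensor_word_induction with
  | hadd a b ha hb => rw [map_add, map_add, ha, hb]
  | hsmul c a ha => rw [map_smul, map_smul, ha]
  | hw w₁ w₂ =>
    have h0 : (fun v w : Fin d × S => crossCov S (topTime T t) t (v.1, v.2.1) (w.1, w.2.1)) = 0 := by
      funext v w
      refine crossCov_eq_zero (fun l hl => ?_) _ _
      have := monotone_topTime hT ht hl
      rwa [topTime_of_lt (l := depth S + 1) (by omega) t] at this
    rw [mixedContraction_copyVal hS hτ hN hx hT ht, h0, mixedMom_zero, tensorSq_tmul]
    have key : ∀ w : List (Fin d × S), ntr N (mom (fun v w : Fin d × S => crossCov S (topTime T t) 0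
        (v.1, v.2.1) (w.1, w.2.1)) (means T t M) w) =
        (traceN N τ ∘ₗ (FreeAlgebra.lift ℂ (plusVal x S T t M)).toLinearMap) (word w) := by
      intro w
      rw [LinearMap.comp_apply, AlgHom.toLinearMap_apply, traceN_eq]
      unfold plusVal
      rw [entryMean_lift_affVal hτ hN hx (fun v : Fin d × S =>
        (coef (topTime T t) (depth S + 1) v.1 (gPlus S v.2.1), means T t M v)), momL_word]
      congr 2
      funext v w
      exact (dot_coef_gPlus hS (monotone_topTime hT ht) (topTime_zero T t) v.2.2 w.2.2 _ _).symm
    rw [key, key]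

theorem hasDerivAt_mixedContraction {slot : ℕ → ℕ} (hS : Slotted S slot) (hτ : IsTrace τ)
    (hN : 1 ≤ N) (hx : IsFreeSemicircularSequence N τ x) (hTS : T.length = depth S)
    (hT : ∀ t ∈ T, 0 ≤ t) {t : ℝ}
    (ht : ordTime T T.length ≤ t) (M : Fin d → Matrix (Fin N) (Fin N) ℂ)
    (R : Poly d S ⊗[ℂ] Poly d S) {u : ℝ} {s : ℕ} (hs : 1 ≤ s) (hsn : s ≤ depth S + 1)
    (h1 : topTime T t (s - 1) < u) (h2 : u < topTime T t s) :
    HasDerivAt (fun u => mixedContraction τ (copyVal x S T t u M false false)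
        (copyVal x S T t u M true false) R)
      (-(1 / (N : ℂ) ^ 2) * (((Real.exp (-u) : ℝ) : ℂ) *
        fourfold τ (copyVal x S T t u M) (pairDeriv S T s R))) u := by
  induction R using tensor_word_induction with
  | hadd a b ha hb =>
    simp only [map_add]
    exact (ha.add hb).congr_deriv (by ring)
  | hsmul c a ha =>
    simp only [map_smul, smul_eq_mul]
    exact (ha.const_mul c).congr_deriv (by ring)
  | hw w₁ w₂ =>
    simp only [mixedContraction_copyVal hS hτ hN hx hT ht]
    have h := hasDerivAt_mixedMom (N := N) hτ hN hx
      (K₀ := fun v w : Fin d × S => crossCov S (topTime T t) 0 (v.1, v.2.1) (w.1, w.2.1))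
      (K := fun u (v w : Fin d × S) => crossCov S (topTime T t) u (v.1, v.2.1) (w.1, w.2.1))
      (fun v w => hasDerivAt_crossCov (monotone_topTime hT ht) hs hsn h1 h2 _ _)
      (isCopies_copies hS hT ht u) (means T t M) w₁ w₂
    refine h.congr_deriv ?_
    rw [neg_mul, ← mul_neg]
    congr 1
    simp only [pairDeriv, LinearMap.sum_apply, LinearMap.smul_apply, map_sum, map_smul,
      Finset.mul_sum, smul_eq_mul, ← Finset.sum_neg_distrib]
    refine Finset.sum_congr rfl fun v _ => Finset.sum_congr rfl fun w _ => ?_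
    change _ * fourfold τ (copyVal x S T t u M) _ = _
    rw [← mul_assoc, ← neg_mul]
    congr 1
    have hv := startIdx_le (depth S) v.2.1
    have hw := startIdx_le (depth S) w.2.1
    unfold pairCoef
    split_ifs with hc
    · rw [topTime_of_le (by omega), topTime_of_le (by omega), sub_eq_add_neg, Real.exp_add]
      push_cast
      ring
    · simp

/-- Strictly between consecutive times exactly one of the closed intervals contains u; their
overlaps at the times are negligible in the integral over u. -/
theorem copyL_eq (hT : ∀ t ∈ T, 0 ≤ t) {t : ℝ} (ht : ordTime T T.length ≤ t)
    (M : Fin d → Matrix (Fin N) (Fin N) ℂ) (R : Poly d S ⊗[ℂ] Poly d S) {u : ℝ} {s : ℕ}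
    (hs : s < depth S + 1) (h1 : topTime T t s < u) (h2 : u < topTime T t (s + 1)) :
    copyL τ x S T t u M R = ((Real.exp (-u) : ℝ) : ℂ) *
      fourfold τ (copyVal x S T t u M) (pairDeriv S T (s + 1) R) := by
  have hm := monotone_topTime hT ht
  unfold copyL
  rw [Finset.sum_eq_single (⟨s, hs⟩ : Fin (depth S + 1))]
  · rw [Set.indicator_of_mem]
    exact ⟨h1.le, h2.le⟩
  · intro s' _ hs'
    refine Set.indicator_of_notMem (fun h => ?_) _
    rcases lt_trichotomy s'.1 s with hlt | heq | hgt
    · exact absurd (h.2.trans (hm hlt)) (not_le.2 h1)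
    · exact hs' (Fin.ext heq)
    · exact absurd ((hm hgt).trans h.1) (not_le.2 h2)
  · simp

/-! ### Growth of the evaluations -/

/-- The range of the times. -/
def timeSet (T : List ℝ) : Set (ℝ × ℝ) := {p | ordTime T T.length < p.1 ∧ 0 ≤ p.2 ∧ p.2 ≤ p.1}

theorem measurableSet_timeSet (T : List ℝ) : MeasurableSet (timeSet T) :=
  (measurableSet_lt measurable_const measurable_fst).inter
    ((measurableSet_le measurable_const measurable_snd).inter
      (measurableSet_le measurable_snd measurable_fst))

theorem IsPolyMat.sum {α : Type*} [TopologicalSpace α] {S : Set α} {ι : Type*} (s : Finset ι)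
    {F : ι → α → (Fin d → Matrix (Fin N) (Fin N) ℂ) → Matrix (Fin N) (Fin N) A}
    (hF : ∀ i ∈ s, IsPolyMat S (F i)) : IsPolyMat S (fun a M => ∑ i ∈ s, F i a M) := by
  intro r c
  simp only [Matrix.sum_apply]
  exact IsPoly.sum s fun i hi => hF i hi r c

theorem isPolyMat_means {α : Type*} [TopologicalSpace α] {U : Set α} {t : α → ℝ}
    (hc : Continuous t) (h0 : ∀ a ∈ U, 0 ≤ t a) (hTS : T.length = depth S) (v : Fin d × S) :
    IsPolyMat U (fun a (M : Fin d → Matrix (Fin N) (Fin N) ℂ) => matEmb A N (means T (t a) M v)) := by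
  have hv := startIdx_le (depth S) v.2.1
  simp only [means, map_smul, meanCoef, startIdx_gPlus]
  refine IsPolyMat.smul (K := Real.exp (ordTime T (startIdx (depth S) v.2.1 - 1) / 2)) ?_ ?_
    (IsPolyMat.matEmb (IsPolyMat.tuple _))
  · have h1 := (continuous_topTime T (startIdx (depth S) v.2.1 - 1)).comp hc
    have h2 := (continuous_topTime T (depth S + 1)).comp hc
    simp only [Function.comp_def] at h1 h2
    fun_prop
  · intro a ha
    rw [topTime_of_le (by omega), topTime_of_lt (by omega), ← Complex.ofReal_mul,
      Complex.norm_real, Real.norm_of_nonneg (by positivity), ← Real.exp_add]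
    refine Real.exp_le_exp.2 ?_
    linarith [h0 a ha]

/-- The bounds are uniform in t and u: each increment coefficient is at most 1, and the prefactor
involves only a time of T, as the starting position is at most n+1. -/
theorem isPolyMat_copyVal (hTS : T.length = depth S) (hT : ∀ t ∈ T, 0 ≤ t) (k o : Bool)
    (v : Fin d × S) :
    IsPolyMat (timeSet T) (fun p (M : Fin d → Matrix (Fin N) (Fin N) ℂ) =>
      copyVal x S T p.1 p.2 M k o v) := by
  have hv := startIdx_le (depth S) v.2.1
  have hθ : ∀ p ∈ timeSet T, ∀ l, 0 ≤ topTime T p.1 l := fun p hp l => by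
    have := monotone_topTime hT hp.1.le (Nat.zero_le l)
    rwa [topTime_zero] at this
  have hc : ∀ l, Continuous fun p : ℝ × ℝ => topTime T p.1 l := fun l =>
    (continuous_topTime T l).comp continuous_fst
  have hgap : ∀ l l', Continuous fun p : ℝ × ℝ =>
      ((gap (min p.2 (topTime T p.1 l)) (min p.2 (topTime T p.1 l')) : ℝ) : ℂ) := fun l l' =>
    Complex.continuous_ofReal.comp (continuous_gap.comp
      ((continuous_snd.min (hc l)).prodMk (continuous_snd.min (hc l'))))
  have hgap' : ∀ l l', Continuous fun p : ℝ × ℝ =>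
      ((gap (max p.2 (topTime T p.1 l)) (max p.2 (topTime T p.1 l')) : ℝ) : ℂ) := fun l l' =>
    Complex.continuous_ofReal.comp (continuous_gap.comp
      ((continuous_snd.max (hc l)).prodMk (continuous_snd.max (hc l'))))
  simp only [copyVal, copies, coefCopy, affVal, map_smul, map_sum, map_add,
    Finsupp.linearCombination_single, one_smul]
  refine IsPolyMat.add ?_ (isPolyMat_means continuous_fst
    (fun p hp => (ordTime_nonneg hT le_rfl).trans hp.1.le) hTS v)
  refine IsPolyMat.smul (K := Real.exp (ordTime T (startIdx (depth S) v.2.1 - 1) / 2)) ?_ ?_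
    (IsPolyMat.sum _ fun l _ => IsPolyMat.add ?_ ?_)
  · have h1 := hc (startIdx (depth S) v.2.1 - 1)
    fun_prop
  · intro p _
    rw [topTime_of_le (by omega), Complex.norm_real, Real.norm_of_nonneg (by positivity)]
  · refine IsPolyMat.smul (hgap _ _) (K := 1) (fun p hp => ?_) (IsPolyMat.const _)
    rw [Complex.norm_real]
    exact abs_gap_le (le_min hp.2.1 (hθ p hp _)) _
  · refine IsPolyMat.smul (hgap' _ _) (K := 1) (fun p hp => ?_) (IsPolyMat.const _)
    rw [Complex.norm_real]
    exact abs_gap_le (hp.2.1.trans (le_max_left _ _)) _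

theorem isPoly_of_tmul {α : Type*} [TopologicalSpace α] {U : Set α} {E F : Type*} [AddCommGroup E]
    [Module ℂ E] [AddCommGroup F] [Module ℂ F]
    {f : α → (Fin d → Matrix (Fin N) (Fin N) ℂ) → E ⊗[ℂ] F →ₗ[ℂ] ℂ}
    (h : ∀ P Q, IsPoly U fun a M => f a M (P ⊗ₜ Q)) (R : E ⊗[ℂ] F) :
    IsPoly U fun a M => f a M R := by
  induction R using TensorProduct.induction_on with
  | zero => simp only [map_zero]; exact IsPoly.const 0
  | tmul P Q => exact h P Q
  | add a b ha hb => simp only [map_add]; exact ha.add hb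

theorem isPoly_fourfold {α : Type*} [TopologicalSpace α] {U : Set α} {Y : Type*}
    {Z : α → (Fin d → Matrix (Fin N) (Fin N) ℂ) → Bool → Bool → Y → Matrix (Fin N) (Fin N) A}
    (hZ : ∀ k o v, IsPolyMat U fun a M => Z a M k o v)
    (Q : (FreeAlgebra ℂ Y ⊗[ℂ] FreeAlgebra ℂ Y) ⊗[ℂ] (FreeAlgebra ℂ Y ⊗[ℂ] FreeAlgebra ℂ Y)) :
    IsPoly U fun a M => fourfold τ (Z a M) Q := by
  refine isPoly_of_tmul (fun P Q => ?_) Q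
  refine isPoly_of_tmul (f := fun a M => fourfold τ (Z a M) ∘ₗ (TensorProduct.mk ℂ _ _).flip Q)
    (fun P P' => ?_) P
  refine isPoly_of_tmul (f := fun a M => fourfold τ (Z a M) ∘ₗ TensorProduct.mk ℂ _ _ (P ⊗ₜ P'))
    (fun Q Q' => ?_) Q
  simp only [LinearMap.comp_apply, TensorProduct.mk_apply, fourfold_tmul]
  exact (((IsPolyMat.lift (hZ _ _) _).mul (IsPolyMat.lift (hZ _ _) _)).mul
    ((IsPolyMat.lift (hZ _ _) _).mul (IsPolyMat.lift (hZ _ _) _))).traceN τ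

theorem isPoly_mixedContraction {α : Type*} [TopologicalSpace α] {U : Set α} {Y : Type*}
    {Z Z' : α → (Fin d → Matrix (Fin N) (Fin N) ℂ) → Y → Matrix (Fin N) (Fin N) A}
    (hZ : ∀ v, IsPolyMat U fun a M => Z a M v) (hZ' : ∀ v, IsPolyMat U fun a M => Z' a M v)
    (R : FreeAlgebra ℂ Y ⊗[ℂ] FreeAlgebra ℂ Y) :
    IsPoly U fun a M => mixedContraction τ (Z a M) (Z' a M) R := by
  refine isPoly_of_tmul (fun P Q => ?_) R
  simp only [mixedContraction, LinearMap.smul_apply, LinearMap.sum_apply,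
    LinearMap.comp_apply, TensorProduct.map_tmul, LinearMap.mul'_apply, LinearMap.mulLeft_apply,
    LinearMap.mulRight_apply, AlgHom.toLinearMap_apply, smul_eq_mul]
  exact (IsPoly.const _).mul (IsPoly.sum _ fun p _ => ((IsPolyMat.const _).mul
    (((IsPolyMat.lift hZ _).mul (IsPolyMat.const _)).mul (IsPolyMat.lift hZ' _))).traceN τ)

theorem isPoly_copies (hTS : T.length = depth S) (hT : ∀ t ∈ T, 0 ≤ t)
    (Q : (Poly d S ⊗[ℂ] Poly d S) ⊗[ℂ] (Poly d S ⊗[ℂ] Poly d S)) :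
    IsPoly (timeSet T) (fun p (M : Fin d → Matrix (Fin N) (Fin N) ℂ) =>
      fourfold τ (copyVal x S T p.1 p.2 M) Q) :=
  isPoly_fourfold (fun k o v => isPolyMat_copyVal hTS hT k o v) Q

/-! ### The difference of the product and of the contraction -/

theorem IsPoly.continuous_comp {α β E : Type*} [TopologicalSpace α] [TopologicalSpace β]
    [NormedAddCommGroup E] {U : Set α} {F : α → (Fin d → Matrix (Fin N) (Fin N) ℂ) → E}
    (hF : IsPoly U F) {f : β → α} (hf : Continuous f) (M : Fin d → Matrix (Fin N) (Fin N) ℂ) :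
    Continuous fun b => F (f b) M :=
  hF.1.comp (hf.prodMk continuous_const)

theorem continuous_mixedContraction_copyVal (hTS : T.length = depth S) (hT : ∀ t ∈ T, 0 ≤ t) (t : ℝ)
    (M : Fin d → Matrix (Fin N) (Fin N) ℂ) (R : Poly d S ⊗[ℂ] Poly d S) :
    Continuous fun u => mixedContraction τ (copyVal x S T t u M false false)
      (copyVal x S T t u M true false) R := by
  have h := (isPoly_mixedContraction (τ := τ) (fun v => isPolyMat_copyVal (x := x) hTS hT false false v)
    (fun v => isPolyMat_copyVal (x := x) hTS hT true false v) R)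
  exact h.continuous_comp (Continuous.prodMk_right t) M

theorem continuous_fourfold_copyVal (hTS : T.length = depth S) (hT : ∀ t ∈ T, 0 ≤ t) (t : ℝ)
    (M : Fin d → Matrix (Fin N) (Fin N) ℂ)
    (Q : (Poly d S ⊗[ℂ] Poly d S) ⊗[ℂ] (Poly d S ⊗[ℂ] Poly d S)) :
    Continuous fun u => ((Real.exp (-u) : ℝ) : ℂ) * fourfold τ (copyVal x S T t u M) Q := by
  have h := (isPoly_copies (τ := τ) (x := x) hTS hT Q).continuous_comp
    (Continuous.prodMk_right t) M
  have he : Continuous fun u : ℝ => ((Real.exp (-u) : ℝ) : ℂ) := by fun_prop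
  exact he.mul h

theorem integrableOn_copyL (hTS : T.length = depth S) (hT : ∀ t ∈ T, 0 ≤ t) (t : ℝ)
    (M : Fin d → Matrix (Fin N) (Fin N) ℂ) (R : Poly d S ⊗[ℂ] Poly d S) :
    IntegrableOn (fun u => copyL τ x S T t u M R) (Set.Icc 0 t) := by
  unfold copyL
  refine integrable_finsetSum _ fun s _ => ?_
  have h : Continuous fun u => ((Real.exp (-u) : ℝ) : ℂ) *
      fourfold τ (copyVal x S T t u M) (pairDeriv S T (s + 1) R) :=
    continuous_fourfold_copyVal hTS hT t M _
  exact (h.continuousOn.integrableOn_Icc (a := 0) (b := t) (μ := volume)).indicator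
    (measurableSet_Icc (a := topTime T t s) (b := topTime T t (s + 1)))

theorem hasDerivAt_mixedContraction_copyL {slot : ℕ → ℕ} (hS : Slotted S slot) (hτ : IsTrace τ)
    (hN : 1 ≤ N) (hx : IsFreeSemicircularSequence N τ x) (hTS : T.length = depth S)
    (hT : ∀ t ∈ T, 0 ≤ t) {t : ℝ} (ht : ordTime T T.length < t)
    (M : Fin d → Matrix (Fin N) (Fin N) ℂ) (R : Poly d S ⊗[ℂ] Poly d S) {u : ℝ} (h0u : 0 < u)
    (hut : u < t) (hne : ∀ l ≤ depth S + 1, topTime T t l ≠ u) :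
    HasDerivAt (fun u => mixedContraction τ (copyVal x S T t u M false false)
        (copyVal x S T t u M true false) R)
      (-(1 / (N : ℂ) ^ 2) * copyL τ x S T t u M R) u := by
  have hex : ∃ l, u < topTime T t l := ⟨depth S + 1, by rwa [topTime_of_lt (by omega)]⟩
  classical
  -- The first time exceeding u; the previous one is strictly below u, because u is not itself one
  -- of the times.
  set s := Nat.find hex with hs
  have hs2 : u < topTime T t s := Nat.find_spec hex
  have hs0 : s ≠ 0 := by
    intro e
    rw [e, topTime_zero] at hs2
    linarith
  obtain ⟨s', hs'⟩ : ∃ s', s = s' + 1 := ⟨s - 1, by omega⟩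
  have hsn : s ≤ depth S + 1 := Nat.find_min' hex (by rwa [topTime_of_lt (by omega)])
  have hs1 : topTime T t s' < u :=
    lt_of_le_of_ne (not_lt.1 (Nat.find_min hex (by omega))) (hne _ (by omega))
  rw [hs'] at hs2
  rw [copyL_eq hT ht.le M R (by omega) hs1 hs2]
  exact hasDerivAt_mixedContraction hS hτ hN hx hTS hT ht.le M R (by omega) (by omega) hs1 hs2

/-- The fundamental theorem of calculus in u, from fully correlated copies at u = 0 to independent
ones at u = t. The integrand is differentiable except at the finitely many times, and continuous
there. The cross covariance decreases in u, whence the sign. -/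
theorem tensorSq_sub_contraction {slot : ℕ → ℕ} (hS : Slotted S slot) (hτ : IsTrace τ)
    (hN : 1 ≤ N) (hx : IsFreeSemicircularSequence N τ x) (hTS : T.length = depth S)
    (hT : ∀ t ∈ T, 0 ≤ t) {t : ℝ}
    (ht : ordTime T T.length < t) (M : Fin d → Matrix (Fin N) (Fin N) ℂ)
    (R : Poly d S ⊗[ℂ] Poly d S) :
    tensorSq (traceN N τ ∘ₗ (FreeAlgebra.lift ℂ (plusVal x S T t M)).toLinearMap) R -
      contraction τ (plusVal x S T t M) R =
      -(1 / (N : ℂ) ^ 2) * ∫ u in Set.Icc 0 t, copyL τ x S T t u M R := by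
  have ht0 : 0 ≤ t := (ordTime_nonneg hT le_rfl).trans ht.le
  have hcont := continuous_mixedContraction_copyVal (τ := τ) (x := x) hTS hT t M R
  have hint : IntervalIntegrable (fun u => -(1 / (N : ℂ) ^ 2) * copyL τ x S T t u M R)
      volume 0 t :=
    ((intervalIntegrable_iff_integrableOn_Icc_of_le ht0).2
      (integrableOn_copyL hTS hT t M R)).const_mul _
  have h := integral_eq_of_hasDerivAt_off_countable_of_le
    (fun u => mixedContraction τ (copyVal x S T t u M false false)
        (copyVal x S T t u M true false) R)
    (fun u => -(1 / (N : ℂ) ^ 2) * copyL τ x S T t u M R) ht0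
    (s := (Finset.range (depth S + 2)).image (topTime T t)) (Finset.countable_toSet _)
    hcont.continuousOn (fun u hu => ?_) hint
  · rw [mixedContraction_copyVal_top hS hτ hN hx hTS hT ht.le,
      mixedContraction_copyVal_zero hS hτ hN hx hT ht.le] at h
    rw [← h, intervalIntegral.integral_const_mul, intervalIntegral.integral_of_le ht0,
      integral_Icc_eq_integral_Ioc]
  · refine hasDerivAt_mixedContraction_copyL hS hτ hN hx hTS hT ht M R hu.1.1 hu.1.2
      fun l hl e => hu.2 ?_
    exact Finset.mem_coe.2 (Finset.mem_image.2 ⟨l, Finset.mem_range.2 (by omega), e⟩)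

end Evolution

end

end MasterEquation

open MeasureTheory ProbabilityTheory
open scoped TensorProduct

namespace MasterEquation

noncomputable section

/-! ## The evolution in the last time -/

section Interpolation

variable {A : Type*} [CStarAlgebra A] {N d : ℕ} {τ : A →L[ℂ] ℂ}
  {x : ℕ → Fin d → Matrix (Fin N) (Fin N) A} {S : Finset (List ℕ)} {T : List ℝ}

/-- The factor `e^{t̃_{m-1}/2}`. -/
def startFactor (T : List ℝ) (I : S) : ℝ := Real.exp (ordTime T (startIdx (depth S) I.1 - 1) / 2)

theorem coef_gPlus (hTS : T.length = depth S) (t : ℝ) (i : Fin d) (I : S) :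
    coef (topTime T t) (depth S + 1) i (gPlus S I) = coef (ordTime T) (depth S) i I.1 +
      ((startFactor T I * gap (ordTime T T.length) t : ℝ) : ℂ) •
        Finsupp.single (maxLabel S + 1, i) 1 := by
  have hm := startIdx_le (depth S) I.1
  unfold coef startFactor
  rw [startIdx_gPlus, topTime_of_le (by omega), Icc_eq_Ico_succ, Finset.sum_Ico_succ_top hm,
    smul_add, Complex.ofReal_mul, smul_smul]
  congr 2
  · rw [← Icc_eq_Ico_succ]
    refine Finset.sum_congr rfl fun l hl => ?_
    rw [Finset.mem_Icc] at hl
    rw [topTime_of_le (by omega), topTime_of_le (by omega)]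
    have := (plusEntry_of_le I.2 hl.1 hl.2).1
    rw [plusEntry] at this
    rw [this]
  · rw [topTime_of_lt (l := depth S + 1) (by omega), Nat.add_sub_cancel,
      topTime_of_le (by omega), hTS]
  · have := plusEntry_last I.2
    rw [plusEntry] at this
    rw [this]

theorem meanCoef_gPlus (hTS : T.length = depth S) (t : ℝ) (I : S) :
    meanCoef (topTime T t) (depth S + 1) (gPlus S I) =
      ((startFactor T I * Real.exp (-t / 2) : ℝ) : ℂ) := by
  have hm := startIdx_le (depth S) I.1
  rw [meanCoef, startIdx_gPlus, topTime_of_le (by omega), topTime_of_lt (by omega),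
    Complex.ofReal_mul, startFactor]

/-- The labels occurring in S lie between 1 and c, so both x^{c+1}, used for the interpolation, and
x^0, used for its limit, are fresh. -/
theorem coef_apply_eq_zero {slot : ℕ → ℕ} (hS : Slotted S slot) (ϑ : ℕ → ℝ) (i j : Fin d) (I : S)
    {L : ℕ} (hL : L = 0 ∨ L = maxLabel S + 1) : coef ϑ (depth S) i I.1 (L, j) = 0 := by
  unfold coef
  rw [Finsupp.smul_apply, Finsupp.finsetSum_apply, Finset.sum_eq_zero, smul_zero]
  intro l hl
  rw [Finset.mem_Icc] at hl
  rw [Finsupp.smul_apply, Finsupp.single_apply, if_neg, smul_zero]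
  intro e
  have h1 := plusEntry_of_le I.2 hl.1 hl.2
  have h2 := (plusEntry_bounds hS I.2 hl.1 (by omega)).1
  have h3 := congrArg Prod.fst e
  simp only at h3
  omega

theorem dot_single_right {ι : Type*} (q : ι) (a : ι →₀ ℂ) : dot a (Finsupp.single q 1) = a q := by
  classical
  rw [dot, Finsupp.linearCombination_apply, Finsupp.sum]
  simp only [Finsupp.single_apply, smul_eq_mul, mul_ite, mul_one, mul_zero]
  rw [Finset.sum_ite_eq a.support q]
  simp only [Finsupp.mem_support_iff, ne_eq, ite_not]
  split_ifs with h
  · exact h.symm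
  · rfl

theorem dot_add_right {ι : Type*} (a b b' : ι →₀ ℂ) : dot a (b + b') = dot a b + dot a b' := by
  simp [dot, Finsupp.linearCombination_apply, Finsupp.sum, mul_add, Finset.sum_add_distrib]

theorem dot_smul_right {ι : Type*} (c : ℂ) (a b : ι →₀ ℂ) : dot a (c • b) = c * dot a b := by
  simp only [dot, Finsupp.linearCombination_apply, Finsupp.sum, Finset.mul_sum, Finsupp.smul_apply,
    smul_eq_mul]
  exact Finset.sum_congr rfl fun _ _ => by ring

theorem dot_add_single {ι : Type*} [DecidableEq ι] {a b : ι →₀ ℂ} {p q : ι} (ha : a q = 0)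
    (hb : b p = 0) (c c' : ℂ) :
    dot (a + c • Finsupp.single p 1) (b + c' • Finsupp.single q 1) =
      dot a b + c * c' * if p = q then 1 else 0 := by
  rw [dot_add_left, dot_add_right, dot_add_right, dot_smul_right, dot_smul_right, dot_smul_left,
    dot_smul_left, dot_single_right, dot_single_right, dot_single_left, ha, hb,
    Finsupp.single_apply]
  ring

theorem plusVal_eq (hTS : T.length = depth S) (t : ℝ) (M : Fin d → Matrix (Fin N) (Fin N) ℂ)
    (v : Fin d × S) : plusVal x S T t M v =
      Finsupp.linearCombination ℂ (fun q : ℕ × Fin d => x q.1 q.2)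
          (coef (ordTime T) (depth S) v.1 v.2.1) +
        ((startFactor T v.2 * gap (ordTime T T.length) t : ℝ) : ℂ) • x (maxLabel S + 1) v.1 +
        ((startFactor T v.2 * Real.exp (-t / 2) : ℝ) : ℂ) • matEmb A N (M v.1) := by
  rw [plusVal, means, affVal_eq, coef_gPlus hTS, meanCoef_gPlus hTS, map_add, map_smul,
    Finsupp.linearCombination_single, one_smul]

theorem plusVal_bot (hTS : T.length = depth S) (M : Fin d → Matrix (Fin N) (Fin N) ℂ) :
    plusVal x S T (ordTime T T.length) M = interp S T x fun i => matEmb A N (M i) := by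
  funext v
  have hm := startIdx_le (depth S) v.2.1
  rw [plusVal_eq hTS, interp_eq, gap_self, hTS, meanCoef, startFactor, mul_zero, Complex.ofReal_zero,
    zero_smul, add_zero, Complex.ofReal_mul]

theorem isPolyMat_plusVal (hTS : T.length = depth S) (hT : ∀ t ∈ T, 0 ≤ t) (v : Fin d × S) :
    IsPolyMat (Set.Ioi (ordTime T T.length)) (fun t (M : Fin d → Matrix (Fin N) (Fin N) ℂ) =>
      plusVal x S T t M v) := by
  have h0 := ordTime_nonneg hT (le_refl T.length)
  simp only [plusVal_eq hTS]
  refine ((IsPolyMat.const _).add (IsPolyMat.smul (K := startFactor T v.2) ?_ ?_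
    (IsPolyMat.const _))).add (IsPolyMat.smul (K := startFactor T v.2) ?_ ?_
    (IsPolyMat.matEmb (IsPolyMat.tuple _)))
  · exact Complex.continuous_ofReal.comp (continuous_const.mul
      (continuous_gap.comp (continuous_const.prodMk continuous_id)))
  · intro t _
    have hs : 0 ≤ startFactor T v.2 := (Real.exp_pos _).le
    rw [Complex.norm_real, norm_mul, Real.norm_of_nonneg hs]
    exact mul_le_of_le_one_right hs (abs_gap_le h0 _)
  · fun_prop
  · intro t ht
    have hs : 0 ≤ startFactor T v.2 := (Real.exp_pos _).le
    rw [Complex.norm_real, norm_mul, Real.norm_of_nonneg hs, Real.norm_of_nonneg (Real.exp_pos _).le]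
    refine mul_le_of_le_one_right hs (Real.exp_le_one_iff.2 ?_)
    have : ordTime T T.length < t := ht
    linarith

/-- The evaluation of the product functional. -/
theorem isPoly_tensorSq {α : Type*} [TopologicalSpace α] {U : Set α} {Y : Type*}
    {Z : α → (Fin d → Matrix (Fin N) (Fin N) ℂ) → Y → Matrix (Fin N) (Fin N) A}
    (hZ : ∀ v, IsPolyMat U fun a M => Z a M v) (R : FreeAlgebra ℂ Y ⊗[ℂ] FreeAlgebra ℂ Y) :
    IsPoly U fun a M => tensorSq (traceN N τ ∘ₗ (FreeAlgebra.lift ℂ (Z a M)).toLinearMap) R := by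
  refine isPoly_of_tmul (fun P Q => ?_) R
  simp only [tensorSq_tmul, LinearMap.comp_apply, AlgHom.toLinearMap_apply]
  exact ((IsPolyMat.lift hZ _).traceN τ).mul ((IsPolyMat.lift hZ _).traceN τ)

/-- The derivative of `τ_N(P)` along the interpolation, up to the factor `e^{-t/2}`. -/
def flow (τ : A →L[ℂ] ℂ) (x : ℕ → Fin d → Matrix (Fin N) (Fin N) A) (T : List ℝ) (P : Poly d S)
    (t : ℝ) (M : Fin d → Matrix (Fin N) (Fin N) ℂ) : ℂ :=
  ∑ i : Fin d, ∑ h ∈ Finset.range (depth S + 1), ((Real.exp (ordTime T h / 2) / 2 : ℝ) : ℂ) *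
    ((∑ k ∈ Finset.range (depth S + 1), ((Real.exp (ordTime T k / 2) * Real.exp (-t / 2) : ℝ) : ℂ) *
      tensorSq (traceN N τ ∘ₗ (FreeAlgebra.lift ℂ (plusVal x S T t M)).toLinearMap)
        (ncDerivLevel S i k (cycDerivLevel S i h P))) +
      -1 * traceN N τ (matEmb A N (M i) *
        FreeAlgebra.lift ℂ (plusVal x S T t M) (cycDerivLevel S i h P)))

theorem isPoly_flow (hTS : T.length = depth S) (hT : ∀ t ∈ T, 0 ≤ t) (P : Poly d S) :
    IsPoly (Set.Ioi (ordTime T T.length)) (fun t (M : Fin d → Matrix (Fin N) (Fin N) ℂ) =>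
      flow τ x T P t M) := by
  have h0 := ordTime_nonneg hT (le_refl T.length)
  refine IsPoly.sum _ fun i _ => IsPoly.sum _ fun h _ => (IsPoly.const _).mul (IsPoly.add
    (IsPoly.sum _ fun k _ => IsPoly.mul
      (IsPoly.of_param (K := Real.exp (ordTime T k / 2)) ?_ ?_) (isPoly_tensorSq
        (fun v => isPolyMat_plusVal hTS hT v) _)) ((IsPoly.const _).mul
    ((IsPolyMat.mul (IsPolyMat.matEmb (IsPolyMat.tuple i)) (IsPolyMat.lift
      (fun v => isPolyMat_plusVal hTS hT v) _)).traceN τ)))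
  · fun_prop
  · intro t ht
    have hs : 0 ≤ Real.exp (ordTime T k / 2) := (Real.exp_pos _).le
    rw [Complex.norm_real, norm_mul, Real.norm_of_nonneg hs, Real.norm_of_nonneg (Real.exp_pos _).le]
    refine mul_le_of_le_one_right hs (Real.exp_le_one_iff.2 ?_)
    have : ordTime T T.length < t := ht
    linarith

theorem sum_startFactor_ncDeriv (i : Fin d) :
    ∑ I : S, ((startFactor T I : ℝ) : ℂ) • ncDeriv (i, I) =
      ∑ h ∈ Finset.range (depth S + 1), ((Real.exp (ordTime T h / 2) : ℝ) : ℂ) •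
        ncDerivLevel S i h :=
  (sum_level_all S (fun h => ((Real.exp (ordTime T h / 2) : ℝ) : ℂ))
    fun I => ncDeriv (i, I)).symm

theorem hasDerivAt_gap {a t : ℝ} (h : a < t) :
    HasDerivAt (gap a) (Real.exp (-t) / (2 * gap a t)) t := by
  have hpos : Real.exp (-a) - Real.exp (-t) ≠ 0 :=
    (sub_pos.2 (Real.exp_lt_exp.2 (neg_lt_neg h))).ne'
  have h1 : HasDerivAt (fun t => Real.exp (-a) - Real.exp (-t)) (Real.exp (-t)) t := by
    have := ((hasDerivAt_neg t).exp).const_sub (Real.exp (-a))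
    simpa using this
  exact h1.sqrt hpos

/-- The coefficient of x^{c+1} has derivative e^{-t}/(2γ) up to the start factor, singular as t →
t̃_n. The Schwinger-Dyson equation returns the covariance of x^{c+1} with a variable, which contains
γ, and the singularity cancels. -/
theorem hasDerivAt_traceN_plusVal {slot : ℕ → ℕ} (hS : Slotted S slot) (hτ : IsTrace τ) (hN : 1 ≤ N)
    (hx : IsFreeSemicircularSequence N τ x) (hTS : T.length = depth S) {t : ℝ}
    (ht : ordTime T T.length < t) (M : Fin d → Matrix (Fin N) (Fin N) ℂ) (P : Poly d S) :
    HasDerivAt (fun t => traceN N τ (FreeAlgebra.lift ℂ (plusVal x S T t M) P))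
      (((Real.exp (-t / 2) : ℝ) : ℂ) * flow τ x T P t M) t := by
  set γ := gap (ordTime T T.length) t with hγ
  have hγ0 : γ ≠ 0 := (Real.sqrt_pos.2 (sub_pos.2 (Real.exp_lt_exp.2 (neg_lt_neg ht)))).ne'
  set Z' : Fin d × S → Matrix (Fin N) (Fin N) A := fun v =>
    ((startFactor T v.2 * (Real.exp (-t) / (2 * γ)) : ℝ) : ℂ) • x (maxLabel S + 1) v.1 +
      ((startFactor T v.2 * (-(1 / 2) * Real.exp (-t / 2)) : ℝ) : ℂ) • matEmb A N (M v.1) with hZ'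
  have hZ : ∀ v r s, HasDerivAt (fun t => plusVal x S T t M v r s) (Z' v r s) t := by
    intro v r s
    simp only [plusVal_eq hTS, Matrix.add_apply, Matrix.smul_apply, hZ']
    have h1 := ((hasDerivAt_gap ht).const_mul (startFactor T v.2)).ofReal_comp.smul_const
      (x (maxLabel S + 1) v.1 r s)
    have h2e : HasDerivAt (fun t : ℝ => Real.exp (-t / 2)) (-(1 / 2) * Real.exp (-t / 2)) t := by
      have := ((hasDerivAt_neg t).div_const 2).exp
      refine this.congr_deriv ?_
      ring
    have h2 := (h2e.const_mul (startFactor T v.2)).ofReal_comp.smul_const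
      (matEmb A N (M v.1) r s)
    exact (h1.const_add _).add h2
  refine (hasDerivAt_traceN τ (hasDerivAt_lift hZ P)).congr_deriv ?_
  set Z := plusVal x S T t M with hZdef
  have hD : ∀ v, traceN N τ (sandwich (Z' v) Z (ncDeriv v P)) =
      ((startFactor T v.2 * (Real.exp (-t) / 2) : ℝ) : ℂ) * (∑ I : S, ((startFactor T I : ℝ) : ℂ) *
        tensorSq (traceN N τ ∘ₗ (FreeAlgebra.lift ℂ Z).toLinearMap)
          (ncDeriv (v.1, I) (mulOp (ncDeriv v P)))) -
      ((startFactor T v.2 * (1 / 2 * Real.exp (-t / 2)) : ℝ) : ℂ) *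
        traceN N τ (matEmb A N (M v.1) * FreeAlgebra.lift ℂ Z (mulOp (ncDeriv v P))) := by
    intro v
    rw [trace_sandwich _ (traceN_mul_comm hτ)]
    simp only [hZ']
    rw [add_mul, map_add, smul_mul_assoc, smul_mul_assoc, map_smul, map_smul, smul_eq_mul,
      smul_eq_mul]
    -- Since c+1 is fresh, x_i^{c+1} is correlated only with variables of the same i, and only
    -- through their last coefficient.
    have hx1 := traceN_mul_lift_affVal hτ hN hx (fun v : Fin d × S =>
      (coef (topTime T t) (depth S + 1) v.1 (gPlus S v.2.1), means T t M v))
      (Finsupp.single (maxLabel S + 1, v.1) 1) (mulOp (ncDeriv v P))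
    rw [Finsupp.linearCombination_single, one_smul] at hx1
    change traceN N τ (x (maxLabel S + 1) v.1 * FreeAlgebra.lift ℂ Z _) =
      ∑ w : Fin d × S, _ * tensorSq (traceN N τ ∘ₗ (FreeAlgebra.lift ℂ Z).toLinearMap) _ at hx1
    rw [hx1, Fintype.sum_prod_type, Finset.sum_eq_single v.1]
    · simp only [dot_single_left, coef_gPlus hTS, Finsupp.add_apply, Finsupp.smul_apply,
        coef_apply_eq_zero hS (ordTime T) _ _ _ (Or.inr rfl), Finsupp.single_eq_same, zero_add,
        smul_eq_mul, mul_one, ← hγ]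
      rw [sub_eq_add_neg, ← neg_mul]
      congr 1
      · rw [Finset.mul_sum, Finset.mul_sum]
        refine Finset.sum_congr rfl fun I _ => ?_
        rw [← mul_assoc, ← mul_assoc, ← Complex.ofReal_mul, ← Complex.ofReal_mul]
        congr 2
        field_simp
      · rw [← Complex.ofReal_neg]
        congr 2
        ring
    · intro j _ hj
      refine Finset.sum_eq_zero fun I _ => ?_
      rw [dot_single_left, coef_gPlus hTS, Finsupp.add_apply, Finsupp.smul_apply,
        coef_apply_eq_zero hS (ordTime T) _ _ _ (Or.inr rfl), Finsupp.single_apply, if_neg]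
      · simp
      · exact fun e => hj (congrArg Prod.snd e)
    · simp
  rw [map_sum, Finset.sum_congr rfl fun v _ => hD v, Fintype.sum_prod_type, flow, Finset.mul_sum]
  refine Finset.sum_congr rfl fun i _ => ?_
  -- the sums over the levels
  have hlin : ∀ (φ : Poly d S ⊗[ℂ] Poly d S →ₗ[ℂ] ℂ) (Q : Poly d S),
      ∑ I : S, ((startFactor T I : ℝ) : ℂ) * φ (ncDeriv (i, I) Q) =
        ∑ h ∈ Finset.range (depth S + 1), ((Real.exp (ordTime T h / 2) : ℝ) : ℂ) *
          φ (ncDerivLevel S i h Q) := by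
    intro φ Q
    have := congrArg (fun f : Poly d S →ₗ[ℂ] Poly d S ⊗[ℂ] Poly d S => φ (f Q))
      (sum_startFactor_ncDeriv (S := S) (T := T) i)
    simpa only [LinearMap.sum_apply, LinearMap.smul_apply, map_sum, map_smul, smul_eq_mul] using this
  -- The inner bracket is a linear functional of the first derivative ∂_{i,I} P; this allows the
  -- outer sum over indices to be regrouped by levels as well.
  let φ : Poly d S ⊗[ℂ] Poly d S →ₗ[ℂ] ℂ :=
    (∑ k ∈ Finset.range (depth S + 1), ((Real.exp (ordTime T k / 2) * (Real.exp (-t) / 2) : ℝ) : ℂ) •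
      (tensorSq (traceN N τ ∘ₗ (FreeAlgebra.lift ℂ Z).toLinearMap) ∘ₗ ncDerivLevel S i k ∘ₗ mulOp)) -
    ((1 / 2 * Real.exp (-t / 2) : ℝ) : ℂ) • (traceN N τ ∘ₗ LinearMap.mulLeft ℂ (matEmb A N (M i)) ∘ₗ
      (FreeAlgebra.lift ℂ Z).toLinearMap ∘ₗ mulOp)
  have hexp : Real.exp (-t) = Real.exp (-t / 2) * Real.exp (-t / 2) := by
    rw [← Real.exp_add]; congr 1; ring
  have h := hlin φ P
  simp only [φ, LinearMap.sub_apply, LinearMap.sum_apply, LinearMap.smul_apply, smul_eq_mul,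
    LinearMap.comp_apply, AlgHom.toLinearMap_apply, LinearMap.mulLeft_apply] at h
  refine Eq.trans (Finset.sum_congr rfl fun I _ => ?_) (h.trans ?_)
  · rw [hlin]
    simp only [mul_sub, Finset.mul_sum, ← mul_assoc, ← Complex.ofReal_mul]
    congr 1
    refine Finset.sum_congr rfl fun k _ => ?_
    congr 2
    ring
  · rw [Finset.mul_sum]
    refine Finset.sum_congr rfl fun h _ => ?_
    simp only [cycDerivLevel, LinearMap.comp_apply]
    rw [hexp]
    simp only [mul_sub, mul_add, Finset.mul_sum, ← mul_assoc]
    rw [sub_eq_add_neg]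
    congr 1
    · refine Finset.sum_congr rfl fun k _ => ?_
      push_cast
      ring
    · push_cast
      ring

theorem IsPoly.integrableOn {α : Type*} [TopologicalSpace α] [SecondCountableTopology α]
    [MeasurableSpace α] [BorelSpace α] {ν : Measure α} {U : Set α} (hU : MeasurableSet U) {c : α → ℂ}
    (hc : IntegrableOn c U ν) {F : α → (Fin d → Matrix (Fin N) (Fin N) ℂ) → ℂ} (hF : IsPoly U F)
    (M : Fin d → Matrix (Fin N) (Fin N) ℂ) : IntegrableOn (fun a => c a * F a M) U ν := by
  have hcont := hF.continuous_comp continuous_id M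
  obtain ⟨-, K, k, hK, hF⟩ := hF
  refine Integrable.mul_bdd (c := K * gnorm M ^ k) hc hcont.aestronglyMeasurable ?_
  exact (ae_restrict_iff' hU).2 (ae_of_all _ fun a ha => hF a ha M)

/-- Moments are continuous functions of the covariances and means, so their convergence suffices;
the elements themselves need not converge. -/
theorem tendsto_traceN_affVal {Y : Type*} (hτ : IsTrace τ) (hN : 1 ≤ N)
    (hx : IsFreeSemicircularSequence N τ x) {f : ℝ → Y → (ℕ × Fin d →₀ ℂ) × Matrix (Fin N) (Fin N) ℂ}
    {f' : Y → (ℕ × Fin d →₀ ℂ) × Matrix (Fin N) (Fin N) ℂ} {l : Filter ℝ}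
    (hC : ∀ v w, Filter.Tendsto (fun t => dot (f t v).1 (f t w).1) l
      (nhds (dot (f' v).1 (f' w).1)))
    (hM : ∀ v, Filter.Tendsto (fun t => (f t v).2) l (nhds (f' v).2)) (P : FreeAlgebra ℂ Y) :
    Filter.Tendsto (fun t => traceN N τ (FreeAlgebra.lift ℂ (fun v => affVal x (f t v)) P)) l
      (nhds (traceN N τ (FreeAlgebra.lift ℂ (fun v => affVal x (f' v)) P))) := by
  have hcont : Continuous fun q : (Y → Y → ℂ) × (Y → Matrix (Fin N) (Fin N) ℂ) =>
      ntr N (momL q.1 q.2 P) :=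
    continuous_ntr.comp (continuous_momL
      (fun a b => (continuous_apply b).comp ((continuous_apply a).comp continuous_fst))
      (fun a => (continuous_apply a).comp continuous_snd) P)
  simp only [traceN_eq, entryMean_lift_affVal hτ hN hx]
  have h1 : Filter.Tendsto (fun t v w => dot (f t v).1 (f t w).1) l
      (nhds fun v w => dot (f' v).1 (f' w).1) :=
    tendsto_pi_nhds.2 fun v => tendsto_pi_nhds.2 fun w => hC v w
  have h2 : Filter.Tendsto (fun t v => (f t v).2) l (nhds fun v => (f' v).2) :=
    tendsto_pi_nhds.2 hM
  have h3 := Filter.Tendsto.comp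
    (hcont.tendsto (fun v w => dot (f' v).1 (f' w).1, fun v => (f' v).2)) (h1.prodMk_nhds h2)
  simp only [Function.comp_def] at h3
  exact h3

theorem tendsto_gap_atTop (a : ℝ) :
    Filter.Tendsto (fun t => gap a t) Filter.atTop (nhds (Real.exp (-a / 2))) := by
  have : Real.exp (-a / 2) = Real.sqrt (Real.exp (-a) - 0) := by rw [sub_zero, Real.exp_half]
  rw [this]
  refine (Real.continuous_sqrt.tendsto _).comp (Filter.Tendsto.sub tendsto_const_nhds ?_)
  exact Real.tendsto_exp_neg_atTop_nhds_zero

theorem tendsto_exp_neg_half_atTop :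
    Filter.Tendsto (fun t : ℝ => Real.exp (-t / 2)) Filter.atTop (nhds 0) := by
  refine Real.tendsto_exp_atBot.comp ?_
  have : (fun t : ℝ => -t / 2) = fun t => -(t / 2) := by funext t; ring
  rw [this]
  exact Filter.tendsto_neg_atTop_atBot.comp (Filter.tendsto_id.atTop_div_const (by norm_num))

theorem interp_free_eq (hTS : T.length = depth S) (v : Fin d × S) :
    interp S T x (x 0) v = affVal x (coef (ordTime T) (depth S) v.1 v.2.1 + ((startFactor T v.2 *
      Real.exp (-ordTime T T.length / 2) : ℝ) : ℂ) • Finsupp.single (0, v.1) 1, 0) := by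
  simp only [interp_eq, affVal, map_zero, add_zero, map_add, map_smul,
    Finsupp.linearCombination_single, one_smul, hTS, meanCoef, startFactor, Complex.ofReal_mul]

/-- The means tend to 0 and (e^{-t̃_n} - e^{-t})^{1/2} to e^{-t̃_n/2}. In the limit x^{c+1} occupies
the place of x^0 in x^{T_n}; as both labels are fresh, the covariances coincide. -/
theorem tendsto_traceN_plusVal {slot : ℕ → ℕ} (hS : Slotted S slot) (hτ : IsTrace τ) (hN : 1 ≤ N)
    (hx : IsFreeSemicircularSequence N τ x) (hTS : T.length = depth S)
    (M : Fin d → Matrix (Fin N) (Fin N) ℂ) (P : Poly d S) :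
    Filter.Tendsto (fun t => traceN N τ (FreeAlgebra.lift ℂ (plusVal x S T t M) P)) Filter.atTop
      (nhds (traceFree τ x T P)) := by
  have hC : ∀ v w : Fin d × S, Filter.Tendsto (fun t =>
      dot (coef (topTime T t) (depth S + 1) v.1 (gPlus S v.2.1))
        (coef (topTime T t) (depth S + 1) w.1 (gPlus S w.2.1))) Filter.atTop
      (nhds (dot (coef (ordTime T) (depth S) v.1 v.2.1 + ((startFactor T v.2 *
          Real.exp (-ordTime T T.length / 2) : ℝ) : ℂ) • Finsupp.single (0, v.1) 1)
        (coef (ordTime T) (depth S) w.1 w.2.1 + ((startFactor T w.2 *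
          Real.exp (-ordTime T T.length / 2) : ℝ) : ℂ) • Finsupp.single (0, w.1) 1))) := by
    intro v w
    simp only [coef_gPlus hTS]
    simp only [dot_add_single (coef_apply_eq_zero hS _ _ _ _ (Or.inr rfl))
      (coef_apply_eq_zero hS _ _ _ _ (Or.inr rfl)),
      dot_add_single (coef_apply_eq_zero hS _ _ _ _ (Or.inl rfl))
      (coef_apply_eq_zero hS _ _ _ _ (Or.inl rfl)), Prod.mk.injEq, true_and]
    have hgc : ∀ a : ℝ, Filter.Tendsto
        (fun t => ((a * gap (ordTime T T.length) t : ℝ) : ℂ)) Filter.atTop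
        (nhds ((a * Real.exp (-ordTime T T.length / 2) : ℝ) : ℂ)) := fun a =>
      (Complex.continuous_ofReal.tendsto _).comp ((tendsto_gap_atTop _).const_mul a)
    exact (((hgc _).mul (hgc _)).mul_const _).const_add _
  have hM : ∀ v : Fin d × S, Filter.Tendsto (fun t => means T t M v) Filter.atTop (nhds 0) := by
    intro v
    simp only [means, meanCoef_gPlus hTS]
    have := ((Complex.continuous_ofReal.tendsto _).comp
      (tendsto_exp_neg_half_atTop.const_mul (startFactor T v.2))).smul_const (M v.1)
    simpa using this
  have h := tendsto_traceN_affVal hτ hN hx (f := fun t v =>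
    (coef (topTime T t) (depth S + 1) v.1 (gPlus S v.2.1), means T t M v))
    (f' := fun v => (coef (ordTime T) (depth S) v.1 v.2.1 + ((startFactor T v.2 *
      Real.exp (-ordTime T T.length / 2) : ℝ) : ℂ) • Finsupp.single (0, v.1) 1, 0)) hC hM P
  rw [← funext (interp_free_eq hTS)] at h
  exact h

theorem integrableOn_exp_neg_half (a : ℝ) :
    IntegrableOn (fun t : ℝ => ((Real.exp (-t / 2) : ℝ) : ℂ)) (Set.Ioi a) := by
    have h : IntegrableOn (fun t : ℝ => ((Real.exp (-(1 / 2) * t) : ℝ) : ℂ))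
        (Set.Ioi a) :=
      (integrableOn_exp_mul_Ioi (a := -(1 / 2)) (by norm_num) a).ofReal
    refine h.congr_fun (fun t _ => ?_) measurableSet_Ioi
    dsimp only
    rw [show -(1 / 2) * t = -t / 2 by ring]

/-- The fundamental theorem of calculus along the interpolation. -/
theorem integral_flow {slot : ℕ → ℕ} (hS : Slotted S slot) (hτ : IsTrace τ) (hN : 1 ≤ N)
    (hx : IsFreeSemicircularSequence N τ x) (hTS : T.length = depth S) (hT : ∀ t ∈ T, 0 ≤ t)
    (M : Fin d → Matrix (Fin N) (Fin N) ℂ) (P : Poly d S) :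
    ∫ t in Set.Ioi (ordTime T T.length), ((Real.exp (-t / 2) : ℝ) : ℂ) * flow τ x T P t M =
      traceFree τ x T P - traceAt τ x T P M := by
  have hcont : Continuous fun t => traceN N τ (FreeAlgebra.lift ℂ (plusVal x S T t M) P) :=
    ((IsPolyMat.lift (fun v => isPolyMat_plusVal hTS hT v) P).traceN τ).continuous_comp
      continuous_id M
  have h := integral_Ioi_of_hasDerivAt_of_tendsto hcont.continuousWithinAt
    (fun t ht => hasDerivAt_traceN_plusVal hS hτ hN hx hTS ht M P)
    (IsPoly.integrableOn measurableSet_Ioi (integrableOn_exp_neg_half _) (isPoly_flow hTS hT P) M)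
    (tendsto_traceN_plusVal hS hτ hN hx hTS M P)
  rw [h, plusVal_bot hTS]
  rfl

end Interpolation

end

end MasterEquation

open MeasureTheory ProbabilityTheory
open scoped TensorProduct

namespace MasterEquation

noncomputable section

/-! ## Expectations -/

section Expectation

variable {A : Type*} [CStarAlgebra A] {N d : ℕ} {τ : A →L[ℂ] ℂ}
  {x : ℕ → Fin d → Matrix (Fin N) (Fin N) A} {S : Finset (List ℕ)} {T : List ℝ}
  {Ω : Type*} [MeasurableSpace Ω] {μ : Measure Ω} {X : Fin d → Ω → Matrix (Fin N) (Fin N) ℂ}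
  {V : FreeAlgebra ℂ (Fin d)}

theorem isPoly_traceAt {α : Type*} [TopologicalSpace α] {U : Set α} (T : List ℝ) (Q : Poly d S) :
    IsPoly U fun (_ : α) (M : Fin d → Matrix (Fin N) (Fin N) ℂ) => traceAt τ x T Q M := by
  refine (IsPolyMat.lift (fun v => ?_) Q).traceN τ
  unfold interp
  exact IsPolyMat.smul continuous_const (fun _ _ => le_rfl) ((IsPolyMat.const _).add
    (IsPolyMat.smul continuous_const (fun _ _ => le_rfl) (IsPolyMat.matEmb (IsPolyMat.tuple _))))

theorem integrable_weighted (hX : IsGUETuple μ X) (hV : WeightIntegrable μ X V) (T : List ℝ)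
    (Q : Poly d S) : Integrable (fun ω => weighted τ x V X T Q ω) μ :=
  (isPoly_traceAt (U := (Set.univ : Set Unit)) T Q).integrable hX hV (a := ()) trivial

theorem integrable_weight (hX : IsGUETuple μ X) (hV : WeightIntegrable μ X V) :
    Integrable (fun ω => weight V fun i => X i ω) μ := by
  simpa using (IsPoly.const (1 : ℂ)).integrable (S := (Set.univ : Set Unit)) hX hV (a := ())
    trivial

theorem isPoly_contraction {α : Type*} [TopologicalSpace α] {U : Set α} {Y : Type*}
    {Z : α → (Fin d → Matrix (Fin N) (Fin N) ℂ) → Y → Matrix (Fin N) (Fin N) A}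
    (hZ : ∀ v, IsPolyMat U fun a M => Z a M v)
    (R : FreeAlgebra ℂ Y ⊗[ℂ] FreeAlgebra ℂ Y) :
    IsPoly U fun a M => contraction τ (Z a M) R := by
  simp only [contraction_apply]
  exact (IsPoly.const _).mul (IsPoly.sum _ fun p _ => ((IsPolyMat.const _).mul
    (IsPolyMat.sandwich (IsPolyMat.const _) hZ R)).traceN τ)

/-- The expectation of `F(X^N) e^{-N tr_N(V(X^N))}`. -/
def expect (μ : Measure Ω) (X : Fin d → Ω → Matrix (Fin N) (Fin N) ℂ) (V : FreeAlgebra ℂ (Fin d))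
    (F : (Fin d → Matrix (Fin N) (Fin N) ℂ) → ℂ) : ℂ :=
  ∫ ω, F (fun i => X i ω) * weight V (fun i => X i ω) ∂μ

theorem expect_const_mul (c : ℂ) (F : (Fin d → Matrix (Fin N) (Fin N) ℂ) → ℂ) :
    expect μ X V (fun M => c * F M) = c * expect μ X V F := by
  simp only [expect, mul_assoc, integral_const_mul]

theorem IsPoly.at_param {α : Type*} [TopologicalSpace α] {U : Set α}
    {F : α → (Fin d → Matrix (Fin N) (Fin N) ℂ) → ℂ} (hF : IsPoly U F) {a : α} (ha : a ∈ U) :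
    IsPoly (Set.univ : Set Unit) fun _ M => F a M :=
  hF.comp_param (f := fun _ => a) continuous_const fun _ _ => ha

theorem expect_add (hX : IsGUETuple μ X) (hV : WeightIntegrable μ X V)
    {F G : (Fin d → Matrix (Fin N) (Fin N) ℂ) → ℂ}
    (hF : IsPoly (Set.univ : Set Unit) fun _ M => F M)
    (hG : IsPoly (Set.univ : Set Unit) fun _ M => G M) :
    expect μ X V (fun M => F M + G M) = expect μ X V F + expect μ X V G := by
  simp only [expect, add_mul]
  exact integral_add (hF.integrable hX hV (a := ()) trivial)
    (hG.integrable hX hV (a := ()) trivial)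

theorem expect_sum (hX : IsGUETuple μ X) (hV : WeightIntegrable μ X V) {ι : Type*} (s : Finset ι)
    {F : ι → (Fin d → Matrix (Fin N) (Fin N) ℂ) → ℂ}
    (hF : ∀ i, IsPoly (Set.univ : Set Unit) fun _ M => F i M) :
    expect μ X V (fun M => ∑ i ∈ s, F i M) = ∑ i ∈ s, expect μ X V (F i) := by
  simp only [expect, Finset.sum_mul]
  exact integral_finsetSum _ fun i _ => (hF i).integrable hX hV (a := ()) trivial

/-! ### The operator `∇_V` -/

/-- The trace of `V'_i D(Z)`, where `V'_i` is the cyclic derivative of `V` along the matrices. -/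
def potentialTerm (τ : A →L[ℂ] ℂ) (V : FreeAlgebra ℂ (Fin d)) (i : Fin d) {Y : Type*}
    (M : Fin d → Matrix (Fin N) (Fin N) ℂ) (Z : Y → Matrix (Fin N) (Fin N) A)
    (D : FreeAlgebra ℂ Y) : ℂ :=
  traceN N τ (matEmb A N (FreeAlgebra.lift ℂ M (mulOp (ncDeriv i V))) * FreeAlgebra.lift ℂ Z D)

theorem isPoly_potentialTerm {α : Type*} [TopologicalSpace α] {U : Set α} {Y : Type*}
    {Z : α → (Fin d → Matrix (Fin N) (Fin N) ℂ) → Y → Matrix (Fin N) (Fin N) A}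
    (hZ : ∀ v, IsPolyMat U fun a M => Z a M v) (i : Fin d) (D : FreeAlgebra ℂ Y) :
    IsPoly U fun a M => potentialTerm τ V i M (Z a M) D :=
  ((IsPolyMat.matEmb (IsPolyMat.lift (A := ℂ) (fun v => IsPolyMat.tuple v) _)).mul
    (IsPolyMat.lift hZ _)).traceN τ

theorem lift_interp_substEmpty (hT : ∀ t ∈ T, 0 ≤ t) {t : ℝ} (ht : ordTime T T.length ≤ t)
    (M : Fin d → Matrix (Fin N) (Fin N) ℂ) (Q : FreeAlgebra ℂ (Fin d)) :
    FreeAlgebra.lift ℂ (interp (setG S) (t :: T) x fun i => matEmb A N (M i))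
      (substEmpty (nil_mem_setG S) Q) = matEmb A N (FreeAlgebra.lift ℂ M Q) := by
  have h : (FreeAlgebra.lift ℂ (interp (setG S) (t :: T) x fun i => matEmb A N (M i))).comp
      (substEmpty (nil_mem_setG S)) =
        (matEmb A N : Matrix (Fin N) (Fin N) ℂ →ₐ[ℂ] _).comp (FreeAlgebra.lift ℂ M) := by
    ext i
    simp [substEmpty, interp_nil hT ht]
  exact DFunLike.congr_fun h Q

/-- The order of 𝒟_{i,h} P and 𝒟_i V is exchanged by the trace property, to match the form delivered
by integration by parts. -/
theorem traceAt_nablaV (hτ : IsTrace τ) (hTS : T.length = depth S) (hT : ∀ t ∈ T, 0 ≤ t) {t : ℝ}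
    (ht : ordTime T T.length ≤ t) (M : Fin d → Matrix (Fin N) (Fin N) ℂ) (P : Poly d S) :
    traceAt τ x (t :: T) (nablaV S V T t P) M = ((Real.exp (-t / 2) : ℝ) : ℂ) *
      ∑ i : Fin d, ∑ h ∈ Finset.range (depth S + 1), ((Real.exp (ordTime T h / 2) / 2 : ℝ) : ℂ) *
        potentialTerm τ V i M (plusVal x S T t M) (cycDerivLevel S i h P) := by
  rw [traceAt, nablaV]
  simp only [map_smul, map_sum, map_mul, smul_eq_mul, Finset.mul_sum]
  refine Finset.sum_congr rfl fun i _ => Finset.sum_congr rfl fun h _ => ?_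
  rw [lift_interp_subst (gPlus_mem S) (Z := plusVal x S T t M) (fun v => interp_gPlus hTS hT ht M v),
    lift_interp_substEmpty hT ht, traceN_mul_comm hτ, sub_div, sub_eq_add_neg, ← neg_div,
    Real.exp_add]
  push_cast
  simp only [potentialTerm]
  ring

/-! ### Integration by parts -/

/-- Gaussian integration by parts with the matrix coefficient e^{t̃_k/2} e^{-t/2} of an index on
level k; the fixed semicircular part plays the role of a constant. -/
theorem expect_traceN_mul_plusVal [IsProbabilityMeasure μ] (hN : 1 ≤ N) (hX : IsGUETuple μ X)
    (hV : WeightIntegrable μ X V) (hTS : T.length = depth S) (hT : ∀ t ∈ T, 0 ≤ t) {t : ℝ}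
    (ht : ordTime T T.length < t) (i : Fin d) (D : Poly d S) :
    expect μ X V (fun M => traceN N τ (matEmb A N (M i) *
        FreeAlgebra.lift ℂ (plusVal x S T t M) D)) =
      (∑ k ∈ Finset.range (depth S + 1),
        ((Real.exp (ordTime T k / 2) * Real.exp (-t / 2) : ℝ) : ℂ) *
          expect μ X V (fun M => contraction τ (plusVal x S T t M) (ncDerivLevel S i k D))) -
      expect μ X V (fun M => potentialTerm τ V i M (plusVal x S T t M) D) := by
  have h := integral_traceN_mul_lift hN hX hV (τ := τ)
    (fun v : Fin d × S => Finsupp.linearCombination ℂ (fun q : ℕ × Fin d => x q.1 q.2)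
      (coef (topTime T t) (depth S + 1) v.1 (gPlus S v.2)))
    (fun v => meanCoef (topTime T t) (depth S + 1) (gPlus S v.2)) (fun v => v.1) i D
  have hZ : ∀ M : Fin d → Matrix (Fin N) (Fin N) ℂ, (fun v : Fin d × S =>
      Finsupp.linearCombination ℂ (fun q : ℕ × Fin d => x q.1 q.2)
      (coef (topTime T t) (depth S + 1) v.1 (gPlus S v.2)) +
      meanCoef (topTime T t) (depth S + 1) (gPlus S v.2) • matEmb A N (M v.1)) =
      plusVal x S T t M := fun M => funext fun v => by rw [plusVal, means, affVal_eq]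
  have hZ' := fun ω => hZ fun i => X i ω
  simp only [hZ'] at h
  refine h.trans (congrArg₂ _ ?_ rfl)
  have hcon := fun R : Poly d S ⊗[ℂ] Poly d S =>
    isPoly_contraction (τ := τ) (fun v => isPolyMat_plusVal (x := x) hTS hT v) R
  -- the expectation of the contraction as a linear functional
  let φ : Poly d S ⊗[ℂ] Poly d S →ₗ[ℂ] ℂ :=
    { toFun := fun R => expect μ X V (fun M => contraction τ (plusVal x S T t M) R)
      map_add' := fun R R' => by
        simp only [map_add]
        exact expect_add hX hV ((hcon R).at_param ht) ((hcon R').at_param ht)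
      map_smul' := fun c R => by
        simp only [map_smul, smul_eq_mul, expect_const_mul, RingHom.id_apply] }
  change ∑ v : Fin d × S, _ * φ (ncDeriv v D) = ∑ k ∈ Finset.range (depth S + 1), _ * φ _
  rw [Fintype.sum_prod_type, Finset.sum_eq_single i]
  · have hs := congrArg (fun f : Poly d S →ₗ[ℂ] Poly d S ⊗[ℂ] Poly d S => φ (f D))
      (sum_startFactor_ncDeriv (S := S) (T := T) i)
    simp only [LinearMap.sum_apply, LinearMap.smul_apply, map_sum, map_smul, smul_eq_mul] at hs
    have hs' := congrArg (fun z => ((Real.exp (-t / 2) : ℝ) : ℂ) * z) hs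
    simp only [Finset.mul_sum] at hs'
    simp only [if_true, meanCoef_gPlus hTS]
    refine Eq.trans ?_ (hs'.trans ?_)
    · refine Finset.sum_congr rfl fun I _ => ?_
      push_cast
      ring
    · refine Finset.sum_congr rfl fun I _ => ?_
      push_cast
      ring
  · intro j _ hj
    exact Finset.sum_eq_zero fun I _ => by rw [if_neg hj, zero_mul]
  · simp

/-- The flow with the product functional replaced by the contraction. -/
def contractedFlow (τ : A →L[ℂ] ℂ) (x : ℕ → Fin d → Matrix (Fin N) (Fin N) A) (T : List ℝ)
    (P : Poly d S) (t : ℝ) (M : Fin d → Matrix (Fin N) (Fin N) ℂ) : ℂ :=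
  ∑ i : Fin d, ∑ h ∈ Finset.range (depth S + 1), ((Real.exp (ordTime T h / 2) / 2 : ℝ) : ℂ) *
    ((∑ k ∈ Finset.range (depth S + 1), ((Real.exp (ordTime T k / 2) * Real.exp (-t / 2) : ℝ) : ℂ) *
      contraction τ (plusVal x S T t M) (ncDerivLevel S i k (cycDerivLevel S i h P))) +
      -1 * traceN N τ (matEmb A N (M i) *
        FreeAlgebra.lift ℂ (plusVal x S T t M) (cycDerivLevel S i h P)))

theorem isPoly_traceN_matEmb_mul_plusVal (hTS : T.length = depth S) (hT : ∀ t ∈ T, 0 ≤ t) (i : Fin d)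
    (D : Poly d S) : IsPoly (Set.Ioi (ordTime T T.length))
      fun t (M : Fin d → Matrix (Fin N) (Fin N) ℂ) => traceN N τ (matEmb A N (M i) *
        FreeAlgebra.lift ℂ (plusVal x S T t M) D) :=
  ((IsPolyMat.matEmb (IsPolyMat.tuple i)).mul
    (IsPolyMat.lift (fun v => isPolyMat_plusVal hTS hT v) D)).traceN τ

theorem isPoly_contractedFlow_term (hTS : T.length = depth S) (hT : ∀ t ∈ T, 0 ≤ t) {t : ℝ}
    (ht : ordTime T T.length < t) (i : Fin d) (h : ℕ) (P : Poly d S) :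
    IsPoly (Set.univ : Set Unit) fun _ (M : Fin d → Matrix (Fin N) (Fin N) ℂ) =>
      ((Real.exp (ordTime T h / 2) / 2 : ℝ) : ℂ) * ((∑ k ∈ Finset.range (depth S + 1),
        ((Real.exp (ordTime T k / 2) * Real.exp (-t / 2) : ℝ) : ℂ) *
          contraction τ (plusVal x S T t M) (ncDerivLevel S i k (cycDerivLevel S i h P))) +
        -1 * traceN N τ (matEmb A N (M i) *
          FreeAlgebra.lift ℂ (plusVal x S T t M) (cycDerivLevel S i h P))) :=
  (IsPoly.const _).mul ((IsPoly.sum _ fun _ _ => (IsPoly.const _).mul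
    ((isPoly_contraction (fun v => isPolyMat_plusVal hTS hT v) _).at_param ht)).add
    ((IsPoly.const _).mul ((isPoly_traceN_matEmb_mul_plusVal hTS hT i _).at_param ht)))

theorem isPoly_contractedFlow (hTS : T.length = depth S) (hT : ∀ t ∈ T, 0 ≤ t) {t : ℝ}
    (ht : ordTime T T.length < t) (P : Poly d S) :
    IsPoly (Set.univ : Set Unit) fun _ (M : Fin d → Matrix (Fin N) (Fin N) ℂ) =>
      contractedFlow τ x T P t M :=
  IsPoly.sum _ fun i _ => IsPoly.sum _ fun h _ => isPoly_contractedFlow_term hTS hT ht i h P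

/-- Integration by parts produces the same contraction terms with the opposite sign, so only the
potential is left. -/
theorem expect_contractedFlow [IsProbabilityMeasure μ] (hτ : IsTrace τ) (hN : 1 ≤ N)
    (hX : IsGUETuple μ X)
    (hV : WeightIntegrable μ X V) (hTS : T.length = depth S) (hT : ∀ t ∈ T, 0 ≤ t) {t : ℝ}
    (ht : ordTime T T.length < t) (P : Poly d S) :
    expect μ X V (fun M => ((Real.exp (-t / 2) : ℝ) : ℂ) * contractedFlow τ x T P t M) =
      ∫ ω, weighted τ x V X (t :: T) (nablaV S V T t P) ω ∂μ := by
  have hZ := fun v => isPolyMat_plusVal (N := N) (d := d) (x := x) hTS hT v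
  have h2 : ∀ (c : ℂ) i D, IsPoly (Set.univ : Set Unit) fun _ M =>
      c * potentialTerm τ V i M (plusVal x S T t M) D := fun c i D =>
    (IsPoly.const c).mul ((isPoly_potentialTerm hZ i D).at_param ht)
  have h3 : ∀ (c : ℂ) i (D : Poly d S), IsPoly (Set.univ : Set Unit) fun _ M => c * traceN N τ
      (matEmb A N (M i) * FreeAlgebra.lift ℂ (plusVal x S T t M) D) := fun c i D =>
    (IsPoly.const c).mul ((isPoly_traceN_matEmb_mul_plusVal hTS hT i D).at_param ht)
  have h1 : ∀ (c : ℂ) R, IsPoly (Set.univ : Set Unit) fun _ M =>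
      c * contraction τ (plusVal x S T t M) R := fun c R =>
    (IsPoly.const c).mul ((isPoly_contraction hZ R).at_param ht)
  have hR : ∫ ω, weighted τ x V X (t :: T) (nablaV S V T t P) ω ∂μ =
      expect μ X V fun M => traceAt τ x (t :: T) (nablaV S V T t P) M := rfl
  simp only [hR, traceAt_nablaV hτ hTS hT ht.le, expect_const_mul]
  congr 1
  unfold contractedFlow
  refine (expect_sum hX hV _ fun i => IsPoly.sum _ fun h _ =>
    isPoly_contractedFlow_term hTS hT ht i h P).trans (Eq.trans ?_
    (expect_sum hX hV _ fun i => IsPoly.sum _ fun h _ => h2 _ _ _).symm)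
  refine Finset.sum_congr rfl fun i _ => ?_
  refine (expect_sum hX hV _ fun h => isPoly_contractedFlow_term hTS hT ht i h P).trans
    (Eq.trans ?_ (expect_sum hX hV _ fun h => h2 _ _ _).symm)
  refine Finset.sum_congr rfl fun h _ => ?_
  rw [expect_const_mul, expect_const_mul]
  congr 1
  refine (expect_add hX hV (IsPoly.sum _ fun k _ => h1 _ _) (h3 _ _ _)).trans ?_
  rw [expect_sum hX hV _ fun k => h1 _ _, expect_const_mul,
    expect_traceN_mul_plusVal hN hX hV hTS hT ht]
  simp only [expect_const_mul]
  ring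

/-- The two flows differ only by product against contraction, that is by `tensorSq_sub_contraction`;
the two factors e^{-t/2} combine to the e^{-t} in L. -/
theorem flow_eq_contractedFlow {slot : ℕ → ℕ} (hS : Slotted S slot) (hτ : IsTrace τ)
    (hN : 1 ≤ N) (hx : IsFreeSemicircularSequence N τ x) (hTS : T.length = depth S)
    (hT : ∀ t ∈ T, 0 ≤ t) {t : ℝ} (ht : ordTime T T.length < t) (P : Poly d S)
    (M : Fin d → Matrix (Fin N) (Fin N) ℂ) :
    ((Real.exp (-t / 2) : ℝ) : ℂ) * flow τ x T P t M =
      ((Real.exp (-t / 2) : ℝ) : ℂ) * contractedFlow τ x T P t M +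
        -(1 / (N : ℂ) ^ 2) * ∫ u in Set.Icc 0 t, traceAt τ x (u :: t :: T) (opL S T t u P) M := by
  have hint := fun R => integrableOn_copyL (τ := τ) (x := x) hTS hT t M R
  simp only [traceAt_opL hTS hT ht.le, integral_const_mul]
  rw [integral_finsetSum _ fun i _ => integrable_finsetSum _ fun h _ => integrable_finsetSum _
    fun k _ => (hint _).const_mul _]
  simp only [integral_finsetSum _ fun h _ => integrable_finsetSum _
    fun k _ => (hint _).const_mul _, integral_finsetSum _ fun k _ => (hint _).const_mul _,
    integral_const_mul]
  rw [flow, contractedFlow]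
  simp only [Finset.mul_sum, ← Finset.sum_add_distrib]
  refine Finset.sum_congr rfl fun i _ => Finset.sum_congr rfl fun h _ => ?_
  simp only [mul_add, Finset.mul_sum]
  rw [add_right_comm, ← Finset.sum_add_distrib]
  congr 1
  refine Finset.sum_congr rfl fun k _ => ?_
  rw [eq_add_of_sub_eq (tensorSq_sub_contraction hS hτ hN hx hTS hT ht M _),
    show (ordTime T h + ordTime T k) / 2 - t =
      ordTime T h / 2 + ordTime T k / 2 + (-t / 2 + -t / 2) by ring,
    Real.exp_add, Real.exp_add, Real.exp_add]
  push_cast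
  ring

/-! ### Integrability in the times -/

theorem isPoly_copies_comp (hTS : T.length = depth S) (hT : ∀ t ∈ T, 0 ≤ t) {α : Type*}
    [TopologicalSpace α] {U : Set α} {f : α → ℝ × ℝ} (hf : Continuous f)
    (hfU : ∀ a ∈ U, f a ∈ timeSet T)
    (Q : (Poly d S ⊗[ℂ] Poly d S) ⊗[ℂ] (Poly d S ⊗[ℂ] Poly d S)) :
    IsPoly U fun a (M : Fin d → Matrix (Fin N) (Fin N) ℂ) =>
      fourfold τ (copyVal x S T (f a).1 (f a).2 M) Q :=
  isPoly_fourfold (fun k o v r s => (isPolyMat_copyVal hTS hT k o v r s).comp_param hf hfU) Q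

/-- The factor e^{-t-u} supplies integrability in the times and polynomial growth that in the
matrices. The map f covers both uses: t fixed with u varying, and both times varying. -/
theorem integrable_opL_prod [SFinite μ] (hX : IsGUETuple μ X) (hV : WeightIntegrable μ X V)
    (hTS : T.length = depth S) (hT : ∀ t ∈ T, 0 ≤ t) (P : Poly d S) {α : Type*} [TopologicalSpace α]
    [SecondCountableTopology α] [MeasurableSpace α] [BorelSpace α] {ν : Measure α} [SFinite ν]
    {U : Set α} (hU : MeasurableSet U) {f : α → ℝ × ℝ} (hf : Continuous f)
    (hfU : ∀ a ∈ U, f a ∈ timeSet T)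
    (hint : IntegrableOn (fun a => Real.exp (-(f a).1) * Real.exp (-(f a).2)) U ν) :
    Integrable (fun p : α × Ω => weighted τ x V X ((f p.1).2 :: (f p.1).1 :: T)
      (opL S T (f p.1).1 (f p.1).2 P) p.2) ((ν.restrict U).prod μ) := by
  have hmem : ∀ᵐ p ∂(ν.restrict U).prod μ, p.1 ∈ U :=
    Measure.quasiMeasurePreserving_fst.ae (ae_restrict_mem hU)
  have hθ : ∀ l, Measurable fun a => topTime T (f a).1 l := fun l =>
    ((continuous_topTime T l).comp (continuous_fst.comp hf)).measurable
  have hf2 : Measurable fun a => (f a).2 := (continuous_snd.comp hf).measurable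
  set B : ℕ → Set α := fun s => {a | (f a).2 ∈ Set.Icc (topTime T (f a).1 s)
      (topTime T (f a).1 (s + 1))} with hB
  have hBm : ∀ s, MeasurableSet (B s) := fun s =>
    (measurableSet_le (hθ s) hf2).inter (measurableSet_le hf2 (hθ (s + 1)))
  set c : α → ℂ := fun a => ((Real.exp (-(f a).1) * Real.exp (-(f a).2) : ℝ) : ℂ) with hc
  have hint' : IntegrableOn c U ν := hint.ofReal
  have key : ∀ (s : ℕ) (Q : (Poly d S ⊗[ℂ] Poly d S) ⊗[ℂ] (Poly d S ⊗[ℂ] Poly d S)),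
      Integrable (fun p : α × Ω => (B s).indicator c p.1 *
        (fourfold τ (copyVal x S T (f p.1).1 (f p.1).2 fun i => X i p.2) Q *
          weight V fun i => X i p.2)) ((ν.restrict U).prod μ) := by
    intro s Q
    have hI : IntegrableOn ((B s).indicator c) U ν := Integrable.indicator hint' (hBm s)
    have hF := isPoly_copies_comp (N := N) (τ := τ) (x := x) hTS hT hf hfU Q
    clear_value c B
    exact IsPoly.integrable_prod (c := (B s).indicator c)
      (F := fun a M => fourfold τ (copyVal x S T (f a).1 (f a).2 M) Q) hX hV hU hI hF
  have hsum : Integrable (fun p : α × Ω => (1 / 2 : ℂ) * ∑ i : Fin d,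
      ∑ h ∈ Finset.range (depth S + 1), ∑ k ∈ Finset.range (depth S + 1),
        ((Real.exp ((ordTime T h + ordTime T k) / 2) : ℝ) : ℂ) * ∑ s : Fin (depth S + 1),
        (B s).indicator c p.1 *
        (fourfold τ (copyVal x S T (f p.1).1 (f p.1).2 fun i => X i p.2) (pairDeriv S T (s + 1)
          (ncDerivLevel S i k (cycDerivLevel S i h P))) *
          weight V fun i => X i p.2)) ((ν.restrict U).prod μ) := by
    refine Integrable.const_mul ?_ _
    refine integrable_finsetSum _ fun i _ => integrable_finsetSum _ fun h _ =>
      integrable_finsetSum _ fun k _ => ?_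
    refine Integrable.const_mul ?_ _
    refine integrable_finsetSum _ fun s _ => ?_
    exact key s (pairDeriv S T (s + 1) (ncDerivLevel S i k (cycDerivLevel S i h P)))
  refine hsum.congr ?_
  filter_upwards [hmem] with p hp
  rw [weighted, traceAt_opL hTS hT (hfU _ hp).1.le, mul_assoc, Finset.sum_mul]
  congr 1
  refine Finset.sum_congr rfl fun i _ => ?_
  rw [Finset.sum_mul]
  refine Finset.sum_congr rfl fun h _ => ?_
  rw [Finset.sum_mul]
  refine Finset.sum_congr rfl fun k _ => ?_
  rw [copyL, Finset.mul_sum, Finset.mul_sum, Finset.sum_mul]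
  refine Finset.sum_congr rfl fun s _ => ?_
  by_cases hs : (f p.1).2 ∈ Set.Icc (topTime T (f p.1).1 s) (topTime T (f p.1).1 (s + 1))
  · rw [Set.indicator_of_mem (s := B s) hs, Set.indicator_of_mem hs, sub_eq_add_neg,
      Real.exp_add, hc]
    push_cast
    ring
  · rw [Set.indicator_of_notMem (s := B s) hs, Set.indicator_of_notMem hs]
    ring

theorem integrableOn_integral_opL [SFinite μ] (hX : IsGUETuple μ X) (hV : WeightIntegrable μ X V)
    (hTS : T.length = depth S) (hT : ∀ t ∈ T, 0 ≤ t) (P : Poly d S) :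
    IntegrableOn (fun p : ℝ × ℝ =>
      ∫ ω, weighted τ x V X (p.2 :: p.1 :: T) (opL S T p.1 p.2 P) ω ∂μ) (timeSet T) := by
  have hexp : ∀ a : ℝ, IntegrableOn (fun t : ℝ => Real.exp (-t)) (Set.Ici a) := fun a =>
    (integrableOn_Ici_iff_integrableOn_Ioi).2 (integrableOn_exp_neg_Ioi a)
  have h2 : IntegrableOn (fun p : ℝ × ℝ => Real.exp (-p.1) * Real.exp (-p.2)) (timeSet T) := by
    have h := Integrable.mul_prod (hexp (ordTime T T.length)) (hexp 0)
    rw [Measure.prod_restrict, ← Measure.volume_eq_prod] at h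
    -- The region of times lies in a quadrant, on which e^{-t} e^{-u} is an integrable product.
    exact IntegrableOn.mono_set h fun p hp => ⟨hp.1.le, hp.2.1⟩
  exact (integrable_opL_prod hX hV hTS hT P (measurableSet_timeSet T) continuous_id
    (fun a ha => ha) h2).integral_prod_left

theorem integrableOn_integral_nablaV [SFinite μ] (hτ : IsTrace τ) (hX : IsGUETuple μ X)
    (hV : WeightIntegrable μ X V)
    (hTS : T.length = depth S) (hT : ∀ t ∈ T, 0 ≤ t) (P : Poly d S) :
    IntegrableOn (fun t : ℝ => ∫ ω, weighted τ x V X (t :: T) (nablaV S V T t P) ω ∂μ)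
      (Set.Ioi (ordTime T T.length)) := by
  have hpoly : IsPoly (Set.Ioi (ordTime T T.length))
      fun t (M : Fin d → Matrix (Fin N) (Fin N) ℂ) => ∑ i : Fin d,
        ∑ h ∈ Finset.range (depth S + 1), ((Real.exp (ordTime T h / 2) / 2 : ℝ) : ℂ) *
        potentialTerm τ V i M (plusVal x S T t M) (cycDerivLevel S i h P) :=
    IsPoly.sum _ fun i _ => IsPoly.sum _ fun h _ => (IsPoly.const _).mul
      (isPoly_potentialTerm (fun v => isPolyMat_plusVal hTS hT v) i _)
  have h := (IsPoly.integrable_prod hX hV measurableSet_Ioi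
    (integrableOn_exp_neg_half _) hpoly).integral_prod_left
  refine IntegrableOn.congr_fun h (fun t ht => ?_) measurableSet_Ioi
  refine integral_congr_ae (ae_of_all _ fun ω => ?_)
  simp only [weighted]
  rw [traceAt_nablaV hτ hTS hT (le_of_lt ht), mul_assoc]

/-! ### The equation -/

/-- Combines the pointwise comparison of the flows with integration by parts; Fubini moves the
expectation inside the integral over u. -/
theorem expect_flow [IsProbabilityMeasure μ] {slot : ℕ → ℕ} (hS : Slotted S slot) (hτ : IsTrace τ)
    (hN : 1 ≤ N) (hx : IsFreeSemicircularSequence N τ x) (hX : IsGUETuple μ X)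
    (hV : WeightIntegrable μ X V) (hTS : T.length = depth S)
    (hT : ∀ t ∈ T, 0 ≤ t) {t : ℝ} (ht : ordTime T T.length < t) (P : Poly d S) :
    expect μ X V (fun M => ((Real.exp (-t / 2) : ℝ) : ℂ) * flow τ x T P t M) =
      (∫ ω, weighted τ x V X (t :: T) (nablaV S V T t P) ω ∂μ) +
        -(1 / (N : ℂ) ^ 2) * ∫ u in Set.Icc 0 t,
          (∫ ω, weighted τ x V X (u :: t :: T) (opL S T t u P) ω ∂μ) := by
  have hcont : Continuous fun u : ℝ => Real.exp (-t) * Real.exp (-u) := by fun_prop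
  have hprod := integrable_opL_prod (τ := τ) (x := x) hX hV hTS hT P (f := fun u : ℝ => (t, u))
    (U := Set.Icc 0 t) (ν := volume) measurableSet_Icc (Continuous.prodMk_right t)
    (fun u hu => ⟨ht, hu.1, hu.2⟩) hcont.continuousOn.integrableOn_Icc
  rw [integral_integral_swap hprod, ← expect_contractedFlow hτ hN hX hV hTS hT ht P]
  have hcf : Integrable (fun ω => ((Real.exp (-t / 2) : ℝ) : ℂ) *
      contractedFlow τ x T P t (fun i => X i ω) * weight V fun i => X i ω) μ :=
    ((IsPoly.const _).mul (isPoly_contractedFlow hTS hT ht P)).integrable hX hV (a := ()) trivial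
  simp only [expect, flow_eq_contractedFlow hS hτ hN hx hTS hT ht P, add_mul]
  rw [integral_add hcf]
  · congr 1
    rw [← integral_const_mul]
    refine integral_congr_ae (ae_of_all _ fun ω => ?_)
    simp only [weighted, mul_assoc, integral_mul_const]
  · have := hprod.integral_prod_right.const_mul (-(1 / (N : ℂ) ^ 2))
    refine this.congr (ae_of_all _ fun ω => ?_)
    simp only [weighted, mul_assoc, integral_mul_const]

theorem master_equation [IsProbabilityMeasure μ] {slot : ℕ → ℕ} (hS : Slotted S slot)
    (hτ : IsTrace τ) (hN : 1 ≤ N) (hx : IsFreeSemicircularSequence N τ x) (hX : IsGUETuple μ X)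
    (hV : WeightIntegrable μ X V) (hTS : T.length = depth S) (hT : ∀ t ∈ T, 0 ≤ t)
    (P : Poly d S) :
    (∫ ω, weighted τ x V X T P ω ∂μ) =
      traceFree τ x T P * (∫ ω, weight V (fun i => X i ω) ∂μ)
      - (∫ t in Set.Ioi (ordTime T T.length),
          (∫ ω, weighted τ x V X (t :: T) (nablaV S V T t P) ω ∂μ))
      + (1 / (N : ℂ) ^ 2) * (∫ t in Set.Ioi (ordTime T T.length), (∫ u in Set.Icc 0 t,
          (∫ ω, weighted τ x V X (u :: t :: T) (opL S T t u P) ω ∂μ))) := by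
  have hprod := IsPoly.integrable_prod hX hV measurableSet_Ioi
    (integrableOn_exp_neg_half (ordTime T T.length)) (isPoly_flow (τ := τ) (x := x) hTS hT P)
  have hE : ∀ t, ∫ ω, ((Real.exp (-t / 2) : ℝ) : ℂ) * (flow τ x T P t (fun i => X i ω) *
      weight V fun i => X i ω) ∂μ =
      expect μ X V (fun M => ((Real.exp (-t / 2) : ℝ) : ℂ) * flow τ x T P t M) := fun t => by
    simp only [expect, mul_assoc]
  have hL : ∫ ω, (∫ t in Set.Ioi (ordTime T T.length), ((Real.exp (-t / 2) : ℝ) : ℂ) *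
      (flow τ x T P t (fun i => X i ω) * weight V fun i => X i ω)) ∂μ =
      traceFree τ x T P * (∫ ω, weight V (fun i => X i ω) ∂μ) -
        ∫ ω, weighted τ x V X T P ω ∂μ := by
    rw [← integral_const_mul, ← integral_sub ((integrable_weight hX hV).const_mul _) (integrable_weighted hX hV T P)]
    refine integral_congr_ae (ae_of_all _ fun ω => ?_)
    simp only [← mul_assoc, integral_mul_const]
    rw [integral_flow hS hτ hN hx hTS hT, sub_mul, weighted]
  have hR : ∫ t in Set.Ioi (ordTime T T.length), (∫ ω, ((Real.exp (-t / 2) : ℝ) : ℂ) *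
      (flow τ x T P t (fun i => X i ω) * weight V fun i => X i ω) ∂μ) =
      (∫ t in Set.Ioi (ordTime T T.length),
          (∫ ω, weighted τ x V X (t :: T) (nablaV S V T t P) ω ∂μ))
      - (1 / (N : ℂ) ^ 2) * (∫ t in Set.Ioi (ordTime T T.length), (∫ u in Set.Icc 0 t,
          (∫ ω, weighted τ x V X (u :: t :: T) (opL S T t u P) ω ∂μ))) := by
    -- The L-term is represented as the ∇_V-term minus the flow, both integrable in t, so the outer
    -- integral splits.
    have h := integral_sub (integrableOn_integral_nablaV (x := x) hτ hX hV hTS hT P)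
      hprod.integral_prod_left
    rw [eq_sub_iff_add_eq, ← eq_sub_iff_add_eq', ← h, ← integral_const_mul]
    refine setIntegral_congr_fun measurableSet_Ioi fun t ht => ?_
    simp only [hE]
    rw [expect_flow hS hτ hN hx hX hV hTS hT ht]
    ring
  rw [integral_integral_swap hprod, hL] at hR
  linear_combination -hR

end Expectation

end

end MasterEquation

theorem theorem3p4 {A : Type*} [CStarAlgebra A] (τ : A →L[ℂ] ℂ) (hτ : IsTrace τ)
    {Ω : Type*} [MeasurableSpace Ω] (μ : Measure Ω) [IsProbabilityMeasure μ]
    (N d : ℕ) (hN : 1 ≤ N)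
    (X : Fin d → Ω → Matrix (Fin N) (Fin N) ℂ) (hX : IsGUETuple μ X)
    (x : ℕ → Fin d → Matrix (Fin N) (Fin N) A) (hx : IsFreeSemicircularSequence N τ x)
    (V : FreeAlgebra ℂ (Fin d))
    (hV : ∀ Q : FreeAlgebra ℂ (Fin d), Integrable (fun ω =>
      (1 / (N : ℂ)) * (FreeAlgebra.lift ℂ (fun i => X i ω) Q).trace *
        weight V (fun i => X i ω)) μ)
    (H : List Step) (hH : Admissible H)
    (T : List ℝ) (hT : T.length = depth (indexSet H)) (hT0 : ∀ t ∈ T, 0 ≤ t)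
    (P : MasterEquation.Poly d (indexSet H)) :
    -- the expectations and the time integrals below are well-defined
    (Integrable (fun ω => weight V (fun i => X i ω)) μ ∧
      Integrable (fun ω => weighted τ x V X T P ω) μ ∧
      (∀ t : ℝ, Integrable
        (fun ω => weighted τ x V X (t :: T) (nablaV (indexSet H) V T t P) ω) μ) ∧
      (∀ t u : ℝ, Integrable
        (fun ω => weighted τ x V X (u :: t :: T) (opL (indexSet H) T t u P) ω) μ) ∧
      IntegrableOn
        (fun t : ℝ => ∫ ω, weighted τ x V X (t :: T) (nablaV (indexSet H) V T t P) ω ∂μ)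
        (Set.Ioi (ordTime T T.length)) ∧
      IntegrableOn
        (fun p : ℝ × ℝ =>
          ∫ ω, weighted τ x V X (p.2 :: p.1 :: T) (opL (indexSet H) T p.1 p.2 P) ω ∂μ)
        {p : ℝ × ℝ | ordTime T T.length < p.1 ∧ 0 ≤ p.2 ∧ p.2 ≤ p.1}) ∧
    -- the master equation
    (∫ ω, weighted τ x V X T P ω ∂μ) =
      traceFree τ x T P * (∫ ω, weight V (fun i => X i ω) ∂μ)
      - (∫ t in Set.Ioi (ordTime T T.length),
          (∫ ω, weighted τ x V X (t :: T) (nablaV (indexSet H) V T t P) ω ∂μ))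
      + (1 / (N : ℂ) ^ 2) * (∫ t in Set.Ioi (ordTime T T.length), (∫ u in Set.Icc 0 t,
          (∫ ω, weighted τ x V X (u :: t :: T) (opL (indexSet H) T t u P) ω ∂μ))) := by
  obtain ⟨slot, hS⟩ := exists_slotted_indexSet H
  have hW : WeightIntegrable μ X V := fun k => integrable_gnorm_pow V hV hN hX k
  exact ⟨⟨integrable_weight hX hW, integrable_weighted hX hW T P, fun t => integrable_weighted hX hW _ _,
    fun t u => integrable_weighted hX hW _ _, integrableOn_integral_nablaV hτ hX hW hT hT0 P,
    integrableOn_integral_opL hX hW hT hT0 P⟩, master_equation hS hτ hN hx hX hW hT hT0 P⟩
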